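/- **Setting.** Fix $m$ and a sequence $\pi=(\pi_n)_{n\ge1}$ of finite partitions $0=t^n_0<\dots<t^n_{k_n}<\infty$ with $t^n_{k_n}\to\infty$ and mesh tending to $0$ on compacts. For a càdlàg path $x:[0,\infty)\to\mathbb R^m$ put $x(0-)=x(0)$, $\Delta x(t)=x(t)-x(t-)$, $x_t=x(\cdot\wedge t)$, $x_{t-}=x1_{[0,t)}+x(t-)1_{[t,\infty)}$, $x^n=\sum_{i<k_n}x(t^n_{i+1})1_{[t^n_i,t^n_{i+1})}$ and $t'_n=\max\{t_i\in\pi_n: t_i<t\}$ ($\max\emptyset=0$). The path $x$ has finite quadratic variation along $\pi$ if $q_n(t)=\sum_{t^n_i\le t}(x(t^n_{i+1})-x(t^n_i))(x(t^n_{i+1})-x(t^n_i))'$ converges in the Skorokhod $J_1$ topology; the càdlàg limit is $[x]$. Let $\Omega$ be a non-empty set of càdlàg paths with finite quadratic variation along $\pi$ that is *generic*: (i) for $x\in\Omega$, $T>0$, $(x^n)_T\in\Omega$ for all large $n$; (ii) for $x\in\Omega$, $t\ge0$ there is a convex neighbourhood $\mathcal U$ of $0$ with $-\Delta x(t)\in\mathcal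 U$ and $x_t+e1_{[t,\infty)}\in\Omega$ for all $e\in\mathcal U$. Let $\Lambda=\{(t,x_t):t\ge0,\ x\in\Omega\}$. **Functionals.** For $F:\Lambda\to\mathbb R$ put $F_-(t,x_t)=F(t,x_{t-})$; $F$ is *strictly causal* if $F=F_-$. $F$ is *left-continuous* if for all $x\in\Omega$, $t\ge0$: $F(s,x_{s-})\to F(t,x_{t-})$ as $s\uparrow t$, $s\le t$; $F(s,x_s)\to F(t,x_{t-})$ as $s\uparrow t$, $s<t$; and for every sequence $t_n\to t$, $F(t_n,x^n_{t_n-})\to F(t,x_{t-})$ if $t_n\le t'_n$ eventually, and $F(t_n,x^n_{t_n})\to F(t,x_{t-})$ if $t_n<t'_n$ eventually. It is *right-continuous* if $F(s,x_s)\to F(t,x_t)$ as $s\downarrow t$, $s\ge t$; $F(s,x_{s-})\to F(t,x_t)$ as $s\downarrow t$, $s>t$; and for $t_n\to t$, $F(t_n,x^n_{t_n})\to F(t,x_t)$ if $t_n\ge t'_n$ eventually, and $F(t_n,x^n_{t_n-})\to F(t,x_t)$ if $t_n>t'_n$ eventually. *Continuous* means continuous for the $\pi$-topology, the initial topology on $\Lambda$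 generated by all functionals that are both left- and right-continuous. $F$ is *locally bounded* if for all $x\in\Omega$, $T\ge0$ there is $n_0$ such that $F(t,x^n_t)$ is bounded uniformly in $t\le T$, $n\ge n_0$. $F$ *admits a modulus of vertical continuity* if for all $x\in\Omega$, $T\ge0$, $r>0$ there is an increasing $\omega:\mathbb R_+\to\mathbb R_+$ with $\omega(0+)=0$ such that for all large $n$ and all $t\le T$, $|F(t,x^n_{t-}+a1_{[t,\infty)})-F(t,x^n_{t-}+b1_{[t,\infty)})|\le\omega(|a-b|)$ for all $a,b\in\Delta x^n(t)+\mathcal U$ with $|a|,|b|\le r$, where $\mathcal U$ is some neighbourhood as in (ii) for $x^n$ at $t$. These notions are extended componentwise to vector- and matrix-valued functionals. The horizontal derivative is $\mathcal DF(t,x_t)=\lim_{h\downarrow0}(F(t+h,x_t)-F(t,x_t))/h$; the vertical derivative $\nabla_xF(t,x_t)$ is the gradient at $e=0$ of $e\mapsto F(t,x_t+e1_{[t,\infty)})$; $\nabla_x^2F=\nabla_x(\nabla_xF)$. $F\in C^{1,2}(\Lambda)$ means: $F$ is continuous; $\mathcal DF,\nabla_xF,\nabla_x^2F$ exist on $\Lambda$;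 $\mathcal DF$ is right-continuous and locally bounded; $(\nabla_xF)_-$ is left-continuous; $(\nabla^2_xF)_-$ is left-continuous and locally bounded; $\nabla_x^2F$ admits a modulus of vertical continuity. $F$ is of *class $\mathcal M$* if $F$ is continuous, $\mathcal DF$ and $\nabla_xF$ exist on $\Lambda$, $\mathcal DF=0$, and $\nabla_xF$ is left-continuous and strictly causal. For $\phi:\Lambda\to\mathbb R^m$ and $x\in\Omega$, $\int_0^t\phi(s,x_{s-})\,dx:=\lim_n\sum_{t^n_i\le t}\phi(t^n_i,x^n_{t^n_i-})\cdot(x(t^n_{i+1})-x(t^n_i))$ when the limit exists. **Theorem (Representation of $\Sigma$-harmonic functionals).** Let $\Sigma$ be a right-continuous function on $\Lambda$ with values in the positive-definite symmetric $m\times m$ matrices, and let $\Omega_\Sigma$ be the set of $x\in\Omega$ whose quadratic variation $[x]$ is absolutely continuous with Lebesgue density $t\mapsto\Sigma(t,x_t)$. Suppose $F\in C^{1,2}(\Lambda)$ is $\Sigma$-harmonic, i.e. $$\mathcal DF(t,x_t)+\tfrac12\langle\nabla_x^2F(t,x_t),\Sigma(t,x_t)\rangle=0\qquad\text{for all }x\in\Omega_\Sigma,\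 t\ge0.$$ Then for all $x\in\Omega$, $t\ge0$ the integral $\int_0^t\nabla_xF(s,x_{s-})\,dx$ exists, and $$M(t,x_t)=F(0,x_0)+\int_0^t\nabla_xF(s,x_{s-})\,dx$$ defines a functional $M:\Lambda\to\mathbb R$ of class $\mathcal M$ with $M(t,x_t)=F(t,x_t)$ for all $x\in\Omega_\Sigma$, $t\ge0$. On $\Omega_\Sigma$, $M$ is uniquely determined: any functional on $\Lambda$ that coincides with $F$ along the paths of $\Omega_\Sigma$, or that satisfies the displayed formula for $M$ along the paths of $\Omega_\Sigma$, coincides with $M$ along these paths. -/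

import Mathlib

open Filter Topology
open scoped NNReal

noncomputable section

namespace CausalCalculus

/-- The state space `ℝ^m` with its Euclidean norm. -/
abbrev Vec (m : ℕ) := EuclideanSpace ℝ (Fin m)

/-- Paths `[0,∞) → ℝ^m`. -/
abbrev CPath (m : ℕ) := ℝ≥0 → Vec m

/-- A sequence of finite partitions `0 = t n 0 < t n 1 < ... < t n (k n)` whose last points tend to
infinity and whose mesh vanishes on compacts.  The values `t n i` with `i > k n` play no role. -/
structure PartitionSeq where
  k : ℕ → ℕ
  t : ℕ → ℕ → ℝ≥0
  t_zero : ∀ n, t n 0 = 0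
  strictMono : ∀ n, StrictMonoOn (t n) (Set.Iic (k n))
  tendsto_last : Tendsto (fun n => t n (k n)) atTop atTop
  mesh : ∀ T : ℝ≥0, ∀ ε : ℝ, 0 < ε →
    ∀ᶠ n in atTop, ∀ i < k n, t n i ≤ T → (t n (i + 1) : ℝ) - t n i < ε

/-- `max {t_i < t | t_i ∈ π_n}`, with the convention `max ∅ = 0`. -/
def PartitionSeq.prev (P : PartitionSeq) (n : ℕ) (t : ℝ≥0) : ℝ≥0 :=
  ((Finset.range (P.k n + 1)).filter (fun i => P.t n i < t)).sup (P.t n)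

section Paths

variable {m : ℕ}

/-- Right continuous with left limits. -/
def IsCadlag {V : Type*} [TopologicalSpace V] (x : ℝ≥0 → V) : Prop :=
  ∀ t, ContinuousWithinAt x (Set.Ici t) t ∧ ∃ l, Tendsto x (𝓝[<] t) (𝓝 l)

/-- The path `x_t` stopped at `t`. -/
def stopAt (x : CPath m) (t : ℝ≥0) : CPath m := fun s => x (min s t)

/-- The path `x_{t-}`, equal to `x` before `t` and to `x(t-)` from `t` on.
Here `Function.leftLim x 0 = x 0`, which is the convention `x(0-) = x(0)`. -/
def stopAtLeft (x : CPath m) (t : ℝ≥0) : CPath m :=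
  fun s => if s < t then x s else Function.leftLim x t

/-- The jump `Δx(t) = x(t) - x(t-)`. -/
def jump (x : CPath m) (t : ℝ≥0) : Vec m := x t - Function.leftLim x t

/-- The path `e 1_{[t,∞)}`. -/
def bump (t : ℝ≥0) (e : Vec m) : CPath m := fun s => if t ≤ s then e else 0

/-- The piecewise constant approximation `x^n = ∑ x(t_{i+1}) 1_{[t_i,t_{i+1})}`. -/
def approx (P : PartitionSeq) (x : CPath m) (n : ℕ) : CPath m := fun s =>
  ∑ i ∈ Finset.range (P.k n),
    if P.t n i ≤ s ∧ s < P.t n (i + 1) then x (P.t n (i + 1)) else 0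

/-- Convergence of a sequence in the Skorokhod `J₁` topology on `[0,∞)`: there are time changes
`lam n` (increasing bijections of `[0,∞)`) converging uniformly to the identity, such that
`y n ∘ lam n` converges to `z` uniformly on compacts. -/
def TendstoJ1 {V : Type*} [UniformSpace V] (y : ℕ → ℝ≥0 → V) (z : ℝ≥0 → V) : Prop :=
  ∃ lam : ℕ → ℝ≥0 ≃o ℝ≥0,
    TendstoUniformly (fun n s => lam n s) (fun s => s) atTop ∧
    ∀ T : ℝ≥0, TendstoUniformlyOn (fun n s => y n (lam n s)) z atTop (Set.Iic T)

/-- `q_n(t) = ∑_{t_i ≤ t} (x(t_{i+1}) - x(t_i)) (x(t_{i+1}) - x(t_i))'`. -/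
def quadSum (P : PartitionSeq) (x : CPath m) (n : ℕ) (t : ℝ≥0) : Matrix (Fin m) (Fin m) ℝ :=
  ∑ i ∈ (Finset.range (P.k n)).filter (fun i => P.t n i ≤ t),
    Matrix.of fun a b =>
      (x (P.t n (i + 1)) a - x (P.t n i) a) * (x (P.t n (i + 1)) b - x (P.t n i) b)

/-- `q` is the quadratic variation `[x]` of `x` along the partition sequence. -/
def IsQuadVar (P : PartitionSeq) (x : CPath m) (q : ℝ≥0 → Matrix (Fin m) (Fin m) ℝ) : Prop :=
  IsCadlag q ∧ TendstoJ1 (quadSum P x) q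

/-- The set `Q^π_m` of càdlàg paths with finite quadratic variation along `π`. -/
def finiteQV (P : PartitionSeq) (m : ℕ) : Set (CPath m) :=
  {x | IsCadlag x ∧ ∃ q, IsQuadVar P x q}

/-- `U` is a convex neighbourhood of `0` that contains `-Δx(t)` and is such that
`x_t + e 1_{[t,∞)} ∈ Ω` for all `e ∈ U`. -/
def IsVertNhd (Ω : Set (CPath m)) (x : CPath m) (t : ℝ≥0) (U : Set (Vec m)) : Prop :=
  Convex ℝ U ∧ U ∈ 𝓝 (0 : Vec m) ∧ -jump x t ∈ U ∧ ∀ e ∈ U, stopAt x t + bump t e ∈ Ω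

/-- Generic sets of paths. -/
structure IsGeneric (P : PartitionSeq) (Ω : Set (CPath m)) : Prop where
  nonempty : Ω.Nonempty
  cadlag : ∀ x ∈ Ω, IsCadlag x
  approx_mem : ∀ x ∈ Ω, ∀ T : ℝ≥0, 0 < T → ∃ N, ∀ n ≥ N, stopAt (approx P x n) T ∈ Ω
  vert : ∀ x ∈ Ω, ∀ t, ∃ U, IsVertNhd Ω x t U

/-- The set of stopped paths `Λ = {(t, x_t) | t ≥ 0, x ∈ Ω}`. -/
def domain (Ω : Set (CPath m)) : Set (ℝ≥0 × CPath m) := {z | ∃ x ∈ Ω, z.2 = stopAt x z.1}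

/-- The point `(t, x_t)` of `Λ`. -/
def pt {Ω : Set (CPath m)} {x : CPath m} (hx : x ∈ Ω) (t : ℝ≥0) : domain Ω :=
  ⟨(t, stopAt x t), x, hx, rfl⟩

end Paths

section Functionals

variable {m : ℕ} {Ω : Set (CPath m)}

open Classical in
/-- The value `F(t, y)`; it is only meaningful if `(t, y) ∈ Λ`. -/
def val {V : Type*} [Zero V] (F : domain Ω → V) (t : ℝ≥0) (y : CPath m) : V :=
  if h : (t, y) ∈ domain Ω then F ⟨(t, y), h⟩ else 0

/-- `F_-(t, x_t) = F(t, x_{t-})`. -/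
def minus {V : Type*} [Zero V] (F : domain Ω → V) : domain Ω → V :=
  fun z => val F z.1.1 (stopAtLeft z.1.2 z.1.1)

/-- `F` is strictly causal if `F = F_-`. -/
def StrictlyCausal {V : Type*} [Zero V] (F : domain Ω → V) : Prop := F = minus F

/-- Left-continuous functionals. -/
structure LeftCts (P : PartitionSeq) (F : domain Ω → ℝ) : Prop where
  a : ∀ x ∈ Ω, ∀ t,
    Tendsto (fun s => val F s (stopAtLeft x s)) (𝓝[≤] t) (𝓝 (val F t (stopAtLeft x t)))
  b : ∀ x ∈ Ω, ∀ t,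
    Tendsto (fun s => val F s (stopAt x s)) (𝓝[<] t) (𝓝 (val F t (stopAtLeft x t)))
  c : ∀ x ∈ Ω, ∀ t, ∀ u : ℕ → ℝ≥0, Tendsto u atTop (𝓝 t) → (∀ᶠ n in atTop, u n ≤ P.prev n t) →
    Tendsto (fun n => val F (u n) (stopAtLeft (approx P x n) (u n))) atTop
      (𝓝 (val F t (stopAtLeft x t)))
  d : ∀ x ∈ Ω, ∀ t, ∀ u : ℕ → ℝ≥0, Tendsto u atTop (𝓝 t) → (∀ᶠ n in atTop, u n < P.prev n t) →
    Tendsto (fun n => val F (u n) (stopAt (approx P x n) (u n))) atTop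
      (𝓝 (val F t (stopAtLeft x t)))

/-- Right-continuous functionals. -/
structure RightCts (P : PartitionSeq) (F : domain Ω → ℝ) : Prop where
  a : ∀ x ∈ Ω, ∀ t,
    Tendsto (fun s => val F s (stopAt x s)) (𝓝[≥] t) (𝓝 (val F t (stopAt x t)))
  b : ∀ x ∈ Ω, ∀ t,
    Tendsto (fun s => val F s (stopAtLeft x s)) (𝓝[>] t) (𝓝 (val F t (stopAt x t)))
  c : ∀ x ∈ Ω, ∀ t, ∀ u : ℕ → ℝ≥0, Tendsto u atTop (𝓝 t) → (∀ᶠ n in atTop, P.prev n t ≤ u n) →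
    Tendsto (fun n => val F (u n) (stopAt (approx P x n) (u n))) atTop
      (𝓝 (val F t (stopAt x t)))
  d : ∀ x ∈ Ω, ∀ t, ∀ u : ℕ → ℝ≥0, Tendsto u atTop (𝓝 t) → (∀ᶠ n in atTop, P.prev n t < u n) →
    Tendsto (fun n => val F (u n) (stopAtLeft (approx P x n) (u n))) atTop
      (𝓝 (val F t (stopAt x t)))

/-- The `π`-topology on `Λ`: the initial topology generated by the functionals that are both
left- and right-continuous. -/
@[reducible] def piTopology (P : PartitionSeq) (Ω : Set (CPath m)) : TopologicalSpace (domain Ω) :=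
  ⨅ G ∈ {G : domain Ω → ℝ | LeftCts P G ∧ RightCts P G},
    TopologicalSpace.induced G inferInstance

/-- Continuity with respect to the `π`-topology. -/
def PiContinuous (P : PartitionSeq) (F : domain Ω → ℝ) : Prop :=
  @Continuous _ _ (piTopology P Ω) inferInstance F

/-- Existence of the horizontal derivative on all of `Λ`. -/
def HorizDifferentiable (F : domain Ω → ℝ) : Prop :=
  ∀ z : domain Ω, ∃ l : ℝ,
    Tendsto (fun h : ℝ≥0 => (val F (z.1.1 + h) z.1.2 - F z) / (h : ℝ)) (𝓝[>] 0) (𝓝 l)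

/-- The horizontal derivative `𝒟F`. -/
def horizDeriv (F : domain Ω → ℝ) : domain Ω → ℝ := fun z =>
  limUnder (𝓝[>] (0 : ℝ≥0)) fun h : ℝ≥0 => (val F (z.1.1 + h) z.1.2 - F z) / (h : ℝ)

/-- Existence of the vertical derivative on all of `Λ`. -/
def VertDifferentiable (F : domain Ω → ℝ) : Prop :=
  ∀ z : domain Ω, DifferentiableAt ℝ (fun e : Vec m => val F z.1.1 (z.1.2 + bump z.1.1 e)) 0

/-- The vertical derivative `∇ₓF`. -/
def vertGrad (F : domain Ω → ℝ) : domain Ω → Vec m := fun z =>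
  gradient (fun e : Vec m => val F z.1.1 (z.1.2 + bump z.1.1 e)) 0

/-- The `i`-th component of the vertical derivative. -/
def vertGradComp (F : domain Ω → ℝ) (i : Fin m) : domain Ω → ℝ := fun z => vertGrad F z i

/-- The `(i, j)` entry of the second vertical derivative `∇ₓ²F = ∇ₓ(∇ₓF)`. -/
def vertHess (F : domain Ω → ℝ) (i j : Fin m) : domain Ω → ℝ :=
  vertGradComp (vertGradComp F i) j

/-- Local boundedness: the maps `t ↦ F(t, x^n_t)` are bounded on `[0,T]` uniformly in `n ≥ n₀`. -/
def LocBounded (P : PartitionSeq) (F : domain Ω → ℝ) : Prop :=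
  ∀ x ∈ Ω, ∀ T : ℝ≥0, ∃ n₀ : ℕ, ∃ K : ℝ, ∀ n ≥ n₀, ∀ t ≤ T,
    |val F t (stopAt (approx P x n) t)| ≤ K

/-- Modulus of vertical continuity.  The increments `a`, `b` range over a convex set
`Δx^n(t) + U`, where `U` is a neighbourhood of `0` as in the definition of a generic set for
the path `x^n` at time `t`, so that `x^n_{t-} + a 1_{[t,∞)} = x^n_t + (a - Δx^n(t)) 1_{[t,∞)}`
lies in `Ω`. -/
def HasVertModulus (P : PartitionSeq) (F : domain Ω → ℝ) : Prop :=
  ∀ x ∈ Ω, ∀ T : ℝ≥0, ∀ r : ℝ, 0 < r →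
    ∃ ω : ℝ≥0 → ℝ≥0, Monotone ω ∧ Tendsto ω (𝓝[>] 0) (𝓝 0) ∧
      ∃ N : ℕ, ∀ n ≥ N, ∀ t ≤ T, ∃ U, IsVertNhd Ω (approx P x n) t U ∧
        ∀ a b : Vec m, a - jump (approx P x n) t ∈ U → b - jump (approx P x n) t ∈ U →
          ‖a‖ ≤ r → ‖b‖ ≤ r →
          |val F t (stopAtLeft (approx P x n) t + bump t a) -
            val F t (stopAtLeft (approx P x n) t + bump t b)| ≤ ω ‖a - b‖₊

/-- The class `C^{1,2}(Λ)`. -/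
structure IsC12 (P : PartitionSeq) (F : domain Ω → ℝ) : Prop where
  continuous : PiContinuous P F
  horizDifferentiable : HorizDifferentiable F
  vertDifferentiable : VertDifferentiable F
  vertDifferentiable_grad : ∀ i, VertDifferentiable (vertGradComp F i)
  horizDeriv_rightCts : RightCts P (horizDeriv F)
  horizDeriv_locBounded : LocBounded P (horizDeriv F)
  grad_leftCts : ∀ i, LeftCts P (minus (vertGradComp F i))
  hess_leftCts : ∀ i j, LeftCts P (minus (vertHess F i j))
  hess_locBounded : ∀ i j, LocBounded P (minus (vertHess F i j))
  hess_modulus : ∀ i j, HasVertModulus P (vertHess F i j)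

/-- The class `𝒮(Λ)`. -/
structure IsClassS (P : PartitionSeq) (F : domain Ω → ℝ) : Prop where
  continuous : PiContinuous P F
  horizDifferentiable : HorizDifferentiable F
  vertDifferentiable : VertDifferentiable F
  horizDeriv_rightCts : RightCts P (horizDeriv F)
  horizDeriv_locBounded : LocBounded P (horizDeriv F)
  grad_leftCts : ∀ i, LeftCts P (vertGradComp F i)
  grad_strictlyCausal : StrictlyCausal (vertGrad F)

/-- The class `ℳ(Λ)`. -/
def IsClassM (P : PartitionSeq) (F : domain Ω → ℝ) : Prop :=
  IsClassS P F ∧ ∀ z, horizDeriv F z = 0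

/-- The left Riemann sum `∑_{t_i ≤ T} φ(t_i, x^n_{t_i-}) · (x(t_{i+1}) - x(t_i))`. -/
def riemannSum (P : PartitionSeq) (φ : domain Ω → Vec m) (x : CPath m) (T : ℝ≥0) (n : ℕ) : ℝ :=
  ∑ i ∈ (Finset.range (P.k n)).filter (fun i => P.t n i ≤ T),
    inner ℝ (val φ (P.t n i) (stopAtLeft (approx P x n) (P.t n i)))
      (x (P.t n (i + 1)) - x (P.t n i))

/-- The pathwise integral `∫₀ᵀ φ(s, x_{s-}) dx` exists, as the limit of the left Riemann sums,
and equals `I`. -/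
def HasPathIntegral (P : PartitionSeq) (φ : domain Ω → Vec m) (x : CPath m) (T : ℝ≥0) (I : ℝ) :
    Prop :=
  Tendsto (riemannSum P φ x T) atTop (𝓝 I)

/-- The set `Ω_Σ` of paths in `Ω` whose quadratic variation is absolutely continuous with
Lebesgue density `s ↦ Σ(s, x_s)`. -/
def pathsWithDensity (P : PartitionSeq) (Ω : Set (CPath m))
    (S : domain Ω → Matrix (Fin m) (Fin m) ℝ) : Set (CPath m) :=
  {x | ∃ hx : x ∈ Ω,
    (∀ (t : ℝ≥0) (i j : Fin m),
      IntervalIntegrable (fun s : ℝ => S (pt hx s.toNNReal) i j) MeasureTheory.volume 0 t) ∧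
    IsQuadVar P x fun t => Matrix.of fun i j => ∫ s in (0 : ℝ)..t, S (pt hx s.toNNReal) i j}

/-- `F ∈ C^{1,2}(Λ)` is `Σ`-harmonic: `𝒟F + ½⟨∇ₓ²F, Σ⟩ = 0` along all paths of `Ω_Σ`. -/
def IsHarmonic (P : PartitionSeq) (S : domain Ω → Matrix (Fin m) (Fin m) ℝ)
    (F : domain Ω → ℝ) : Prop :=
  IsC12 P F ∧ ∀ x (hx : x ∈ Ω), x ∈ pathsWithDensity P Ω S → ∀ t,
    horizDeriv F (pt hx t) +
      (1 / 2) * ∑ i, ∑ j, vertHess F i j (pt hx t) * S (pt hx t) i j = 0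

end Functionals

end CausalCalculus

end

open CausalCalculus

open Filter Topology
open scoped NNReal

noncomputable section

namespace CausalCalculus

open Set MeasureTheory

/-! ### Partition points and the last point before a given time -/

namespace PartitionSeq

variable (P : PartitionSeq)

/-! Along a step approximation x^n a functional moves in two ways only: horizontally between
partition points, where the stopped path is frozen and the fundamental theorem of calculus applies,
and vertically at partition points. Telescoping, and splitting each vertical move into its linear
part and a remainder `vertRem`, gives an exact identity (`IsC12.riemannSum_eq`): up to a vanishing
first term, the Riemann sum of ∇F is F(u, x^n_u) - F(0, x^n_0) - ∫ 𝒟F - `remSum`. Continuity of F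
handles the first terms and dominated convergence the horizontal integral, so the whole question is
the convergence of the accumulated remainders.

No explicit Itô formula is proved for them. A Taylor estimate bounds each remainder by a constant
times the squared increment, so `remSum` is controlled by the discrete quadratic variation, and
limits A exist along every ultrafilter. Any such limit is right-continuous and satisfies, as s ↑ t,
A(t) - A(s) = `vertRem F x t` + ½⟨∇²F(t, x_{t-}), [x](t-) - [x](s)⟩, with an error small relative to
tr[x](t) - tr[x](s) (`limit_left_estimate`). The difference of two limits therefore has negligible
left increments and starts at 0, so it vanishes by `le_of_left_increments`. Hence the remainders
converge, and so do the Riemann sums.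

Along Ω_Σ the quadratic variation is continuous, so x has no jumps. There Σ-harmonicity makes the
left increments of A + ∫ 𝒟F negligible too, and the same comparison lemma gives A + ∫ 𝒟F = 0, that
is, M = F (`pathInt_eq_of_density`).

That M is of class ℳ needs the limits in a stronger form: the upper time u may move with n. The
outcome depends on which side of the last partition point before t it lies, because the interval
straddling t carries the jump. On the right the Riemann sums tend to the integral; strictly on the
left they tend to the integral minus ∇F(t, x_{t-})·Δx(t). J₁ convergence supplies exactly this side
information (`tendsto_stepSum_of_J1`). Since M along x^n is itself a Riemann sum up to a vanishing
correction, left- and right-continuity of M follow. Two paths that agree before t have Riemann sums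
differing only in the straddling term, which gives ∇M = (∇F)_-. The time derivative of M vanishes
because a frozen path adds no increments. -/

lemma t_lt_iff {n i j : ℕ} (hi : i ≤ P.k n) (hj : j ≤ P.k n) : P.t n i < P.t n j ↔ i < j :=
  (P.strictMono n).lt_iff_lt hi hj

lemma t_le_iff {n i j : ℕ} (hi : i ≤ P.k n) (hj : j ≤ P.k n) : P.t n i ≤ P.t n j ↔ i ≤ j :=
  (P.strictMono n).le_iff_le hi hj

lemma t_lt_succ {n i : ℕ} (hi : i < P.k n) : P.t n i < P.t n (i + 1) :=
  (P.t_lt_iff hi.le hi).2 i.lt_succ_self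

lemma prev_zero (n : ℕ) : P.prev n 0 = 0 := by
  simp [prev]

lemma prev_lt (n : ℕ) {t : ℝ≥0} (ht : 0 < t) : P.prev n t < t := by
  unfold prev
  rw [Finset.sup_lt_iff (by simpa using ht)]
  intro i hi
  exact (Finset.mem_filter.1 hi).2

lemma prev_le (n : ℕ) (t : ℝ≥0) : P.prev n t ≤ t := by
  rcases eq_zero_or_pos t with rfl | h
  · simp [prev_zero]
  · exact (P.prev_lt n h).le

lemma le_prev {n i : ℕ} {t : ℝ≥0} (hi : i ≤ P.k n) (h : P.t n i < t) : P.t n i ≤ P.prev n t :=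
  Finset.le_sup (f := P.t n) (Finset.mem_filter.2 ⟨by simpa [Nat.lt_succ_iff] using hi, h⟩)

lemma prev_mono (n : ℕ) : Monotone (P.prev n) := by
  intro s t h
  refine Finset.sup_mono fun i hi => ?_
  simp only [Finset.mem_filter] at hi ⊢
  exact ⟨hi.1, hi.2.trans_le h⟩

lemma exists_eq_prev (n : ℕ) {t : ℝ≥0} (ht : 0 < t) :
    ∃ i ≤ P.k n, P.t n i = P.prev n t ∧ P.t n i < t := by
  have hne : ((Finset.range (P.k n + 1)).filter (fun i => P.t n i < t)).Nonempty :=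
    ⟨0, by simp [P.t_zero, ht]⟩
  obtain ⟨i, hi, h⟩ := Finset.exists_mem_eq_sup _ hne (P.t n)
  simp only [Finset.mem_filter, Finset.mem_range, Nat.lt_succ_iff] at hi
  exact ⟨i, hi.1, h.symm, hi.2⟩

lemma exists_prev_index {n : ℕ} {t : ℝ≥0} (ht : 0 < t) (hk : t ≤ P.t n (P.k n)) :
    ∃ i < P.k n, P.t n i = P.prev n t ∧ P.t n i < t ∧ t ≤ P.t n (i + 1) := by
  obtain ⟨i, hi, h1, h2⟩ := P.exists_eq_prev n ht
  have hik : i < P.k n := (P.t_lt_iff hi le_rfl).1 (h2.trans_le hk)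
  refine ⟨i, hik, h1, h2, ?_⟩
  by_contra! h
  have := P.le_prev hik h
  rw [← h1] at this
  exact absurd (P.t_lt_succ hik) this.not_gt

lemma prev_eq_of_mem {n i : ℕ} {t : ℝ≥0} (hi : i < P.k n) (h1 : P.t n i < t)
    (h2 : t ≤ P.t n (i + 1)) : P.prev n t = P.t n i := by
  refine le_antisymm ?_ (P.le_prev hi.le h1)
  refine Finset.sup_le fun j hj => ?_
  simp only [Finset.mem_filter, Finset.mem_range, Nat.lt_succ_iff] at hj
  have := (P.t_lt_iff hj.1 hi).1 (hj.2.trans_le h2)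
  exact (P.t_le_iff hj.1 hi.le).2 (Nat.lt_succ_iff.1 this)

lemma exists_index {n : ℕ} {t : ℝ≥0} (hk : t < P.t n (P.k n)) :
    ∃ i < P.k n, P.t n i ≤ t ∧ t < P.t n (i + 1) := by
  classical
  have hex : ∃ j, t < P.t n j := ⟨_, hk⟩
  have h1 := Nat.find_spec hex
  have h2 : Nat.find hex ≤ P.k n := Nat.find_le hk
  have h3 : Nat.find hex ≠ 0 := by
    intro h
    rw [h, P.t_zero] at h1
    exact not_lt_zero h1
  obtain ⟨i, hi⟩ := Nat.exists_eq_succ_of_ne_zero h3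
  refine ⟨i, by omega, ?_, by rw [← Nat.succ_eq_add_one, ← hi]; exact h1⟩
  exact not_lt.1 (Nat.find_min hex (by omega : i < Nat.find hex))

lemma eventually_lt_last (T : ℝ≥0) : ∀ᶠ n in atTop, T < P.t n (P.k n) :=
  P.tendsto_last.eventually_gt_atTop T

lemma eventually_mesh (T : ℝ≥0) {ε : ℝ≥0} (hε : 0 < ε) :
    ∀ᶠ n in atTop, ∀ i < P.k n, P.t n i ≤ T → P.t n (i + 1) < P.t n i + ε := by
  filter_upwards [P.mesh T ε (by exact_mod_cast hε)] with n hn i hi h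
  have := hn i hi h
  rw [← NNReal.coe_lt_coe]
  push_cast
  linarith

lemma eventually_lt_prev {l t : ℝ≥0} (h : l < t) : ∀ᶠ n in atTop, l < P.prev n t := by
  filter_upwards [P.eventually_mesh t (tsub_pos_of_lt h), P.eventually_lt_last t] with n hn hk
  obtain ⟨i, hi, h1, h2, h3⟩ := P.exists_prev_index (pos_of_gt h) hk.le
  rw [← h1]
  have := h3.trans_lt (hn i hi h2.le)
  by_contra! hc
  have h4 := add_le_add_left hc (t - l)
  rw [add_tsub_cancel_of_le h.le] at h4
  exact absurd this h4.not_gt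

/-- Joint in n and the time, because the time itself will move with n, as in `prev n (prev n t)`. -/
lemma tendsto_prev_prod (t : ℝ≥0) :
    Tendsto (fun p : ℕ × ℝ≥0 => P.prev p.1 p.2) (atTop ×ˢ 𝓝 t) (𝓝 t) := by
  rw [tendsto_order]
  constructor
  · intro l hl
    obtain ⟨l', h1, h2⟩ := exists_between hl
    filter_upwards [(P.eventually_lt_prev h1).prod_mk (eventually_gt_nhds h2)] with p hp
    exact hp.1.trans_le (P.prev_mono _ hp.2.le)
  · intro r hr
    filter_upwards [(Eventually.of_forall fun _ => trivial : ∀ᶠ _ : ℕ in atTop, True).prod_mk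
      (eventually_lt_nhds hr)] with p hp
    exact (P.prev_le _ _).trans_lt hp.2

lemma tendsto_prev_comp {t : ℝ≥0} {u : ℕ → ℝ≥0} (hu : Tendsto u atTop (𝓝 t)) :
    Tendsto (fun n => P.prev n (u n)) atTop (𝓝 t) := by
  have h : Tendsto (fun n : ℕ => (n, u n)) atTop (atTop ×ˢ 𝓝 t) := tendsto_id.prodMk hu
  intro s hs
  exact h (P.tendsto_prev_prod t hs)

lemma tendsto_prev (t : ℝ≥0) : Tendsto (fun n => P.prev n t) atTop (𝓝 t) :=
  P.tendsto_prev_comp tendsto_const_nhds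

lemma tendsto_prev_prev (t : ℝ≥0) : Tendsto (fun n => P.prev n (P.prev n t)) atTop (𝓝 t) :=
  P.tendsto_prev_comp (P.tendsto_prev t)

lemma eventually_prev_prev_lt {t : ℝ≥0} (ht : 0 < t) :
    ∀ᶠ n in atTop, P.prev n (P.prev n t) < P.prev n t :=
  (P.eventually_lt_prev ht).mono fun n hn => P.prev_lt n hn

end PartitionSeq

/-! ### Stopped paths, vertical perturbations and step approximations -/

section Paths

variable {m : ℕ}

lemma leftLim_zero {V : Type*} [TopologicalSpace V] (x : ℝ≥0 → V) :
    Function.leftLim x 0 = x 0 :=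
  leftLim_eq_of_isBot isBot_bot

lemma nhdsLT_neBot {t : ℝ≥0} (ht : 0 < t) : (𝓝[<] t).NeBot :=
  nhdsLT_neBot_of_exists_lt ⟨0, ht⟩

lemma leftLim_congr {V : Type*} [TopologicalSpace V] [T2Space V] {x y : ℝ≥0 → V} {t : ℝ≥0}
    (ht : 0 < t) (h : x =ᶠ[𝓝[<] t] y) (hx : ∃ l, Tendsto x (𝓝[<] t) (𝓝 l)) :
    Function.leftLim x t = Function.leftLim y t := by
  have := nhdsLT_neBot ht
  obtain ⟨l, hl⟩ := hx
  rw [leftLim_eq_of_tendsto hl, leftLim_eq_of_tendsto (hl.congr' h)]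

lemma IsCadlag.tendsto_leftLim {V : Type*} [TopologicalSpace V] {x : ℝ≥0 → V} (hx : IsCadlag x)
    (t : ℝ≥0) : Tendsto x (𝓝[<] t) (𝓝 (Function.leftLim x t)) :=
  tendsto_leftLim_of_tendsto (hx t).2

lemma stopAt_stopAt (x : CPath m) {s t : ℝ≥0} (h : s ≤ t) :
    stopAt (stopAt x t) s = stopAt x s := by
  funext u; simp [stopAt, min_assoc, min_eq_left h]

lemma stopAt_stopAt' (x : CPath m) {s t : ℝ≥0} (h : t ≤ s) :
    stopAt (stopAt x t) s = stopAt x t := by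
  funext u; simp [stopAt, min_assoc, min_eq_right h]

lemma stopAt_apply_self (x : CPath m) (t : ℝ≥0) : stopAt x t t = x t := by simp [stopAt]

lemma stopAt_apply_of_le (x : CPath m) {s t : ℝ≥0} (h : s ≤ t) : stopAt x t s = x s := by
  simp [stopAt, h]

lemma stopAt_congr {x y : CPath m} {t : ℝ≥0} (h : ∀ s ≤ t, x s = y s) : stopAt x t = stopAt y t := by
  funext s; exact h _ (min_le_right _ _)

lemma bump_zero (t : ℝ≥0) : bump t (0 : Vec m) = 0 := by
  funext s; simp [bump]

lemma bump_add (t : ℝ≥0) (a b : Vec m) : bump t a + bump t b = bump t (a + b) := by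
  funext s; by_cases h : t ≤ s <;> simp [bump, h]

lemma stopAtLeft_eq (x : CPath m) (t : ℝ≥0) : stopAtLeft x t = stopAt x t + bump t (-jump x t) := by
  funext s
  by_cases h : s < t
  · simp [stopAtLeft, stopAt, bump, h, h.le, h.not_ge]
  · simp [stopAtLeft, stopAt, bump, h, not_lt.1 h, jump]

lemma stopAt_eq (x : CPath m) (t : ℝ≥0) : stopAt x t = stopAtLeft x t + bump t (jump x t) := by
  rw [stopAtLeft_eq, add_assoc, bump_add]; simp [bump_zero]

lemma stopAt_add_bump (x : CPath m) (t : ℝ≥0) (e : Vec m) :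
    stopAt (stopAt x t + bump t e) t = stopAt x t + bump t e := by
  funext s
  rcases le_total t s with h | h
  · simp [stopAt, bump, h]
  · simp only [stopAt, Pi.add_apply, min_eq_left h]

lemma stopAtLeft_zero (x : CPath m) : stopAtLeft x 0 = stopAt x 0 := by
  rw [stopAtLeft_eq]; simp [jump, leftLim_zero, bump_zero]

/-- Existence of the left limit matters: without it `Function.leftLim` falls back on the value at t,
about which agreement before t says nothing. -/
lemma stopAtLeft_congr {x y : CPath m} {t : ℝ≥0} (ht : 0 < t) (hx : ∃ l, Tendsto x (𝓝[<] t) (𝓝 l))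
    (h : ∀ s < t, x s = y s) : stopAtLeft x t = stopAtLeft y t := by
  have : Function.leftLim x t = Function.leftLim y t :=
    leftLim_congr ht (by filter_upwards [self_mem_nhdsWithin] with s hs using h s hs) hx
  funext s
  by_cases hs : s < t
  · simp [stopAtLeft, hs, h s hs]
  · simp [stopAtLeft, hs, this]

/-- Vertical perturbations do not change the path stopped strictly before `t > 0`. -/
lemma stopAtLeft_add_bump {x : CPath m} (hx : IsCadlag x) {t : ℝ≥0} (ht : 0 < t) (e : Vec m) :
    stopAtLeft (stopAt x t + bump t e) t = stopAtLeft x t := by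
  refine (stopAtLeft_congr ht (hx t).2 fun s hs => ?_).symm
  simp [stopAt, bump, hs.le, hs.not_ge]

lemma stopAtLeft_stopAtLeft {x : CPath m} (hx : IsCadlag x) (t : ℝ≥0) :
    stopAtLeft (stopAtLeft x t) t = stopAtLeft x t := by
  rcases eq_zero_or_pos t with rfl | hs
  · rw [stopAtLeft_zero, stopAtLeft_zero, stopAt_stopAt _ le_rfl]
  · rw [stopAtLeft_eq x, stopAtLeft_add_bump hx hs, stopAtLeft_eq x]

lemma stopAtLeft_stopAt_of_lt (x : CPath m) {s t : ℝ≥0} (h : s < t) :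
    stopAtLeft (stopAt x s) t = stopAt x s := by
  have hl : Function.leftLim (stopAt x s) t = x s := by
    have := nhdsLT_neBot (pos_of_gt h)
    refine leftLim_eq_of_tendsto ((tendsto_const_nhds (x := x s)).congr' ?_)
    filter_upwards [Ioo_mem_nhdsLT h] with u hu
    simp [stopAt, hu.1.le]
  funext u
  by_cases hu : u < t
  · simp [stopAtLeft, hu]
  · simp [stopAtLeft, hu, hl, stopAt, h.le.trans (not_lt.1 hu)]

lemma jump_zero (x : CPath m) : jump x 0 = 0 := by simp [jump, leftLim_zero]

section Approx

variable (P : PartitionSeq) (x : CPath m) {n : ℕ}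

lemma approx_apply {i : ℕ} {s : ℝ≥0} (hi : i < P.k n) (h1 : P.t n i ≤ s)
    (h2 : s < P.t n (i + 1)) : approx P x n s = x (P.t n (i + 1)) := by
  unfold approx
  rw [Finset.sum_eq_single i]
  · simp [h1, h2]
  · intro j hj hji
    have hj' := Finset.mem_range.1 hj
    rw [if_neg]
    rintro ⟨h3, h4⟩
    have h5 := (P.t_lt_iff hj'.le hi).1 (h3.trans_lt h2)
    have h6 := (P.t_lt_iff hi.le hj').1 (h1.trans_lt h4)
    omega
  · intro h; exact absurd (Finset.mem_range.2 hi) h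

lemma leftLim_approx {i : ℕ} {s : ℝ≥0} (hi : i < P.k n) (h1 : P.t n i < s)
    (h2 : s ≤ P.t n (i + 1)) : Tendsto (approx P x n) (𝓝[<] s) (𝓝 (x (P.t n (i + 1)))) := by
  refine tendsto_const_nhds.congr' ?_
  filter_upwards [Ioo_mem_nhdsLT h1] with u hu
  exact (approx_apply P x hi hu.1.le (hu.2.trans_le h2)).symm

lemma stopAt_approx {i : ℕ} {s : ℝ≥0} (hi : i < P.k n) (h1 : P.t n i ≤ s)
    (h2 : s < P.t n (i + 1)) : stopAt (approx P x n) s = stopAt (approx P x n) (P.t n i) := by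
  funext u
  simp only [stopAt]
  rcases le_total u (P.t n i) with h | h
  · rw [min_eq_left h, min_eq_left (h.trans h1)]
  · rw [min_eq_right h, approx_apply P x hi (le_min h h1) (min_lt_of_right_lt h2),
      approx_apply P x hi le_rfl (P.t_lt_succ hi)]

lemma stopAtLeft_approx {i : ℕ} {s : ℝ≥0} (hi : i < P.k n) (h1 : P.t n i < s)
    (h2 : s ≤ P.t n (i + 1)) : stopAtLeft (approx P x n) s = stopAt (approx P x n) (P.t n i) := by
  have hl : Function.leftLim (approx P x n) s = x (P.t n (i + 1)) := by
    have := nhdsLT_neBot (pos_of_gt h1)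
    exact leftLim_eq_of_tendsto (leftLim_approx P x hi h1 h2)
  funext u
  simp only [stopAt, stopAtLeft, hl]
  split_ifs with hu
  · rcases le_total u (P.t n i) with h | h
    · rw [min_eq_left h]
    · rw [min_eq_right h, approx_apply P x hi h (hu.trans_le h2),
      approx_apply P x hi le_rfl (P.t_lt_succ hi)]
  · rw [min_eq_right (h1.le.trans (not_lt.1 hu)), approx_apply P x hi le_rfl (P.t_lt_succ hi)]

/-- The step path carries the right-end value x(t_{i+1}) on [t_i, t_{i+1}), so its jump at a
partition point is the increment of x over the interval that starts there. The index is shifted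
because at time 0 there is no jump. -/
lemma jump_approx {i : ℕ} (hi : i + 1 < P.k n) : jump (approx P x n) (P.t n (i + 1)) =
    x (P.t n (i + 1 + 1)) - x (P.t n (i + 1)) := by
  have hi' : i < P.k n := by omega
  have hl : Function.leftLim (approx P x n) (P.t n (i + 1)) = x (P.t n (i + 1)) := by
    have := nhdsLT_neBot (pos_of_gt (P.t_lt_succ hi'))
    exact leftLim_eq_of_tendsto (leftLim_approx P x hi' (P.t_lt_succ hi') le_rfl)
  rw [jump, hl, approx_apply P x hi le_rfl (P.t_lt_succ hi)]

end Approx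

end Paths

/-! ### One-sided limits in the pair (n, u) -/

/-- Pairs `(n, u)` with `n → ∞` and `u → t` subject to the constraint `u ∈ C n`. -/
def alongConstraint (C : ℕ → Set ℝ≥0) (t : ℝ≥0) : Filter (ℕ × ℝ≥0) :=
  (atTop ×ˢ 𝓝 t) ⊓ 𝓟 {p | p.2 ∈ C p.1}

lemma tendsto_alongConstraint {ι : Type*} {l : Filter ι} {C : ℕ → Set ℝ≥0} {t : ℝ≥0}
    {f : ι → ℕ} {u : ι → ℝ≥0} (hf : Tendsto f l atTop) (hu : Tendsto u l (𝓝 t))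
    (hC : ∀ᶠ i in l, u i ∈ C (f i)) : Tendsto (fun i => (f i, u i)) l (alongConstraint C t) :=
  tendsto_inf.2 ⟨hf.prodMk hu, tendsto_principal.2 hC⟩

/-- If the limit failed along the filter, violating pairs would exist for infinitely many n and
arbitrarily close to t. They form a subsequence of times, which the admissible sequence `c`
completes to a full sequence contradicting the hypothesis. -/
lemma tendsto_of_forall_seq {Y : Type*} [TopologicalSpace Y] {C : ℕ → Set ℝ≥0} {t : ℝ≥0}
    {f : ℕ × ℝ≥0 → Y} {a : Y} (c : ℕ → ℝ≥0) (hc : Tendsto c atTop (𝓝 t))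
    (hcC : ∀ᶠ n in atTop, c n ∈ C n)
    (h : ∀ u : ℕ → ℝ≥0, Tendsto u atTop (𝓝 t) → (∀ᶠ n in atTop, u n ∈ C n) →
      Tendsto (fun n => f (n, u n)) atTop (𝓝 a)) :
    Tendsto f (alongConstraint C t) (𝓝 a) := by
  intro s hs
  by_contra hcon
  have hfreq : ∀ k : ℕ, ∃ᶠ n in atTop, ∃ u ∈ C n, dist u t < 1 / ((k : ℝ) + 1) ∧ f (n, u) ∉ s := by
    intro k hk
    apply hcon
    rw [mem_map, alongConstraint, mem_inf_principal]
    have hb : Metric.ball t (1 / ((k : ℝ) + 1)) ∈ 𝓝 t := Metric.ball_mem_nhds _ (by positivity)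
    filter_upwards [hk.prod_mk (eventually_mem_set.2 hb)] with p hp hpC
    by_contra hps
    exact hp.1 ⟨p.2, hpC, hp.2, hps⟩
  obtain ⟨φ, hφ, hu⟩ := extraction_forall_of_frequently hfreq
  choose u huC hud hus using hu
  -- The violating times at the indices φ(k), and the fallback `c` at all other indices.
  set w : ℕ → ℝ≥0 := Function.extend φ u c with hw
  have hwφ : ∀ k, w (φ k) = u k := fun k => hφ.injective.extend_apply u c k
  have hwt : Tendsto w atTop (𝓝 t) := by
    rw [Metric.tendsto_atTop] at hc ⊢
    intro ε hε
    obtain ⟨K, hK⟩ := exists_nat_one_div_lt hε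
    obtain ⟨N, hN⟩ := hc ε hε
    refine ⟨max N (φ K), fun n hn => ?_⟩
    by_cases hex : ∃ k, φ k = n
    · obtain ⟨k, rfl⟩ := hex
      rw [hwφ]
      have hk : K ≤ k := hφ.le_iff_le.1 ((le_max_right _ _).trans hn)
      refine (hud k).trans (lt_of_le_of_lt ?_ hK)
      apply one_div_le_one_div_of_le (by positivity)
      have : (K : ℝ) ≤ k := by exact_mod_cast hk
      linarith
    · rw [hw, Function.extend_apply' _ _ _ hex]
      exact hN n ((le_max_left _ _).trans hn)
  have hwC : ∀ᶠ n in atTop, w n ∈ C n := by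
    filter_upwards [hcC] with n hn
    by_cases hex : ∃ k, φ k = n
    · obtain ⟨k, rfl⟩ := hex
      rw [hwφ]; exact huC k
    · rw [hw, Function.extend_apply' _ _ _ hex]; exact hn
  have h1 := (h w hwt hwC).comp hφ.tendsto_atTop
  obtain ⟨k, hk⟩ := (h1.eventually_mem hs).exists
  simp only [Function.comp, hwφ] at hk
  exact hus k hk

namespace PartitionSeq

variable (P : PartitionSeq)

/-- `(n, u) → (∞, t)` with `max {t_i < t} ≤ u`. -/
def nearRight (t : ℝ≥0) : Filter (ℕ × ℝ≥0) := alongConstraint (fun n => Ici (P.prev n t)) t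

/-- `(n, u) → (∞, t)` with `u ≤ max {t_i < t}`. -/
def nearLeft (t : ℝ≥0) : Filter (ℕ × ℝ≥0) := alongConstraint (fun n => Iic (P.prev n t)) t

/-- `(n, u) → (∞, t)` with `u < max {t_i < t}`. -/
def nearLeftStrict (t : ℝ≥0) : Filter (ℕ × ℝ≥0) := alongConstraint (fun n => Iio (P.prev n t)) t

lemma nearLeftStrict_zero : P.nearLeftStrict 0 = ⊥ := by
  simp [nearLeftStrict, alongConstraint, prev_zero]

variable {ι : Type*} {l : Filter ι} {f : ι → ℕ} {u : ι → ℝ≥0} {t : ℝ≥0}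

lemma tendsto_nearRight (hf : Tendsto f l atTop) (hu : Tendsto u l (𝓝 t))
    (hC : ∀ᶠ i in l, P.prev (f i) t ≤ u i) : Tendsto (fun i => (f i, u i)) l (P.nearRight t) :=
  tendsto_alongConstraint hf hu hC

lemma tendsto_nearLeft (hf : Tendsto f l atTop) (hu : Tendsto u l (𝓝 t))
    (hC : ∀ᶠ i in l, u i ≤ P.prev (f i) t) : Tendsto (fun i => (f i, u i)) l (P.nearLeft t) :=
  tendsto_alongConstraint hf hu hC

lemma tendsto_nearLeftStrict (hf : Tendsto f l atTop) (hu : Tendsto u l (𝓝 t))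
    (hC : ∀ᶠ i in l, u i < P.prev (f i) t) :
    Tendsto (fun i => (f i, u i)) l (P.nearLeftStrict t) :=
  tendsto_alongConstraint hf hu hC

lemma nearRight_const (t : ℝ≥0) : Tendsto (fun n => (n, t)) atTop (P.nearRight t) :=
  P.tendsto_nearRight tendsto_id tendsto_const_nhds (.of_forall fun n => P.prev_le n t)

lemma nearRight_prev (t : ℝ≥0) : Tendsto (fun n => (n, P.prev n t)) atTop (P.nearRight t) :=
  P.tendsto_nearRight tendsto_id (P.tendsto_prev t) (.of_forall fun _ => le_rfl)

lemma nearLeft_prev (t : ℝ≥0) : Tendsto (fun n => (n, P.prev n t)) atTop (P.nearLeft t) :=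
  P.tendsto_nearLeft tendsto_id (P.tendsto_prev t) (.of_forall fun _ => le_rfl)

lemma nearLeftStrict_prev_prev {t : ℝ≥0} (ht : 0 < t) :
    Tendsto (fun n => (n, P.prev n (P.prev n t))) atTop (P.nearLeftStrict t) :=
  P.tendsto_nearLeftStrict tendsto_id (P.tendsto_prev_prev t) (P.eventually_prev_prev_lt ht)

lemma nearRight_le (t : ℝ≥0) : P.nearRight t ≤ atTop ×ˢ 𝓝 t := inf_le_left
lemma nearLeft_le (t : ℝ≥0) : P.nearLeft t ≤ atTop ×ˢ 𝓝 t := inf_le_left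
lemma nearLeftStrict_le (t : ℝ≥0) : P.nearLeftStrict t ≤ atTop ×ˢ 𝓝 t := inf_le_left

lemma nearLeftStrict_lt (t : ℝ≥0) : ∀ᶠ p in P.nearLeftStrict t, p.2 < P.prev p.1 t :=
  mem_inf_of_right fun _ h => h

lemma nearLeftStrict_prev_prev' (t : ℝ≥0) :
    Tendsto (fun p : ℕ × ℝ≥0 => (p.1, P.prev p.1 (P.prev p.1 t))) (P.nearLeftStrict t)
      (P.nearLeftStrict t) := by
  rcases eq_zero_or_pos t with rfl | ht
  · simp [nearLeftStrict_zero]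
  · have h : Tendsto (fun p : ℕ × ℝ≥0 => p.1) (P.nearLeftStrict t) atTop :=
      tendsto_fst.mono_left (P.nearLeftStrict_le t)
    exact (P.nearLeftStrict_prev_prev ht).comp h

lemma nearRight_const' (t : ℝ≥0) :
    Tendsto (fun p : ℕ × ℝ≥0 => (p.1, t)) (P.nearRight t) (P.nearRight t) :=
  (P.nearRight_const t).comp (tendsto_fst.mono_left (P.nearRight_le t))

end PartitionSeq

/-! ### The domain Λ and continuity of functionals -/

section Domain

variable {m : ℕ} {Ω : Set (CPath m)} {P : PartitionSeq}

lemma IsVertNhd.mem_domain {x : CPath m} {t : ℝ≥0} {U : Set (Vec m)} (h : IsVertNhd Ω x t U)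
    {e : Vec m} (he : e ∈ U) : (t, stopAt x t + bump t e) ∈ domain Ω :=
  ⟨_, h.2.2.2 e he, (stopAt_add_bump x t e).symm⟩

lemma IsVertNhd.zero_mem {x : CPath m} {t : ℝ≥0} {U : Set (Vec m)} (h : IsVertNhd Ω x t U) :
    (0 : Vec m) ∈ U := mem_of_mem_nhds h.2.1

lemma domain_stopAt {x : CPath m} (hx : x ∈ Ω) (t : ℝ≥0) : (t, stopAt x t) ∈ domain Ω :=
  ⟨x, hx, rfl⟩

lemma IsGeneric.stopAt_mem (hΩ : IsGeneric P Ω) {x : CPath m} (hx : x ∈ Ω) (t : ℝ≥0) :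
    stopAt x t ∈ Ω := by
  obtain ⟨U, hU⟩ := hΩ.vert x hx t
  simpa [bump_zero] using hU.2.2.2 0 hU.zero_mem

lemma IsGeneric.stopAtLeft_mem (hΩ : IsGeneric P Ω) {x : CPath m} (hx : x ∈ Ω) (t : ℝ≥0) :
    stopAtLeft x t ∈ Ω := by
  obtain ⟨U, hU⟩ := hΩ.vert x hx t
  rw [stopAtLeft_eq]
  exact hU.2.2.2 _ hU.2.2.1

lemma IsGeneric.domain_stopAtLeft (hΩ : IsGeneric P Ω) {x : CPath m} (hx : x ∈ Ω) (t : ℝ≥0) :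
    (t, stopAtLeft x t) ∈ domain Ω := by
  obtain ⟨U, hU⟩ := hΩ.vert x hx t
  rw [stopAtLeft_eq]
  exact hU.mem_domain hU.2.2.1

lemma IsGeneric.domain_later (hΩ : IsGeneric P Ω) {z : ℝ≥0 × CPath m} (hz : z ∈ domain Ω)
    {s : ℝ≥0} (h : z.1 ≤ s) : (s, z.2) ∈ domain Ω := by
  obtain ⟨x, hx, hz⟩ := hz
  refine ⟨stopAt x z.1, hΩ.stopAt_mem hx _, ?_⟩
  rw [stopAt_stopAt' _ h, hz]

lemma IsGeneric.mem_of_domain (hΩ : IsGeneric P Ω) {z : ℝ≥0 × CPath m} (hz : z ∈ domain Ω) :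
    z.2 ∈ Ω := by
  obtain ⟨x, hx, hz⟩ := hz
  rw [hz]; exact hΩ.stopAt_mem hx _

lemma stopAt_of_domain {z : ℝ≥0 × CPath m} (hz : z ∈ domain Ω) : stopAt z.2 z.1 = z.2 := by
  obtain ⟨x, hx, hz⟩ := hz
  rw [hz, stopAt_stopAt _ le_rfl]

/-- For large `n` the approximation `x^n` agrees up to time `T` with a path of `Ω`. -/
lemma IsGeneric.approx_stop (hΩ : IsGeneric P Ω) {x : CPath m} (hx : x ∈ Ω) (T : ℝ≥0) :
    ∀ᶠ n in atTop, ∃ y ∈ Ω, ∀ t ≤ T, stopAt y t = stopAt (approx P x n) t ∧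
      stopAtLeft y t = stopAtLeft (approx P x n) t := by
  obtain ⟨N, hN⟩ := hΩ.approx_mem x hx (T + 1) (by positivity)
  filter_upwards [eventually_ge_atTop N] with n hn
  refine ⟨_, hN n hn, fun t ht => ?_⟩
  have ht' : t ≤ T + 1 := ht.trans le_self_add
  refine ⟨stopAt_stopAt _ ht', ?_⟩
  rcases eq_zero_or_pos t with rfl | h0
  · rw [stopAtLeft_zero, stopAtLeft_zero, stopAt_stopAt _ ht']
  · exact stopAtLeft_congr h0 (hΩ.cadlag _ (hN n hn) t).2
      fun s hs => stopAt_apply_of_le _ (hs.le.trans ht')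

lemma IsGeneric.approx_domain (hΩ : IsGeneric P Ω) {x : CPath m} (hx : x ∈ Ω) (T : ℝ≥0) :
    ∀ᶠ n in atTop, ∀ t ≤ T, (t, stopAt (approx P x n) t) ∈ domain Ω ∧
      (t, stopAtLeft (approx P x n) t) ∈ domain Ω := by
  filter_upwards [hΩ.approx_stop hx T] with n ⟨y, hy, h⟩ t ht
  rw [← (h t ht).1, ← (h t ht).2]
  exact ⟨domain_stopAt hy t, hΩ.domain_stopAtLeft hy t⟩

section Val

variable {V : Type*} [Zero V]

lemma val_of_mem (F : domain Ω → V) {t : ℝ≥0} {y : CPath m} (h : (t, y) ∈ domain Ω) :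
    val F t y = F ⟨(t, y), h⟩ := by
  simp [val, h]

lemma val_coe (F : domain Ω → V) (z : domain Ω) : val F z.1.1 z.1.2 = F z :=
  val_of_mem F z.2

lemma val_stopAt (F : domain Ω → V) {x : CPath m} (hx : x ∈ Ω) (t : ℝ≥0) :
    val F t (stopAt x t) = F (pt hx t) := val_of_mem F _

lemma val_minus (F : domain Ω → V) {t : ℝ≥0} {y : CPath m} (h : (t, y) ∈ domain Ω) :
    val (minus F) t y = val F t (stopAtLeft y t) := by
  rw [val_of_mem _ h]; rfl

lemma val_minus_stopAtLeft (hΩ : IsGeneric P Ω) (F : domain Ω → V) {x : CPath m} (hx : x ∈ Ω)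
    (t : ℝ≥0) : val (minus F) t (stopAtLeft x t) = val F t (stopAtLeft x t) := by
  rw [val_minus F (hΩ.domain_stopAtLeft hx t), stopAtLeft_stopAtLeft (hΩ.cadlag x hx)]

end Val

lemma val_vertGrad (F : domain Ω → ℝ) (t : ℝ≥0) (y : CPath m) (i : Fin m) :
    val (vertGrad F) t y i = val (vertGradComp F i) t y := by
  unfold val
  split_ifs <;> rfl

lemma nearRight_mono_approx (hΩ : IsGeneric P Ω) {x : CPath m} (hx : x ∈ Ω) {t : ℝ≥0}
    {l : Filter (ℕ × ℝ≥0)} (hl : l ≤ atTop ×ˢ 𝓝 t) :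
    ∀ᶠ p in l, ∃ y ∈ Ω, stopAt y p.2 = stopAt (approx P x p.1) p.2 ∧
      stopAtLeft y p.2 = stopAtLeft (approx P x p.1) p.2 := by
  refine hl ?_
  filter_upwards [(hΩ.approx_stop hx (t + 1)).prod_mk
    (eventually_le_nhds (show t < t + 1 by simp))] with p hp
  obtain ⟨⟨y, hy, h⟩, h2⟩ := hp
  exact ⟨y, hy, h _ h2⟩

/-- The sequential clauses become limits along filters, from which bounds uniform in u can be
extracted. -/
lemma LeftCts.nearLeft {F : domain Ω → ℝ} (hF : LeftCts P F) {x : CPath m} (hx : x ∈ Ω)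
    (t : ℝ≥0) : Tendsto (fun p : ℕ × ℝ≥0 => val F p.2 (stopAtLeft (approx P x p.1) p.2))
      (P.nearLeft t) (𝓝 (val F t (stopAtLeft x t))) :=
  tendsto_of_forall_seq (fun n => P.prev n t) (P.tendsto_prev t) (.of_forall fun _ => mem_Iic.2 le_rfl)
    fun u hu hC => hF.c x hx t u hu hC

lemma LeftCts.nearLeftStrict {F : domain Ω → ℝ} (hF : LeftCts P F) {x : CPath m} (hx : x ∈ Ω)
    (t : ℝ≥0) : Tendsto (fun p : ℕ × ℝ≥0 => val F p.2 (stopAt (approx P x p.1) p.2))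
      (P.nearLeftStrict t) (𝓝 (val F t (stopAtLeft x t))) := by
  rcases eq_zero_or_pos t with rfl | ht
  · simp [P.nearLeftStrict_zero]
  · exact tendsto_of_forall_seq _ (P.tendsto_prev_prev t) (P.eventually_prev_prev_lt ht)
      fun u hu hC => hF.d x hx t u hu hC

lemma RightCts.nearRight {F : domain Ω → ℝ} (hF : RightCts P F) {x : CPath m} (hx : x ∈ Ω)
    (t : ℝ≥0) : Tendsto (fun p : ℕ × ℝ≥0 => val F p.2 (stopAt (approx P x p.1) p.2))
      (P.nearRight t) (𝓝 (val F t (stopAt x t))) :=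
  tendsto_of_forall_seq (fun n => P.prev n t) (P.tendsto_prev t) (.of_forall fun _ => mem_Ici.2 le_rfl)
    fun u hu hC => hF.c x hx t u hu hC

/-- For F in C^{1,2} the derivatives are left-continuous only after passing to F_-. Along
left-stopped paths F and F_- agree, so nothing is lost. -/
lemma LeftCts.minus_nearLeft (hΩ : IsGeneric P Ω) {F : domain Ω → ℝ} (hF : LeftCts P (minus F))
    {x : CPath m} (hx : x ∈ Ω) (t : ℝ≥0) :
    Tendsto (fun p : ℕ × ℝ≥0 => val F p.2 (stopAtLeft (approx P x p.1) p.2))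
      (P.nearLeft t) (𝓝 (val F t (stopAtLeft x t))) := by
  have h := hF.nearLeft hx t
  rw [val_minus_stopAtLeft hΩ F hx t] at h
  refine h.congr' ?_
  filter_upwards [nearRight_mono_approx hΩ hx (P.nearLeft_le t)] with p ⟨y, hy, h1, h2⟩
  rw [← h2, val_minus_stopAtLeft hΩ F hy]

/-! ### The π-topology: continuity means left- and right-continuity -/

section Topology

lemma PiContinuous.tendsto {F : domain Ω → ℝ} (hF : PiContinuous P F) {ι : Type*} {l : Filter ι}
    {τ : ι → ℝ≥0} {y : ι → CPath m} {t : ℝ≥0} {w : CPath m}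
    (hz : ∀ᶠ i in l, (τ i, y i) ∈ domain Ω) (hw : (t, w) ∈ domain Ω)
    (h : ∀ G : domain Ω → ℝ, LeftCts P G → RightCts P G →
      Tendsto (fun i => val G (τ i) (y i)) l (𝓝 (val G t w))) :
    Tendsto (fun i => val F (τ i) (y i)) l (𝓝 (val F t w)) := by
  classical
  -- Outside Λ the limit point serves as a default; this happens for no index eventually.
  let z : ι → domain Ω := fun i => if hi : (τ i, y i) ∈ domain Ω then ⟨_, hi⟩ else ⟨_, hw⟩
  have hzval : ∀ G : domain Ω → ℝ, (fun i => G (z i)) =ᶠ[l] fun i => val G (τ i) (y i) := by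
    intro G
    filter_upwards [hz] with i hi
    simp [z, hi, val_of_mem]
  have hzt : Tendsto z l (@nhds _ (piTopology P Ω) ⟨_, hw⟩) := by
    simp only [nhds_iInf, tendsto_iInf]
    intro G hG
    rw [nhds_induced, tendsto_comap_iff, ← val_of_mem G hw]
    exact (h G hG.1 hG.2).congr' (hzval G).symm
  rw [val_of_mem F hw]
  refine Tendsto.congr' (hzval F) ?_
  exact (@Continuous.tendsto _ _ (piTopology P Ω) _ F hF ⟨_, hw⟩).comp hzt

lemma piContinuous_of_leftCts_rightCts {F : domain Ω → ℝ} (hl : LeftCts P F)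
    (hr : RightCts P F) : PiContinuous P F := by
  unfold PiContinuous piTopology
  exact continuous_iInf_dom (i := F) (continuous_iInf_dom (i := ⟨hl, hr⟩) continuous_induced_dom)

lemma eventually_approx_domain (hΩ : IsGeneric P Ω) {x : CPath m} (hx : x ∈ Ω) {t : ℝ≥0}
    {u : ℕ → ℝ≥0} (hu : Tendsto u atTop (𝓝 t)) : ∀ᶠ n in atTop,
      (u n, stopAt (approx P x n) (u n)) ∈ domain Ω ∧
      (u n, stopAtLeft (approx P x n) (u n)) ∈ domain Ω := by
  filter_upwards [hΩ.approx_domain hx (t + 1),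
    hu.eventually (eventually_le_nhds (show t < t + 1 by simp))] with n h1 h2
  exact h1 _ h2

/-- Each clause is convergence of a family of points of Λ on which every generator of the topology
converges, hence convergence in the initial topology. -/
lemma PiContinuous.leftCts (hΩ : IsGeneric P Ω) {F : domain Ω → ℝ} (hF : PiContinuous P F) :
    LeftCts P F where
  a x hx t := hF.tendsto (.of_forall fun s => hΩ.domain_stopAtLeft hx s)
    (hΩ.domain_stopAtLeft hx t) fun _ hl _ => hl.a x hx t
  b x hx t := hF.tendsto (.of_forall fun s => domain_stopAt hx s)
    (hΩ.domain_stopAtLeft hx t) fun _ hl _ => hl.b x hx t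
  c x hx t u hu hC := hF.tendsto ((eventually_approx_domain hΩ hx hu).mono fun _ h => h.2)
    (hΩ.domain_stopAtLeft hx t) fun _ hl _ => hl.c x hx t u hu hC
  d x hx t u hu hC := hF.tendsto ((eventually_approx_domain hΩ hx hu).mono fun _ h => h.1)
    (hΩ.domain_stopAtLeft hx t) fun _ hl _ => hl.d x hx t u hu hC

lemma PiContinuous.rightCts (hΩ : IsGeneric P Ω) {F : domain Ω → ℝ} (hF : PiContinuous P F) :
    RightCts P F where
  a x hx t := hF.tendsto (.of_forall fun s => domain_stopAt hx s)
    (domain_stopAt hx t) fun _ _ hr => hr.a x hx t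
  b x hx t := hF.tendsto (.of_forall fun s => hΩ.domain_stopAtLeft hx s)
    (domain_stopAt hx t) fun _ _ hr => hr.b x hx t
  c x hx t u hu hC := hF.tendsto ((eventually_approx_domain hΩ hx hu).mono fun _ h => h.1)
    (domain_stopAt hx t) fun _ _ hr => hr.c x hx t u hu hC
  d x hx t u hu hC := hF.tendsto ((eventually_approx_domain hΩ hx hu).mono fun _ h => h.2)
    (domain_stopAt hx t) fun _ _ hr => hr.d x hx t u hu hC

end Topology

end Domain

/-! ### Step sums and Skorokhod convergence -/

section StepSum

variable (P : PartitionSeq)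

/-- The sum `∑_{t_i ≤ t} d_i` along the `n`-th partition. -/
def stepSum (d : ℕ → ℕ → ℝ) (n : ℕ) (t : ℝ≥0) : ℝ :=
  ∑ i ∈ (Finset.range (P.k n)).filter (fun i => P.t n i ≤ t), d n i

variable {P}

lemma stepSum_sub (d : ℕ → ℕ → ℝ) (n : ℕ) {s t : ℝ≥0} (h : s ≤ t) :
    stepSum P d n t - stepSum P d n s =
      ∑ i ∈ (Finset.range (P.k n)).filter (fun i => s < P.t n i ∧ P.t n i ≤ t), d n i := by
  have hsub : (Finset.range (P.k n)).filter (fun i => P.t n i ≤ s) ⊆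
      (Finset.range (P.k n)).filter (fun i => P.t n i ≤ t) := by
    intro i hi
    simp only [Finset.mem_filter] at hi ⊢
    exact ⟨hi.1, hi.2.trans h⟩
  rw [stepSum, stepSum, ← Finset.sum_sdiff hsub, add_sub_cancel_right]
  refine Finset.sum_congr ?_ fun _ _ => rfl
  ext i
  simp only [Finset.mem_sdiff, Finset.mem_filter, Finset.mem_range, not_and, not_le]
  tauto

lemma stepSum_eq_of_le {d : ℕ → ℕ → ℝ} {n i : ℕ} {t : ℝ≥0} (hi : i < P.k n) (h1 : P.t n i ≤ t)
    (h2 : t < P.t n (i + 1)) : stepSum P d n t = ∑ j ∈ Finset.range (i + 1), d n j := by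
  refine Finset.sum_congr ?_ fun _ _ => rfl
  ext j
  simp only [Finset.mem_filter, Finset.mem_range]
  constructor
  · rintro ⟨hj, hjt⟩
    exact (P.t_lt_iff hj.le hi).1 (hjt.trans_lt h2)
  · intro hj
    exact ⟨by omega, ((P.t_le_iff (by omega) hi.le).2 (by omega)).trans h1⟩

/-- The increment of a step sum across its jump at the last partition point before `t`. -/
lemma stepSum_prev_sub {d : ℕ → ℕ → ℝ} {n i : ℕ} {t : ℝ≥0} (hi : i < P.k n)
    (h0 : 0 < P.t n i) (h1 : P.t n i = P.prev n t) :
    stepSum P d n (P.prev n t) - stepSum P d n (P.prev n (P.prev n t)) = d n i := by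
  rw [stepSum_sub _ _ (P.prev_le _ _), ← h1]
  refine (Finset.sum_eq_single i ?_ ?_)
  · intro j hj hne
    simp only [Finset.mem_filter, Finset.mem_range] at hj
    have hlt : P.t n j < P.t n i := by
      refine lt_of_le_of_ne hj.2.2 fun h => hne ?_
      exact (P.strictMono n).injOn (mem_Iic.2 hj.1.le) (mem_Iic.2 hi.le) h
    exact absurd (P.le_prev hj.1.le hlt) hj.2.1.not_ge
  · intro h
    exact absurd (Finset.mem_filter.2 ⟨Finset.mem_range.2 hi, P.prev_lt _ h0, le_rfl⟩) h

lemma abs_stepSum_sub_le {d e : ℕ → ℕ → ℝ} {n : ℕ} {K : ℝ} {s t : ℝ≥0} (h : s ≤ t)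
    (hde : ∀ i < P.k n, s < P.t n i → P.t n i ≤ t → |d n i| ≤ K * e n i) :
    |stepSum P d n t - stepSum P d n s| ≤ K * (stepSum P e n t - stepSum P e n s) := by
  rw [stepSum_sub _ _ h, stepSum_sub _ _ h, Finset.mul_sum]
  refine (Finset.abs_sum_le_sum_abs _ _).trans (Finset.sum_le_sum fun i hi => ?_)
  simp only [Finset.mem_filter, Finset.mem_range] at hi
  exact hde i hi.1 hi.2.1 hi.2.2

lemma stepSum_mono {e : ℕ → ℕ → ℝ} {n : ℕ} (he : ∀ i, 0 ≤ e n i) : Monotone (stepSum P e n) := by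
  intro s t h
  rw [← sub_nonneg, stepSum_sub _ _ h]
  exact Finset.sum_nonneg fun i _ => he i

lemma abs_stepSum_sub_le' {d e : ℕ → ℕ → ℝ} {n : ℕ} {K : ℝ} {s t T : ℝ≥0} (hK : 0 ≤ K) (hs : s ≤ T) (ht : t ≤ T)
    (hde : ∀ i < P.k n, P.t n i ≤ T → |d n i| ≤ K * e n i) :
    |stepSum P d n t - stepSum P d n s| ≤ K * |stepSum P e n t - stepSum P e n s| := by
  have key : ∀ {s t : ℝ≥0}, s ≤ t → t ≤ T →
      |stepSum P d n t - stepSum P d n s| ≤ K * (stepSum P e n t - stepSum P e n s) :=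
    fun h ht => abs_stepSum_sub_le h fun i hi _ h2 => hde i hi (h2.trans ht)
  have key2 : ∀ {s t : ℝ≥0}, s ≤ t → t ≤ T →
      |stepSum P d n t - stepSum P d n s| ≤ K * |stepSum P e n t - stepSum P e n s| :=
    fun h ht => (key h ht).trans (mul_le_mul_of_nonneg_left (le_abs_self _) hK)
  rcases le_total s t with h | h
  · exact key2 h ht
  · rw [abs_sub_comm, abs_sub_comm (stepSum P e n t)]
    exact key2 h hs

/-- Where q jumps, the time change must match t with an actual jump time of the step sum. That is a
partition point with a large increment, and large increments start only at the last partition point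
before t. -/
lemma jump_time_eq_prev {d : ℕ → ℕ → ℝ} {q : ℝ≥0 → ℝ} (hq : IsCadlag q)
    {lam : ℕ → ℝ≥0 ≃o ℝ≥0} (hlam : TendstoUniformly (fun n s => lam n s) (fun s => s) atTop)
    (hJ : ∀ T : ℝ≥0, TendstoUniformlyOn (fun n s => stepSum P d n (lam n s)) q atTop (Iic T))
    (hd : ∀ t : ℝ≥0, ∀ c : ℝ, 0 < c → ∀ᶠ p : ℕ × ℝ≥0 in atTop ×ˢ 𝓝 t,
      ∀ i < P.k p.1, P.t p.1 i = p.2 → c ≤ |d p.1 i| → p.2 = P.prev p.1 t)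
    {t : ℝ≥0} (hne : Function.leftLim q t ≠ q t) : ∀ᶠ n in atTop, lam n t = P.prev n t := by
  have ht : 0 < t := by
    rcases eq_zero_or_pos t with rfl | h
    · exact absurd (leftLim_zero q) hne
    · exact h
  -- A quarter of the jump: the two approximation errors and the distance of q(s) to the left limit
  -- each cost less than c, so the step sum itself must move by more than c.
  set c := |q t - Function.leftLim q t| / 4 with hc
  have hc0 : 0 < c := by
    have : 0 < |q t - Function.leftLim q t| := abs_pos.2 (sub_ne_zero.2 hne.symm)
    positivity
  have hlamt : Tendsto (fun n => (n, lam n t)) atTop (atTop ×ˢ 𝓝 t) :=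
    tendsto_id.prodMk (hlam.tendsto_at t)
  obtain ⟨l, hl, hlq⟩ : ∃ l < t, ∀ s ∈ Ioo l t, |q s - Function.leftLim q t| < c := by
    have h1 : ∀ᶠ s in 𝓝[<] t, |q s - Function.leftLim q t| < c :=
      (Metric.tendsto_nhds.1 (hq.tendsto_leftLim t)) c hc0
    obtain ⟨l, hl, h2⟩ := (mem_nhdsLT_iff_exists_Ioo_subset' ht).1 h1
    exact ⟨l, hl, fun s hs => h2 hs⟩
  filter_upwards [hlamt.eventually (hd t c hc0), Metric.tendstoUniformlyOn_iff.1 (hJ t) c hc0]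
    with n h1 h2
  have hpos : 0 < lam n t := by
    have := (lam n).strictMono ht
    exact (zero_le).trans_lt this
  -- With s this close to t, no partition point lies in (lam n s, lam n t] except possibly lam n t
  -- itself.
  obtain ⟨s, hs1, hs2⟩ : ∃ s, max l ((lam n).symm (P.prev n (lam n t))) < s ∧ s < t := by
    refine exists_between (max_lt hl ?_)
    rw [OrderIso.symm_apply_lt]
    exact P.prev_lt n hpos
  have hls : l < s := (le_max_left _ _).trans_lt hs1
  have hps : P.prev n (lam n t) < lam n s := by
    rw [← OrderIso.symm_apply_lt]
    exact (le_max_right _ _).trans_lt hs1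
  have hst : lam n s < lam n t := (lam n).strictMono hs2
  have a1 := h2 t (mem_Iic.2 le_rfl)
  have a2 := h2 s (mem_Iic.2 hs2.le)
  have a3 := hlq s ⟨hls, hs2⟩
  rw [Real.dist_eq] at a1 a2
  have hbig : c < |stepSum P d n (lam n t) - stepSum P d n (lam n s)| := by
    have h4 : 4 * c = |q t - Function.leftLim q t| := by rw [hc]; ring
    by_contra! hcon
    have : |q t - Function.leftLim q t| ≤ |q t - stepSum P d n (lam n t)| +
        |stepSum P d n (lam n t) - stepSum P d n (lam n s)| +
        |q s - stepSum P d n (lam n s)| + |q s - Function.leftLim q t| := by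
      have e : q t - Function.leftLim q t = (q t - stepSum P d n (lam n t)) +
        (stepSum P d n (lam n t) - stepSum P d n (lam n s)) -
        (q s - stepSum P d n (lam n s)) + (q s - Function.leftLim q t) := by ring
      rw [e]
      refine (abs_add_le _ _).trans (add_le_add ?_ le_rfl)
      refine (abs_sub _ _).trans (add_le_add (abs_add_le _ _) le_rfl)
    linarith
  rw [stepSum_sub _ _ hst.le] at hbig
  have hmem : ∀ i ∈ (Finset.range (P.k n)).filter
      (fun i => lam n s < P.t n i ∧ P.t n i ≤ lam n t), i < P.k n ∧ P.t n i = lam n t := by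
    intro i hi
    simp only [Finset.mem_filter, Finset.mem_range] at hi
    refine ⟨hi.1, hi.2.2.antisymm (not_lt.1 fun hlt => ?_)⟩
    exact absurd (P.le_prev hi.1.le hlt) (hps.trans hi.2.1).not_ge
  obtain ⟨i, hi⟩ : ((Finset.range (P.k n)).filter
      (fun i => lam n s < P.t n i ∧ P.t n i ≤ lam n t)).Nonempty := by
    by_contra! hempty
    rw [hempty] at hbig
    simp at hbig
    linarith
  have hsum : ∑ i ∈ (Finset.range (P.k n)).filter
      (fun i => lam n s < P.t n i ∧ P.t n i ≤ lam n t), d n i = d n i := by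
    refine Finset.sum_eq_single i (fun j hj hne => absurd ?_ hne) fun h => absurd hi h
    exact (P.strictMono n).injOn (mem_Iic.2 (hmem j hj).1.le) (mem_Iic.2 (hmem i hi).1.le)
      ((hmem j hj).2.trans (hmem i hi).2.symm)
  rw [hsum] at hbig
  exact h1 i (hmem i hi).1 (hmem i hi).2 hbig.le

/-- Skorokhod convergence of step sums whose large increments straddle the limit time implies
convergence along times on the correct side of the straddling partition interval. -/
lemma tendsto_stepSum_of_J1 {d : ℕ → ℕ → ℝ} {q : ℝ≥0 → ℝ} (hq : IsCadlag q)
    {lam : ℕ → ℝ≥0 ≃o ℝ≥0} (hlam : TendstoUniformly (fun n s => lam n s) (fun s => s) atTop)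
    (hJ : ∀ T : ℝ≥0, TendstoUniformlyOn (fun n s => stepSum P d n (lam n s)) q atTop (Iic T))
    (hd : ∀ t : ℝ≥0, ∀ c : ℝ, 0 < c → ∀ᶠ p : ℕ × ℝ≥0 in atTop ×ˢ 𝓝 t,
      ∀ i < P.k p.1, P.t p.1 i = p.2 → c ≤ |d p.1 i| → p.2 = P.prev p.1 t) (t : ℝ≥0) :
    Tendsto (fun p : ℕ × ℝ≥0 => stepSum P d p.1 p.2) (P.nearRight t) (𝓝 (q t)) ∧
    Tendsto (fun p : ℕ × ℝ≥0 => stepSum P d p.1 p.2) (P.nearLeftStrict t)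
      (𝓝 (Function.leftLim q t)) := by
  have hsymm : Tendsto (fun p : ℕ × ℝ≥0 => (lam p.1).symm p.2) (atTop ×ˢ 𝓝 t) (𝓝 t) := by
    rw [Metric.tendsto_nhds]
    intro ε hε
    have h1 := (Metric.tendstoUniformly_iff.1 hlam) (ε / 2) (by positivity)
    filter_upwards [h1.prod_mk (eventually_mem_set.2 (Metric.ball_mem_nhds t (half_pos hε)))]
      with p ⟨hp1, hp2⟩
    have h3 := hp1 ((lam p.1).symm p.2)
    rw [OrderIso.apply_symm_apply] at h3
    exact (dist_triangle _ p.2 _).trans_lt (by linarith [Metric.mem_ball.1 hp2])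
  have hunif : Tendsto (fun p : ℕ × ℝ≥0 => stepSum P d p.1 p.2 - q ((lam p.1).symm p.2))
      (atTop ×ˢ 𝓝 t) (𝓝 0) := by
    rw [Metric.tendsto_nhds]
    intro ε hε
    have h1 := (Metric.tendstoUniformlyOn_iff.1 (hJ (t + 1))) ε hε
    have h2 := hsymm.eventually (eventually_le_nhds (show t < t + 1 by simp))
    filter_upwards [h2, (h1.prod_mk (Eventually.of_forall (f := 𝓝 t) fun _ => trivial))]
      with p hp2 hp1
    have h3 := hp1.1 _ hp2
    rw [OrderIso.apply_symm_apply, dist_comm] at h3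
    simpa [Real.dist_eq] using h3
  have hstep : ∀ l ≤ atTop ×ˢ 𝓝 t, ∀ a,
      Tendsto (fun p : ℕ × ℝ≥0 => q ((lam p.1).symm p.2)) l (𝓝 a) →
      Tendsto (fun p : ℕ × ℝ≥0 => stepSum P d p.1 p.2) l (𝓝 a) := by
    intro l hl a h
    simpa using (hunif.mono_left hl).add h
  by_cases hne : Function.leftLim q t = q t
  · have hcont : Tendsto q (𝓝 t) (𝓝 (q t)) := by
      have h1 : Tendsto q (𝓝[<] t) (𝓝 (q t)) := hne ▸ hq.tendsto_leftLim t
      rw [← nhdsLT_sup_nhdsGE]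
      exact h1.sup (hq t).1
    rw [hne]
    exact ⟨hstep _ (P.nearRight_le t) _ (hcont.comp (hsymm.mono_left (P.nearRight_le t))),
      hstep _ (P.nearLeftStrict_le t) _ (hcont.comp (hsymm.mono_left (P.nearLeftStrict_le t)))⟩
  -- At a jump of q one has lam n t = prev n t eventually. Then prev n t ≤ u is the same as t ≤ (lam
  -- n)⁻¹ u, so the constraint on u selects the side from which q is approached.
  · have hj := jump_time_eq_prev hq hlam hJ hd hne
    have hj' : ∀ᶠ p : ℕ × ℝ≥0 in atTop ×ˢ 𝓝 t, lam p.1 t = P.prev p.1 t :=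
      tendsto_fst.eventually hj
    constructor
    · refine hstep _ (P.nearRight_le t) _ ((hq t).1.tendsto.comp
        (tendsto_nhdsWithin_iff.2 ⟨hsymm.mono_left (P.nearRight_le t), ?_⟩))
      filter_upwards [P.nearRight_le t hj', mem_inf_of_right (mem_principal_self _)] with p h1 h2
      rw [mem_Ici, OrderIso.le_symm_apply, h1]
      exact h2
    · refine hstep _ (P.nearLeftStrict_le t) _ ((hq.tendsto_leftLim t).comp
        (tendsto_nhdsWithin_iff.2 ⟨hsymm.mono_left (P.nearLeftStrict_le t), ?_⟩))
      filter_upwards [P.nearLeftStrict_le t hj', P.nearLeftStrict_lt t] with p h1 h2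
      rw [mem_Iio, OrderIso.symm_apply_lt, h1]
      exact h2

end StepSum

/-! ### Increments of càdlàg paths along the partitions -/

section Increments

variable {m : ℕ} {P : PartitionSeq}

/-- The partition increment `x(t_{i+1}) - x(t_i)`. -/
def incr (P : PartitionSeq) (x : CPath m) (n i : ℕ) : Vec m := x (P.t n (i + 1)) - x (P.t n i)

/-- Increments over partition intervals contained in a left neighbourhood are small. -/
lemma IsCadlag.small_left {x : CPath m} (hx : IsCadlag x) {t : ℝ≥0} (ht : 0 < t) {ε : ℝ}
    (hε : 0 < ε) : ∃ l < t, ∀ u ∈ Ioo l t, ∀ w ∈ Ioo l t, ‖x u - x w‖ < ε := by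
  have h1 := (Metric.tendsto_nhds.1 (hx.tendsto_leftLim t)) (ε / 2) (half_pos hε)
  obtain ⟨l, hl, h2⟩ := (mem_nhdsLT_iff_exists_Ioo_subset' ht).1 h1
  refine ⟨l, hl, fun u hu w hw => ?_⟩
  rw [← dist_eq_norm]
  have a := h2 hu
  have b := h2 hw
  simp only [mem_ofPred_eq] at a b
  exact (dist_triangle_right _ _ (Function.leftLim x t)).trans_lt (by linarith)

lemma IsCadlag.small_right {x : CPath m} (hx : IsCadlag x) (t : ℝ≥0) {ε : ℝ}
    (hε : 0 < ε) : ∃ r > t, ∀ u ∈ Ico t r, ∀ w ∈ Ico t r, ‖x u - x w‖ < ε := by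
  have h1 := (Metric.tendsto_nhds.1 (hx t).1.tendsto) (ε / 2) (half_pos hε)
  obtain ⟨r, hr, h2⟩ := (mem_nhdsGE_iff_exists_Ico_subset' (show t < t + 1 by simp)).1 h1
  refine ⟨r, hr, fun u hu w hw => ?_⟩
  rw [← dist_eq_norm]
  have a := h2 hu
  have b := h2 hw
  simp only [mem_ofPred_eq] at a b
  exact (dist_triangle_right _ _ (x t)).trans_lt (by linarith)

/-- An interval near t lying entirely before t or entirely from t on has a small increment, by the
left limit and by right-continuity. A large increment must straddle t, and then its left end is the
last partition point before t. -/
lemma eventually_small_incr {x : CPath m} (hx : IsCadlag x) (t : ℝ≥0) {c : ℝ} (hc : 0 < c) :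
    ∀ᶠ p : ℕ × ℝ≥0 in atTop ×ˢ 𝓝 t,
      ∀ i < P.k p.1, P.t p.1 i = p.2 → c ≤ ‖incr P x p.1 i‖ → p.2 = P.prev p.1 t := by
  obtain ⟨r, hr, hr2⟩ := hx.small_right t hc
  obtain ⟨r', hr', hr'2⟩ := exists_between hr
  have hmesh := (P.eventually_mesh r' (tsub_pos_of_lt hr'2)).prod_mk (eventually_le_nhds hr')
  have hleft : ∀ᶠ p : ℕ × ℝ≥0 in atTop ×ˢ 𝓝 t,
      ∀ i < P.k p.1, P.t p.1 i = p.2 → c ≤ ‖incr P x p.1 i‖ → t ≤ P.t p.1 (i + 1) := by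
    rcases eq_zero_or_pos t with rfl | ht
    · exact .of_forall fun p i _ _ _ => zero_le
    · obtain ⟨l, hl, hl2⟩ := hx.small_left ht hc
      filter_upwards [(Eventually.of_forall (f := atTop) fun _ => trivial).prod_mk
        (eventually_gt_nhds hl)] with p hp i hi hip hci
      by_contra! hlt
      have hlt' := P.t_lt_succ hi
      have h1 : l < P.t p.1 i := hip ▸ hp.2
      exact absurd (hl2 (P.t p.1 (i + 1)) ⟨h1.trans hlt', hlt⟩ (P.t p.1 i) ⟨h1, hlt'.trans hlt⟩)
        hci.not_gt
  filter_upwards [hmesh, hleft] with p hp hp2 i hi hip hci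
  have h1 : P.t p.1 (i + 1) < r := by
    have h3 : P.t p.1 i ≤ r' := hip ▸ hp.2
    refine (hp.1 i hi h3).trans_le ?_
    calc P.t p.1 i + (r - r') ≤ r' + (r - r') := add_le_add_left h3 _
      _ = r := add_tsub_cancel_of_le hr'2.le
  have hlt' := P.t_lt_succ hi
  have h2 : P.t p.1 i < t := by
    by_contra! hge
    exact absurd (hr2 (P.t p.1 (i + 1)) ⟨hge.trans hlt'.le, h1⟩ (P.t p.1 i) ⟨hge, hlt'.trans h1⟩)
      hci.not_gt
  rw [P.prev_eq_of_mem hi h2 (hp2 i hi hip hci), hip]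

/-- The next partition value converges to the value at `t`. -/
lemma eventually_next {x : CPath m} (hx : IsCadlag x) (t : ℝ≥0) {ε : ℝ} (hε : 0 < ε) :
    ∀ᶠ n in atTop, ∀ i < P.k n, P.t n i ≤ t → t ≤ P.t n (i + 1) →
      ‖x (P.t n (i + 1)) - x t‖ < ε := by
  obtain ⟨r, hr, hr2⟩ := hx.small_right t hε
  filter_upwards [P.eventually_mesh t (tsub_pos_of_lt hr)] with n hn i hi h1 h2
  refine hr2 _ ⟨h2, (hn i hi h1).trans_le ?_⟩ _ ⟨le_rfl, hr⟩
  calc P.t n i + (r - t) ≤ t + (r - t) := add_le_add_left h1 _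
    _ = r := add_tsub_cancel_of_le hr.le

/-- Convergence of the discrete quadratic variation at either side of the limit time. -/
lemma IsQuadVar.tendsto {x : CPath m} (hx : IsCadlag x)
    {q : ℝ≥0 → Matrix (Fin m) (Fin m) ℝ} (hq : IsQuadVar P x q) (a b : Fin m) :
    IsCadlag (fun t => q t a b) ∧ ∀ t,
    Tendsto (fun p : ℕ × ℝ≥0 => stepSum P (fun n i => incr P x n i a * incr P x n i b) p.1 p.2)
      (P.nearRight t) (𝓝 (q t a b)) ∧
    Tendsto (fun p : ℕ × ℝ≥0 => stepSum P (fun n i => incr P x n i a * incr P x n i b) p.1 p.2)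
      (P.nearLeftStrict t) (𝓝 (Function.leftLim (fun s => q s a b) t)) := by
  obtain ⟨hc, lam, hlam, hJ⟩ := hq
  have hcont : Continuous fun M : Matrix (Fin m) (Fin m) ℝ => M a b :=
    (continuous_apply b).comp (continuous_apply a)
  have huc : UniformContinuous fun M : Matrix (Fin m) (Fin m) ℝ => M a b :=
    (Pi.uniformContinuous_proj (fun _ : Fin m => ℝ) b).comp
      (Pi.uniformContinuous_proj (fun _ : Fin m => Fin m → ℝ) a)
  have hc' : IsCadlag (fun t => q t a b) := fun t =>
    ⟨(hcont.tendsto _).comp (hc t).1, by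
      obtain ⟨l, hl⟩ := (hc t).2
      exact ⟨_, (hcont.tendsto _).comp hl⟩⟩
  refine ⟨hc', tendsto_stepSum_of_J1 hc' hlam (fun T => ?_) fun t c hc0 => ?_⟩
  · have h := huc.comp_tendstoUniformlyOn (hJ T)
    refine h.congr (.of_forall fun n s _ => ?_)
    simp [quadSum, stepSum, incr, Matrix.sum_apply]
  -- A product of two coordinates of size at least c forces the increment to have norm at least √c.
  · filter_upwards [eventually_small_incr hx t (Real.sqrt_pos.2 hc0)] with p hp i hi hip hci
    refine hp i hi hip (Real.sqrt_le_iff.2 ⟨norm_nonneg _, hci.trans ?_⟩)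
    rw [abs_mul, sq, ← Real.norm_eq_abs, ← Real.norm_eq_abs]
    exact mul_le_mul (PiLp.norm_apply_le _ a) (PiLp.norm_apply_le _ b) (norm_nonneg _)
      (norm_nonneg _)

end Increments

/-! ### Second-order vertical expansion -/

lemma taylor_two_bound {G G1 G2 : ℝ → ℝ} {c B : ℝ}
    (h1 : ∀ θ ∈ Icc (0 : ℝ) 1, HasDerivAt G (G1 θ) θ)
    (h2 : ∀ θ ∈ Icc (0 : ℝ) 1, HasDerivAt G1 (G2 θ) θ)
    (hB : ∀ θ ∈ Icc (0 : ℝ) 1, |G2 θ - c| ≤ B) :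
    |G 1 - G 0 - G1 0 - 1 / 2 * c| ≤ B := by
  have hB0 : 0 ≤ B := (abs_nonneg _).trans (hB 0 (by simp))
  -- The mean value inequality, first for G1 minus its linear approximation with slope c; applied
  -- again below, it gives the bound for G.
  have step : ∀ θ ∈ Icc (0 : ℝ) 1, |G1 θ - G1 0 - c * θ| ≤ B := by
    intro θ hθ
    have hd : ∀ s ∈ Icc (0 : ℝ) 1,
        HasDerivWithinAt (fun s => G1 s - c * s) (G2 s - c) (Icc 0 1) s := fun s hs => by
      have := (h2 s hs).fun_sub ((hasDerivAt_id' s).const_mul c)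
      rw [mul_one] at this
      exact this.hasDerivWithinAt
    have := (convex_Icc (0 : ℝ) 1).norm_image_sub_le_of_norm_hasDerivWithin_le hd
      (fun s hs => by simpa [Real.norm_eq_abs] using hB s hs) (left_mem_Icc.2 zero_le_one) hθ
    simp only [mul_zero, sub_zero, Real.norm_eq_abs] at this
    have e : G1 θ - c * θ - G1 0 = G1 θ - G1 0 - c * θ := by ring
    rw [e, abs_of_nonneg hθ.1] at this
    exact this.trans (mul_le_of_le_one_right hB0 hθ.2)
  have hd : ∀ s ∈ Icc (0 : ℝ) 1, HasDerivWithinAt (fun s => G s - G1 0 * s - 1 / 2 * c * s ^ 2)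
      (G1 s - G1 0 - c * s) (Icc 0 1) s := fun s hs => by
    have := ((h1 s hs).fun_sub ((hasDerivAt_id' s).const_mul (G1 0))).fun_sub
      ((hasDerivAt_pow 2 s).const_mul (1 / 2 * c))
    have e : G1 s - G1 0 - c * s = G1 s - G1 0 * 1 - 1 / 2 * c * (((2 : ℕ) : ℝ) * s ^ (2 - 1)) := by
      push_cast; ring
    rw [e]
    exact this.hasDerivWithinAt
  have := (convex_Icc (0 : ℝ) 1).norm_image_sub_le_of_norm_hasDerivWithin_le hd
    (fun s hs => by simpa [Real.norm_eq_abs] using step s hs) (left_mem_Icc.2 zero_le_one)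
    (right_mem_Icc.2 zero_le_one)
  simp only [Real.norm_eq_abs, sub_zero, abs_one, mul_one] at this
  convert this using 2
  ring

section Taylor

variable {m : ℕ} {Ω : Set (CPath m)} {P : PartitionSeq}

/-- Vertical derivatives are taken at e = 0 only. Since perturbations at one time add up, moving the
base point along a segment yields derivatives at every θ for which the perturbed path stays in Λ. -/
lemma VertDifferentiable.hasDerivAt {F : domain Ω → ℝ} (hF : VertDifferentiable F) {t : ℝ≥0}
    {y : CPath m} {J : Vec m} {θ₀ : ℝ} (h : (t, y + bump t (θ₀ • J)) ∈ domain Ω) :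
    HasDerivAt (fun θ : ℝ => val F t (y + bump t (θ • J)))
      (∑ a, val (vertGradComp F a) t (y + bump t (θ₀ • J)) * J a) θ₀ := by
  have hg := (hF ⟨_, h⟩).hasGradientAt.hasFDerivAt
  have hlin : HasDerivAt (fun θ : ℝ => (θ - θ₀) • J) J θ₀ := by
    simpa using ((hasDerivAt_id θ₀).sub_const θ₀).smul_const J
  have hg' : HasFDerivAt (fun e : Vec m => val F t (y + bump t (θ₀ • J) + bump t e))
      (InnerProductSpace.toDual ℝ (Vec m) (vertGrad F ⟨_, h⟩)) ((θ₀ - θ₀) • J) := by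
    simpa [vertGrad] using hg
  have hcomp := hg'.comp_hasDerivAt θ₀ hlin
  have hval : (InnerProductSpace.toDual ℝ (Vec m) (vertGrad F ⟨_, h⟩)) J =
      ∑ a, val (vertGradComp F a) t (y + bump t (θ₀ • J)) * J a := by
    rw [InnerProductSpace.toDual_apply_apply, PiLp.inner_apply]
    refine Finset.sum_congr rfl fun a _ => ?_
    rw [val_of_mem _ h]
    simp [vertGradComp, mul_comm]
  rw [hval] at hcomp
  refine hcomp.congr_of_eventuallyEq (.of_forall fun θ => ?_)
  simp only [Function.comp]
  rw [add_assoc, bump_add, ← add_smul]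
  simp

lemma abs_mul_coord_le (v : Vec m) (a b : Fin m) : |v b * v a| ≤ ‖v‖ ^ 2 := by
  rw [abs_mul, sq, ← Real.norm_eq_abs, ← Real.norm_eq_abs]
  exact mul_le_mul (PiLp.norm_apply_le _ b) (PiLp.norm_apply_le _ a) (norm_nonneg _)
      (norm_nonneg _)

/-- A function on `[0, ∞)` that is non-negative, monotone and tends to `0` at `0`. -/
structure IsModulus (ω : ℝ → ℝ) : Prop where
  nonneg : ∀ ρ, 0 ≤ ω ρ
  mono : Monotone ω
  small : ∀ ε > 0, ∃ η > 0, ∀ ρ ≤ η, ω ρ ≤ ε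

lemma isModulus_of_tendsto {ω : ℝ≥0 → ℝ≥0} (h : Monotone ω) (h0 : Tendsto ω (𝓝[>] 0) (𝓝 0)) :
    IsModulus fun ρ => (ω ρ.toNNReal : ℝ) where
  nonneg ρ := NNReal.coe_nonneg _
  mono a b hab := NNReal.coe_le_coe.2 (h (Real.toNNReal_mono hab))
  small ε hε := by
    have h1 : ∀ᶠ ρ in 𝓝[>] (0 : ℝ≥0), ω ρ < ε.toNNReal :=
      h0.eventually (gt_mem_nhds (Real.toNNReal_pos.2 hε))
    obtain ⟨η, hη, h2⟩ := (h1.and self_mem_nhdsWithin).exists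
    refine ⟨η, NNReal.coe_pos.2 h2, fun ρ hρ => ?_⟩
    have h3 : ρ.toNNReal ≤ η := Real.toNNReal_le_iff_le_coe.2 hρ
    have := NNReal.coe_le_coe.2 ((h h3).trans hη.le)
    rwa [Real.coe_toNNReal _ hε.le] at this

lemma IsModulus.sum {ι : Type*} (s : Finset ι) {ω : ι → ℝ → ℝ} (h : ∀ i ∈ s, IsModulus (ω i)) :
    IsModulus fun ρ => ∑ i ∈ s, ω i ρ where
  nonneg ρ := Finset.sum_nonneg fun i hi => (h i hi).nonneg ρ
  mono a b hab := Finset.sum_le_sum fun i hi => (h i hi).mono hab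
  small ε hε := by
    have hc : (0 : ℝ) < ε / (s.card + 1) := by positivity
    have : ∀ i, ∃ η > 0, i ∈ s → ∀ ρ ≤ η, ω i ρ ≤ ε / (s.card + 1) := by
      intro i
      by_cases hi : i ∈ s
      · obtain ⟨η, h1, h2⟩ := (h i hi).small _ hc
        exact ⟨η, h1, fun _ => h2⟩
      · exact ⟨1, one_pos, fun h => absurd h hi⟩
    choose η hη hs using this
    obtain ⟨η₀, h0, h1⟩ : ∃ η₀ > 0, ∀ i ∈ s, η₀ ≤ η i := by
      rcases s.eq_empty_or_nonempty with rfl | hne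
      · exact ⟨1, one_pos, by simp⟩
      · exact ⟨s.inf' hne η, (Finset.lt_inf'_iff hne).2 fun i _ => hη i,
          fun i hi => Finset.inf'_le η hi⟩
    refine ⟨η₀, h0, fun ρ hρ => ?_⟩
    refine (Finset.sum_le_card_nsmul s _ _ fun i hi => hs i hi ρ (hρ.trans (h1 i hi))).trans ?_
    rw [nsmul_eq_mul, mul_div_assoc']
    rw [div_le_iff₀ (by positivity)]
    nlinarith

/-- The remainder of the first order vertical expansion of `F` at the jump of `y` at time `t`. -/
def vertRem (F : domain Ω → ℝ) (y : CPath m) (t : ℝ≥0) : ℝ :=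
  val F t (stopAt y t) - val F t (stopAtLeft y t) -
    ∑ a, val (vertGradComp F a) t (stopAtLeft y t) * jump y t a

/-- Taylor's formula along θ ↦ x^n_{t-} + θJ 1_{[t,∞)}, where J is the jump. The modulus of vertical
continuity compares the Hessian on this segment with its value at θ = 0. -/
lemma IsC12.vert_taylor {F : domain Ω → ℝ} (hF : IsC12 P F) {x : CPath m} (hx : x ∈ Ω) (T : ℝ≥0)
    {r : ℝ} (hr : 0 < r) : ∃ ω, IsModulus ω ∧ ∀ᶠ n in atTop, ∀ t ≤ T,
      ‖jump (approx P x n) t‖ ≤ r →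
      |vertRem F (approx P x n) t - 1 / 2 * ∑ a, ∑ b,
        val (vertHess F a b) t (stopAtLeft (approx P x n) t) *
          (jump (approx P x n) t b * jump (approx P x n) t a)| ≤
      ω ‖jump (approx P x n) t‖ * ‖jump (approx P x n) t‖ ^ 2 := by
  have hmod := fun a b => hF.hess_modulus a b x hx T r hr
  choose ω hω hω0 N hN using hmod
  refine ⟨fun ρ => ∑ a, ∑ b, (ω a b ρ.toNNReal : ℝ),
    IsModulus.sum _ fun a _ => IsModulus.sum _ fun b _ => isModulus_of_tendsto (hω a b) (hω0 a b),
    ?_⟩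
  have hev : ∀ᶠ n in atTop, ∀ a b, N a b ≤ n :=
    eventually_all.2 fun a => eventually_all.2 fun b => eventually_ge_atTop _
  filter_upwards [hev] with n hn t ht hJr
  set y := approx P x n with hy
  set J := jump y t with hJ
  -- The whole segment stays in Λ: U is convex and contains 0 and -J, hence also θJ - J = θ·0 +
  -- (1-θ)(-J).
  have hpos : ∀ {U : Set (Vec m)} (_ : IsVertNhd Ω y t U) {θ : ℝ} (_ : θ ∈ Icc (0 : ℝ) 1),
      θ • J - J ∈ U := by
    intro U hU θ hθ
    have := hU.1 hU.zero_mem hU.2.2.1 hθ.1 (sub_nonneg.2 hθ.2) (by ring)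
    have e : θ • J - J = θ • (0 : Vec m) + (1 - θ) • -J := by
      rw [smul_zero, zero_add, sub_smul, one_smul, smul_neg]; abel
    rw [e]; exact this
  -- In dimension 0 there is no pair of indices from which to obtain a neighbourhood U.
  rcases Nat.eq_zero_or_pos m with hm | hm
  · subst hm
    have hJ0 : J = 0 := Subsingleton.elim _ _
    have h1 : stopAtLeft y t = stopAt y t := Subsingleton.elim _ _
    simp [vertRem, h1]
  have i0 : Fin m := ⟨0, hm⟩
  have hdom : ∀ θ ∈ Icc (0 : ℝ) 1, (t, stopAtLeft y t + bump t (θ • J)) ∈ domain Ω := by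
    intro θ hθ
    obtain ⟨U, hU, -⟩ := hN i0 i0 n (hn i0 i0) t ht
    have := hU.mem_domain (hpos hU hθ)
    convert this using 2
    rw [stopAt_eq y t, add_assoc, bump_add]
    congr 2
    rw [← hJ]; abel
  have hmain := taylor_two_bound (B := (∑ a, ∑ b, (ω a b ‖J‖.toNNReal : ℝ)) * ‖J‖ ^ 2)
    (c := ∑ a, ∑ b, val (vertHess F a b) t (stopAtLeft y t) * (J b * J a))
    (G := fun θ => val F t (stopAtLeft y t + bump t (θ • J)))
    (G1 := fun θ => ∑ a, val (vertGradComp F a) t (stopAtLeft y t + bump t (θ • J)) * J a)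
    (G2 := fun θ => ∑ a, (∑ b, val (vertHess F a b) t (stopAtLeft y t + bump t (θ • J)) * J b) * J a)
    (fun θ hθ => hF.vertDifferentiable.hasDerivAt (hdom θ hθ))
    (fun θ hθ => HasDerivAt.fun_sum fun a _ =>
      ((hF.vertDifferentiable_grad a).hasDerivAt (hdom θ hθ)).mul_const _)
    (fun θ hθ => ?_)
  · simp only [zero_smul, bump_zero, add_zero, one_smul] at hmain
    rw [vertRem, stopAt_eq y t]
    exact hmain
  · have e : (∑ a, (∑ b, val (vertHess F a b) t (stopAtLeft y t + bump t (θ • J)) * J b) * J a) -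
        ∑ a, ∑ b, val (vertHess F a b) t (stopAtLeft y t) * (J b * J a) =
        ∑ a, ∑ b, (val (vertHess F a b) t (stopAtLeft y t + bump t (θ • J)) -
          val (vertHess F a b) t (stopAtLeft y t + bump t 0)) * (J b * J a) := by
      rw [← Finset.sum_sub_distrib]
      refine Finset.sum_congr rfl fun a _ => ?_
      rw [Finset.sum_mul, ← Finset.sum_sub_distrib]
      refine Finset.sum_congr rfl fun b _ => ?_
      rw [bump_zero, add_zero]; ring
    rw [e, Finset.sum_mul]
    refine (Finset.abs_sum_le_sum_abs _ _).trans (Finset.sum_le_sum fun a _ => ?_)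
    rw [Finset.sum_mul]
    refine (Finset.abs_sum_le_sum_abs _ _).trans (Finset.sum_le_sum fun b _ => ?_)
    rw [abs_mul]
    refine mul_le_mul ?_ (abs_mul_coord_le _ _ _) (abs_nonneg _) (NNReal.coe_nonneg _)
    obtain ⟨U, hU, hUω⟩ := hN a b n (hn a b) t ht
    have hθJ : ‖θ • J‖ ≤ ‖J‖ := by
      rw [norm_smul, Real.norm_eq_abs, abs_of_nonneg hθ.1]
      exact mul_le_of_le_one_left (norm_nonneg _) hθ.2
    refine (hUω (θ • J) 0 (hpos hU hθ) (by simpa using hU.2.2.1) (hθJ.trans hJr)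
      (by simpa using hr.le)).trans ?_
    rw [NNReal.coe_le_coe]
    apply hω a b
    rw [← NNReal.coe_le_coe]
    simpa using hθJ

lemma IsCadlag.bounded {x : CPath m} (hx : IsCadlag x) (T : ℝ≥0) : ∃ C : ℝ, ∀ t ≤ T, ‖x t‖ ≤ C := by
  have : ∃ C : ℝ, ∀ t ∈ Icc 0 T, ‖x t‖ ≤ C := by
    refine isCompact_Icc.induction_on (p := fun s => ∃ C : ℝ, ∀ t ∈ s, ‖x t‖ ≤ C) ⟨0, by simp⟩ ?_ ?_ ?_
    · rintro s t hst ⟨C, hC⟩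
      exact ⟨C, fun u hu => hC u (hst hu)⟩
    · rintro s t ⟨C, hC⟩ ⟨D, hD⟩
      refine ⟨max C D, fun u hu => hu.elim (fun h => (hC u h).trans (le_max_left _ _))
        fun h => (hD u h).trans (le_max_right _ _)⟩
    · intro t _
      have hr : ∀ᶠ s in 𝓝[≥] t, ‖x s‖ < ‖x t‖ + 1 :=
        (hx t).1.norm.eventually (gt_mem_nhds (by simp))
      have hl : ∀ᶠ s in 𝓝[<] t, ‖x s‖ < ‖Function.leftLim x t‖ + 1 :=
        (hx.tendsto_leftLim t).norm.eventually (gt_mem_nhds (by simp))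
      have h : ∀ᶠ s in 𝓝 t, ‖x s‖ ≤ max (‖x t‖ + 1) (‖Function.leftLim x t‖ + 1) := by
        rw [← nhdsLT_sup_nhdsGE, eventually_sup]
        exact ⟨hl.mono fun s h => h.le.trans (le_max_right _ _),
          hr.mono fun s h => h.le.trans (le_max_left _ _)⟩
      exact ⟨_, nhdsWithin_le_nhds h, _, fun s hs => hs⟩
  obtain ⟨C, hC⟩ := this
  exact ⟨C, fun t ht => hC t ⟨zero_le, ht⟩⟩

/-- The jumps of the step approximation are dominated by the partition increments. -/
lemma jump_approx_cases (x : CPath m) {n i : ℕ} (hi : i < P.k n) :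
    (i = 0 ∧ jump (approx P x n) (P.t n i) = 0) ∨
      (0 < i ∧ jump (approx P x n) (P.t n i) = incr P x n i) := by
  rcases i with _ | i
  · left; simp [P.t_zero, jump_zero]
  · right; exact ⟨i.succ_pos, jump_approx P x hi⟩

lemma norm_jump_approx_le (x : CPath m) {n i : ℕ} (hi : i < P.k n) :
    ‖jump (approx P x n) (P.t n i)‖ ≤ ‖incr P x n i‖ := by
  rcases jump_approx_cases (P := P) x hi with ⟨-, h⟩ | ⟨-, h⟩ <;> simp [h]

lemma IsCadlag.incr_bounded {x : CPath m} (hx : IsCadlag x) (T : ℝ≥0) :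
    ∃ r > 0, ∀ᶠ n in atTop, ∀ i < P.k n, P.t n i ≤ T → ‖incr P x n i‖ ≤ r := by
  obtain ⟨C, hC⟩ := hx.bounded (T + 1)
  have hC0 : 0 ≤ C := (norm_nonneg _).trans (hC 0 zero_le)
  refine ⟨2 * C + 1, by positivity, ?_⟩
  filter_upwards [P.eventually_mesh T one_pos] with n hn i hi hT
  have h1 := hC _ (hT.trans le_self_add)
  have h2 := hC _ ((hn i hi hT).le.trans (add_le_add_left hT 1))
  exact (norm_sub_le _ _).trans (by linarith)

/-- Second order expansion of `F` at the jumps of the step approximations, with a uniform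
modulus of continuity and uniform bounds. -/
lemma IsC12.rem_bounds (hΩ : IsGeneric P Ω) {F : domain Ω → ℝ} (hF : IsC12 P F) {x : CPath m}
    (hx : x ∈ Ω) (T : ℝ≥0) : ∃ ω, IsModulus ω ∧ ∃ K ≥ 0, ∀ᶠ n in atTop, ∀ i < P.k n,
      P.t n i ≤ T →
      |vertRem F (approx P x n) (P.t n i) - 1 / 2 * ∑ a, ∑ b,
        val (vertHess F a b) (P.t n i) (stopAtLeft (approx P x n) (P.t n i)) *
          (jump (approx P x n) (P.t n i) b * jump (approx P x n) (P.t n i) a)| ≤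
        ω ‖incr P x n i‖ * ‖incr P x n i‖ ^ 2 ∧
      |vertRem F (approx P x n) (P.t n i)| ≤ K * ‖incr P x n i‖ ^ 2 := by
  obtain ⟨r, hr, hrb⟩ := (hΩ.cadlag x hx).incr_bounded (P := P) T
  obtain ⟨ω, hω, hT⟩ := hF.vert_taylor hx T hr
  have hH := fun a b => hF.hess_locBounded a b x hx T
  choose N K hK using hH
  have hev : ∀ᶠ n in atTop, ∀ a b, N a b ≤ n :=
    eventually_all.2 fun a => eventually_all.2 fun b => eventually_ge_atTop _
  -- The constant adds the worst Taylor error for increments of norm at most r to the bound on the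
  -- Hessian term.
  refine ⟨ω, hω, ω r + 1 / 2 * ∑ a, ∑ b, |K a b|, add_nonneg (hω.nonneg _) (by positivity), ?_⟩
  filter_upwards [hrb, hT, hev, hΩ.approx_domain hx T] with n h1 h2 h3 h4 i hi hiT
  have hJ := norm_jump_approx_le (P := P) x hi
  have hJr := h1 i hi hiT
  have h5 := h2 _ hiT (hJ.trans hJr)
  have h6 : ω ‖jump (approx P x n) (P.t n i)‖ * ‖jump (approx P x n) (P.t n i)‖ ^ 2 ≤
      ω ‖incr P x n i‖ * ‖incr P x n i‖ ^ 2 :=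
    mul_le_mul (hω.mono hJ) (by gcongr) (by positivity) (hω.nonneg _)
  refine ⟨h5.trans h6, ?_⟩
  have h7 : |1 / 2 * ∑ a, ∑ b,
        val (vertHess F a b) (P.t n i) (stopAtLeft (approx P x n) (P.t n i)) *
          (jump (approx P x n) (P.t n i) b * jump (approx P x n) (P.t n i) a)| ≤
      (1 / 2 * ∑ a, ∑ b, |K a b|) * ‖incr P x n i‖ ^ 2 := by
    rw [abs_mul, abs_of_pos (by norm_num : (0 : ℝ) < 1 / 2), mul_assoc]
    refine mul_le_mul_of_nonneg_left ?_ (by norm_num)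
    rw [Finset.sum_mul]
    refine (Finset.abs_sum_le_sum_abs _ _).trans (Finset.sum_le_sum fun a _ => ?_)
    rw [Finset.sum_mul]
    refine (Finset.abs_sum_le_sum_abs _ _).trans (Finset.sum_le_sum fun b _ => ?_)
    rw [abs_mul]
    refine mul_le_mul ?_ ((abs_mul_coord_le _ _ _).trans (by gcongr)) (abs_nonneg _) (abs_nonneg _)
    have := hK a b n (h3 a b) _ hiT
    obtain ⟨y, hy, hyy⟩ := (h4 _ hiT).1
    rw [val_minus _ (h4 _ hiT).1] at this
    have e : stopAtLeft (stopAt (approx P x n) (P.t n i)) (P.t n i) =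
        stopAtLeft (approx P x n) (P.t n i) := by
      rcases eq_zero_or_pos (P.t n i) with h0 | h0
      · rw [h0, stopAtLeft_zero, stopAtLeft_zero, stopAt_stopAt _ le_rfl]
      · refine stopAtLeft_congr h0 ?_ fun s hs => stopAt_apply_of_le _ hs.le
        have hc := hΩ.cadlag _ (hΩ.mem_of_domain (h4 _ hiT).1)
        exact (hc _).2
    rw [e] at this
    exact this.trans (le_abs_self _)
  have h8 := abs_add_le (vertRem F (approx P x n) (P.t n i) - 1 / 2 * ∑ a, ∑ b,
        val (vertHess F a b) (P.t n i) (stopAtLeft (approx P x n) (P.t n i)) *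
          (jump (approx P x n) (P.t n i) b * jump (approx P x n) (P.t n i) a)) (1 / 2 * ∑ a, ∑ b,
        val (vertHess F a b) (P.t n i) (stopAtLeft (approx P x n) (P.t n i)) *
          (jump (approx P x n) (P.t n i) b * jump (approx P x n) (P.t n i) a))
  rw [sub_add_cancel] at h8
  have h9 : ω ‖incr P x n i‖ * ‖incr P x n i‖ ^ 2 ≤ ω r * ‖incr P x n i‖ ^ 2 :=
    mul_le_mul_of_nonneg_right (hω.mono hJr) (by positivity)
  rw [add_mul]
  linarith

end Taylor

/-- The function is the pointwise limit of its values at the next grid point to the right, and each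
such approximation depends on s through an integer only. -/
lemma measurable_of_rightContinuous {f : ℝ≥0 → ℝ} (hf : ∀ t, ContinuousWithinAt f (Ici t) t) :
    Measurable f := by
  have hmeas : ∀ n : ℕ, Measurable fun s : ℝ≥0 =>
      f (((⌊s * (n + 1)⌋₊ : ℝ≥0) + 1) / ((n : ℝ≥0) + 1)) := by
    intro n
    have h1 : Measurable fun s : ℝ≥0 => ⌊s * ((n : ℝ≥0) + 1)⌋₊ :=
      Nat.measurable_floor.comp (measurable_id.mul_const _)
    exact (measurable_from_nat (f := fun j : ℕ => f (((j : ℝ≥0) + 1) / ((n : ℝ≥0) + 1)))).comp h1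
  refine measurable_of_tendsto_metrizable hmeas (tendsto_pi_nhds.2 fun s => ?_)
  refine (hf s).tendsto.comp (tendsto_nhdsWithin_iff.2 ⟨?_, .of_forall fun n => ?_⟩)
  · have hlim : Tendsto (fun n : ℕ => s + 1 / ((n : ℝ≥0) + 1)) atTop (𝓝 s) := by
      simpa using (tendsto_one_div_add_atTop_nhds_zero_nat (𝕜 := ℝ≥0)).const_add s
    refine tendsto_of_tendsto_of_tendsto_of_le_of_le tendsto_const_nhds hlim (fun n => ?_)
      fun n => ?_
    · rw [le_div_iff₀ (by positivity)]
      exact (Nat.lt_floor_add_one _).le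
    · simp only
      rw [div_le_iff₀ (by positivity), add_mul, one_div, inv_mul_cancel₀ (by positivity)]
      exact add_le_add_left (Nat.floor_le zero_le) 1
  · simp only [mem_Ici]
    rw [le_div_iff₀ (by positivity)]
    exact (Nat.lt_floor_add_one _).le

/-! ### Telescoping along a partition -/

section Telescope

variable {P : PartitionSeq}

/-- Telescoping of a pair of functions (values and left values) along a partition. -/
lemma step_telescope {n : ℕ} {α β S : ℝ≥0 → ℝ} {T : ℝ≥0} (hT : T < P.t n (P.k n))
    (h0 : α 0 = β 0)
    (hα : ∀ i < P.k n, ∀ u ≤ T, P.t n i ≤ u → u < P.t n (i + 1) →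
      α u - α (P.t n i) = S u - S (P.t n i))
    (hβ : ∀ i < P.k n, ∀ u ≤ T, P.t n i < u → u ≤ P.t n (i + 1) →
      β u - α (P.t n i) = S u - S (P.t n i)) :
    (∀ u ≤ T, α u = α 0 + (S u - S 0) +
      stepSum P (fun n i => α (P.t n i) - β (P.t n i)) n u) ∧
    (∀ u ≤ T, 0 < u → β u = α 0 + (S u - S 0) +
      stepSum P (fun n i => α (P.t n i) - β (P.t n i)) n (P.prev n u)) := by
  have key : ∀ i < P.k n, P.t n i ≤ T → α (P.t n i) = α 0 + (S (P.t n i) - S 0) +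
      ∑ j ∈ Finset.range (i + 1), (α (P.t n j) - β (P.t n j)) := by
    intro i
    induction i with
    | zero => intro _ _; simp [P.t_zero, h0]
    | succ i ih =>
      intro hi hiT
      have hi' : i < P.k n := by omega
      have hlt := P.t_lt_succ hi'
      have h1 := ih hi' (hlt.le.trans hiT)
      have h2 := hβ i hi' _ hiT hlt le_rfl
      rw [Finset.sum_range_succ]
      linarith
  constructor
  · intro u hu
    obtain ⟨i, hi, h1, h2⟩ := P.exists_index (hu.trans_lt hT)
    rw [stepSum_eq_of_le hi h1 h2]
    have h3 := key i hi (h1.trans hu)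
    have h4 := hα i hi u hu h1 h2
    linarith
  · intro u hu hu0
    obtain ⟨i, hi, h1, h2, h3⟩ := P.exists_prev_index hu0 (hu.trans hT.le)
    rw [← h1, stepSum_eq_of_le hi le_rfl (P.t_lt_succ hi)]
    have h4 := key i hi (h2.le.trans hu)
    have h5 := hβ i hi u hu h2 h3
    linarith

end Telescope

/-! ### The horizontal integral and the discrete change of variable formula -/

section Horizontal

variable {m : ℕ} {Ω : Set (CPath m)} {P : PartitionSeq}

/-- The time integral of the horizontal derivative along a path. -/
def horizInt (F : domain Ω → ℝ) (x : CPath m) (u : ℝ≥0) : ℝ :=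
  ∫ s in (0 : ℝ)..u, val (horizDeriv F) s.toNNReal (stopAt x s.toNNReal)

lemma HorizDifferentiable.tendsto {F : domain Ω → ℝ} (hF : HorizDifferentiable F) {t : ℝ≥0}
    {w : CPath m} (hw : (t, w) ∈ domain Ω) :
    Tendsto (fun h : ℝ≥0 => (val F (t + h) w - val F t w) / (h : ℝ)) (𝓝[>] 0)
      (𝓝 (val (horizDeriv F) t w)) := by
  rw [val_of_mem _ hw, val_of_mem _ hw]
  exact tendsto_nhds_limUnder (hF ⟨_, hw⟩)

/-- Horizontal increments are integrals of the horizontal derivative. -/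
lemma horizontal_ftc (hΩ : IsGeneric P Ω) {F : domain Ω → ℝ} (hl : LeftCts P F)
    (hr : RightCts P F) (hd : HorizDifferentiable F) {a b : ℝ≥0} (hab : a ≤ b) {w : CPath m}
    (hw : (a, w) ∈ domain Ω) {D : ℝ → ℝ}
    (hD : ∀ s : ℝ≥0, a < s → s < b → D s = val (horizDeriv F) s w)
    (hint : IntervalIntegrable D volume a b) :
    ∫ s in (a : ℝ)..b, D s = val F b w - val F a w := by
  have hwΩ := hΩ.mem_of_domain hw
  have hdom : ∀ s, a ≤ s → (s, w) ∈ domain Ω := fun s hs => hΩ.domain_later hw hs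
  have stoppedEq : ∀ s, a ≤ s → stopAt w s = w := fun s hs => stopAt_of_domain (hdom s hs)
  have hright : ∀ s, a ≤ s → Tendsto (fun s => val F s w) (𝓝[≥] s) (𝓝 (val F s w)) := by
    intro s hs
    have := hr.a w hwΩ s
    rw [stoppedEq s hs] at this
    refine this.congr' ?_
    filter_upwards [self_mem_nhdsWithin] with u hu
    rw [stoppedEq u (hs.trans hu)]
  have hleft : ∀ s, a < s → Tendsto (fun s => val F s w) (𝓝[≤] s) (𝓝 (val F s w)) := by
    intro s hs
    have e : ∀ u, a < u → stopAtLeft w u = w := fun u hu => by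
      conv_lhs => rw [← stoppedEq a le_rfl]
      rw [stopAtLeft_stopAt_of_lt _ hu, stoppedEq a le_rfl]
    have := hl.a w hwΩ s
    rw [e s hs] at this
    refine this.congr' ?_
    filter_upwards [mem_nhdsWithin_of_mem_nhds (Ioi_mem_nhds hs)] with u hu
    rw [e u hu]
  -- For a fixed stopped path w, left-stopping at a time after a changes nothing, so left- and
  -- right-continuity of F combine to ordinary continuity in time.
  have hcont : ContinuousOn (fun s => val F s w) (Icc a b) := by
    intro s hs
    rcases eq_or_lt_of_le hs.1 with rfl | h
    · exact (hright a le_rfl).mono_left (nhdsWithin_mono _ Icc_subset_Ici_self)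
    · have : ContinuousAt (fun s => val F s w) s :=
        continuousAt_iff_continuous_left_right.2 ⟨hleft s h, hright s hs.1⟩
      exact this.continuousWithinAt
  have hab' : (a : ℝ) ≤ b := hab
  -- Only a right derivative is available; for a continuous function with integrable right
  -- derivative this suffices.
  have h := intervalIntegral.integral_eq_sub_of_hasDeriv_right_of_le
    (f := fun s : ℝ => val F s.toNNReal w) (f' := D) hab' ?_ ?_ hint
  · simpa using h
  · refine hcont.comp continuous_real_toNNReal.continuousOn fun s hs => ?_
    exact ⟨by simpa using Real.toNNReal_mono hs.1, by simpa using Real.toNNReal_mono hs.2⟩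
  · intro s hs
    have hs0 : 0 ≤ s := a.2.trans hs.1.le
    lift s to ℝ≥0 using hs0
    have has : a < s := by exact_mod_cast hs.1
    have hsb : s < b := by exact_mod_cast hs.2
    rw [hD s has hsb, hasDerivWithinAt_iff_tendsto_slope' (by simp)]
    have ht := hd.tendsto (hdom s has.le)
    have hmap : Tendsto (fun u : ℝ => (u - s).toNNReal) (𝓝[>] (s : ℝ)) (𝓝[>] 0) := by
      refine tendsto_nhdsWithin_iff.2 ⟨?_, ?_⟩
      · have : Tendsto (fun u : ℝ => (u - s).toNNReal) (𝓝 (s : ℝ)) (𝓝 ((s : ℝ) - s).toNNReal) :=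
          (continuous_real_toNNReal.comp (continuous_id.sub continuous_const)).tendsto _
        simp only [sub_self, Real.toNNReal_zero] at this
        exact this.mono_left nhdsWithin_le_nhds
      · filter_upwards [self_mem_nhdsWithin] with u hu
        simpa using hu
    refine (ht.comp hmap).congr' ?_
    filter_upwards [self_mem_nhdsWithin] with u hu
    have hu : (s : ℝ) < u := hu
    have e : s + (u - s).toNNReal = u.toNNReal := by
      rw [← NNReal.coe_inj]
      push_cast
      rw [Real.coe_toNNReal _ (by linarith), Real.coe_toNNReal _ (by linarith [s.2])]
      ring
    simp only [Function.comp, slope_def_field, e, Real.toNNReal_coe]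
    rw [Real.coe_toNNReal _ (by linarith)]

lemma RightCts.measurable {G : domain Ω → ℝ} (hG : RightCts P G) {y : CPath m} (hy : y ∈ Ω) :
    Measurable fun s : ℝ => val G s.toNNReal (stopAt y s.toNNReal) := by
  have : Measurable fun s : ℝ≥0 => val G s (stopAt y s) :=
    measurable_of_rightContinuous fun t => hG.a y hy t
  exact this.comp measurable_real_toNNReal

lemma intervalIntegrable_of_bounded {f : ℝ → ℝ} (hf : Measurable f) {K : ℝ} {a b : ℝ≥0}
    (hab : a ≤ b) (hK : ∀ s : ℝ≥0, s ≤ b → |f s| ≤ K) : IntervalIntegrable f volume a b := by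
  rw [intervalIntegrable_iff_integrableOn_Ioc_of_le (NNReal.coe_le_coe.2 hab)]
  refine Measure.integrableOn_of_bounded (M := K) (by simp) hf.aestronglyMeasurable ?_
  rw [ae_restrict_iff' measurableSet_Ioc]
  refine .of_forall fun s hs => ?_
  have hs0 : 0 ≤ s := a.2.trans hs.1.le
  lift s to ℝ≥0 using hs0
  exact hK s (by exact_mod_cast hs.2)

variable {F : domain Ω → ℝ}

/-- Uniform bound and integrability for the horizontal derivative along step approximations. -/
lemma IsC12.horiz_approx (hΩ : IsGeneric P Ω) (hF : IsC12 P F) {x : CPath m} (hx : x ∈ Ω)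
    (T : ℝ≥0) : ∃ K : ℝ, ∀ᶠ n in atTop,
      (∀ s ≤ T, |val (horizDeriv F) s (stopAt (approx P x n) s)| ≤ K) ∧
      ∀ a b : ℝ≥0, a ≤ b → b ≤ T → IntervalIntegrable
        (fun s : ℝ => val (horizDeriv F) s.toNNReal (stopAt (approx P x n) s.toNNReal))
        volume a b := by
  obtain ⟨N, K, hK⟩ := hF.horizDeriv_locBounded x hx T
  refine ⟨K, ?_⟩
  filter_upwards [eventually_ge_atTop N, hΩ.approx_stop hx T] with n hn ⟨y, hy, hyn⟩
  refine ⟨fun s hs => hK n hn s hs, fun a b hab hb => ?_⟩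
  have h1 : IntervalIntegrable
      (fun s : ℝ => val (horizDeriv F) s.toNNReal (stopAt y s.toNNReal)) volume a b :=
    intervalIntegrable_of_bounded (hF.horizDeriv_rightCts.measurable hy) hab (K := K)
      fun s hs => by
        rw [Real.toNNReal_coe, (hyn s (hs.trans hb)).1]
        exact hK n hn s (hs.trans hb)
  refine h1.congr fun s hs => ?_
  rw [uIoc_of_le (by exact_mod_cast hab)] at hs
  have : s.toNNReal ≤ T := (Real.toNNReal_le_iff_le_coe.2 hs.2).trans hb
  rw [(hyn _ this).1]

lemma IsC12.tendsto_horiz (hF : IsC12 P F) {x : CPath m} (hx : x ∈ Ω) (s : ℝ≥0) :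
    Tendsto (fun n => val (horizDeriv F) s (stopAt (approx P x n) s)) atTop
      (𝓝 (val (horizDeriv F) s (stopAt x s))) :=
  hF.horizDeriv_rightCts.c x hx s (fun _ => s) tendsto_const_nhds (.of_forall fun n => P.prev_le n s)

lemma IsC12.horiz_bounded (hΩ : IsGeneric P Ω) (hF : IsC12 P F) {x : CPath m} (hx : x ∈ Ω)
    (T : ℝ≥0) : ∃ K : ℝ, ∀ s ≤ T, |val (horizDeriv F) s (stopAt x s)| ≤ K := by
  obtain ⟨K, hK⟩ := hF.horiz_approx hΩ hx T
  exact ⟨K, fun s hs => le_of_tendsto (hF.tendsto_horiz hx s).abs (hK.mono fun n hn => hn.1 s hs)⟩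

lemma IsC12.horiz_integrable (hΩ : IsGeneric P Ω) (hF : IsC12 P F) {x : CPath m} (hx : x ∈ Ω)
    {a b : ℝ≥0} (hab : a ≤ b) : IntervalIntegrable
      (fun s : ℝ => val (horizDeriv F) s.toNNReal (stopAt x s.toNNReal)) volume a b := by
  obtain ⟨K, hK⟩ := hF.horiz_bounded hΩ hx b
  exact intervalIntegrable_of_bounded (hF.horizDeriv_rightCts.measurable hx) hab (K := K)
    fun s hs => by simpa using hK s hs

/-- Dominated convergence at the fixed endpoint t; moving the endpoint to u costs at most K|u - t|,
uniformly in n. -/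
lemma IsC12.tendsto_horizInt (hΩ : IsGeneric P Ω) (hF : IsC12 P F) {x : CPath m} (hx : x ∈ Ω)
    (t : ℝ≥0) : Tendsto (fun p : ℕ × ℝ≥0 => horizInt F (approx P x p.1) p.2) (atTop ×ˢ 𝓝 t)
      (𝓝 (horizInt F x t)) := by
  obtain ⟨K, hK⟩ := hF.horiz_approx hΩ hx (t + 1)
  have h1 : Tendsto (fun n => horizInt F (approx P x n) t) atTop (𝓝 (horizInt F x t)) := by
    refine intervalIntegral.tendsto_integral_filter_of_dominated_convergence (fun _ => K) ?_ ?_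
      (by simp) ?_
    · filter_upwards [hK] with n hn
      exact (hn.2 0 t zero_le le_self_add).aestronglyMeasurable_restrict_uIoc
    · filter_upwards [hK] with n hn
      refine .of_forall fun s hs => ?_
      rw [uIoc_of_le (NNReal.coe_nonneg t)] at hs
      exact hn.1 _ ((Real.toNNReal_le_iff_le_coe.2 hs.2).trans le_self_add)
    · exact .of_forall fun s _ => hF.tendsto_horiz hx _
  have h2 : Tendsto (fun p : ℕ × ℝ≥0 => horizInt F (approx P x p.1) p.2 -
      horizInt F (approx P x p.1) t) (atTop ×ˢ 𝓝 t) (𝓝 0) := by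
    have hlim : Tendsto (fun p : ℕ × ℝ≥0 => K * |(p.2 : ℝ) - t|) (atTop ×ˢ 𝓝 t) (𝓝 0) := by
      have h3 : Tendsto (fun p : ℕ × ℝ≥0 => (p.2 : ℝ)) (atTop ×ˢ 𝓝 t) (𝓝 (t : ℝ)) :=
        (NNReal.continuous_coe.tendsto t).comp tendsto_snd
      have := ((h3.sub_const (t : ℝ)).abs).const_mul K
      simpa using this
    refine squeeze_zero_norm' ?_ hlim
    filter_upwards [hK.prod_mk (eventually_le_nhds (show t < t + 1 by simp))] with p ⟨hn, hp⟩
    rw [horizInt, horizInt, intervalIntegral.integral_interval_sub_left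
      (NNReal.coe_zero ▸ hn.2 0 _ zero_le hp) (NNReal.coe_zero ▸ hn.2 0 _ zero_le le_self_add)]
    refine intervalIntegral.norm_integral_le_of_norm_le_const fun s hs => hn.1 _ ?_
    have := hs.2
    rw [Real.toNNReal_le_iff_le_coe]
    refine this.trans ?_
    rw [max_le_iff]
    exact ⟨by exact_mod_cast (le_self_add : t ≤ t + 1), by exact_mod_cast hp⟩
  have h4 : Tendsto (fun p : ℕ × ℝ≥0 => horizInt F (approx P x p.1) t) (atTop ×ˢ 𝓝 t)
    (𝓝 (horizInt F x t)) := h1.comp tendsto_fst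
  simpa using h2.add h4

/-- The first term of the Riemann sums. -/
def initTerm (P : PartitionSeq) (F : domain Ω → ℝ) (x : CPath m) (n : ℕ) : ℝ :=
  inner ℝ (val (vertGrad F) (P.t n 0) (stopAtLeft (approx P x n) (P.t n 0))) (incr P x n 0)

lemma inner_vertGrad (F : domain Ω → ℝ) (t : ℝ≥0) (y : CPath m) (v : Vec m) :
    inner ℝ (val (vertGrad F) t y) v = ∑ a, val (vertGradComp F a) t y * v a := by
  rw [PiLp.inner_apply]
  refine Finset.sum_congr rfl fun a _ => ?_
  rw [val_vertGrad]
  simp [mul_comm]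

lemma tendsto_incr_zero {x : CPath m} (hx : IsCadlag x) :
    Tendsto (fun n => incr P x n 0) atTop (𝓝 0) := by
  rw [Metric.tendsto_nhds]
  intro ε hε
  filter_upwards [eventually_next (P := P) hx 0 hε, P.eventually_lt_last 0] with n h1 h2
  have hk : 0 < P.k n := by
    by_contra! h
    rw [Nat.le_zero.1 h, P.t_zero] at h2
    exact lt_irrefl _ h2
  simpa [incr, P.t_zero] using h1 0 hk (by simp [P.t_zero]) zero_le

/-- The Riemann sum contains the increment starting at time 0, whereas x^n has no jump there.
Right-continuity of x at 0 makes this discrepancy vanish. -/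
lemma tendsto_initTerm (hΩ : IsGeneric P Ω) (hg : ∀ a, LeftCts P (minus (vertGradComp F a)))
    {x : CPath m} (hx : x ∈ Ω) : Tendsto (initTerm P F x) atTop (𝓝 0) := by
  have h1 := fun a => (((hg a).minus_nearLeft hΩ hx 0).comp (P.nearLeft_prev 0)).mul
    (((EuclideanSpace.proj (𝕜 := ℝ) a).continuous.tendsto _).comp
      (tendsto_incr_zero (P := P) (hΩ.cadlag x hx)))
  have h2 := tendsto_finsetSum Finset.univ fun a _ => h1 a
  simp only [map_zero, mul_zero, Finset.sum_const_zero] at h2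
  refine h2.congr fun n => ?_
  simp [initTerm, inner_vertGrad, P.t_zero, P.prev_zero]

/-- Riemann sums with jumps of the step path in place of partition increments. -/
lemma riemannSum_eq_stepSum (F : domain Ω → ℝ) (x : CPath m) (u : ℝ≥0) {n : ℕ} (hk : 0 < P.k n) :
    riemannSum P (vertGrad F) x u n = initTerm P F x n + stepSum P (fun n i =>
      ∑ a, val (vertGradComp F a) (P.t n i) (stopAtLeft (approx P x n) (P.t n i)) *
        jump (approx P x n) (P.t n i) a) n u := by
  have h0 : initTerm P F x n = ∑ i ∈ (Finset.range (P.k n)).filter (fun i => P.t n i ≤ u),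
      if i = 0 then initTerm P F x n else 0 := by
    rw [Finset.sum_ite_eq', if_pos]
    simp [hk, P.t_zero]
  rw [h0, riemannSum, stepSum, ← Finset.sum_add_distrib]
  refine Finset.sum_congr rfl fun i hi => ?_
  have hik := Finset.mem_range.1 (Finset.mem_filter.1 hi).1
  rcases jump_approx_cases (P := P) x hik with ⟨rfl, h⟩ | ⟨h1, h⟩
  · simp [h, initTerm, incr]
  · rw [if_neg h1.ne', h, ← inner_vertGrad, zero_add]; rfl

/-- Discrete change of variable formula along the step approximations. -/
lemma IsC12.riemannSum_eq (hΩ : IsGeneric P Ω) (hF : IsC12 P F) {x : CPath m} (hx : x ∈ Ω)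
    (T : ℝ≥0) : ∀ᶠ n in atTop, ∀ u ≤ T, riemannSum P (vertGrad F) x u n =
      initTerm P F x n + (val F u (stopAt (approx P x n) u) - val F 0 (stopAt (approx P x n) 0)) -
      horizInt F (approx P x n) u -
      stepSum P (fun n i => vertRem F (approx P x n) (P.t n i)) n u := by
  obtain ⟨K, hK⟩ := hF.horiz_approx hΩ hx T
  filter_upwards [hK, P.eventually_lt_last T, hΩ.approx_domain hx T] with n hn hT hdom u hu
  have hk : 0 < P.k n := by
    by_contra! h
    rw [Nat.le_zero.1 h, P.t_zero] at hT
    exact not_lt_zero hT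
  have hl := hF.continuous.leftCts hΩ
  have hr := hF.continuous.rightCts hΩ
  have hS : ∀ a b : ℝ≥0, a ≤ b → b ≤ T → horizInt F (approx P x n) b -
      horizInt F (approx P x n) a = ∫ s in (a : ℝ)..b,
        val (horizDeriv F) s.toNNReal (stopAt (approx P x n) s.toNNReal) := by
    intro a b hab hb
    exact intervalIntegral.integral_interval_sub_left
      (NNReal.coe_zero ▸ hn.2 0 b zero_le hb) (NNReal.coe_zero ▸ hn.2 0 a zero_le (hab.trans hb))
  have hstep : ∀ i < P.k n, ∀ u ≤ T, P.t n i ≤ u → u ≤ P.t n (i + 1) →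
      val F u (stopAt (approx P x n) (P.t n i)) - val F (P.t n i)
        (stopAt (approx P x n) (P.t n i)) =
      horizInt F (approx P x n) u - horizInt F (approx P x n) (P.t n i) := by
    intro i hi u hu h1 h2
    rw [hS _ _ h1 hu]
    refine (horizontal_ftc hΩ hl hr hF.horizDifferentiable h1 (hdom _ (h1.trans hu)).1 ?_
      (hn.2 _ _ h1 hu)).symm
    intro s hs1 hs2
    rw [Real.toNNReal_coe, stopAt_approx P x hi hs1.le (hs2.trans_le h2)]
  -- On [t_i, t_{i+1}) the stopped step path is frozen, so the change of F is the horizontal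
  -- integral; what remains are the vertical moves at partition points.
  have htel := (step_telescope (α := fun u => val F u (stopAt (approx P x n) u))
    (β := fun u => val F u (stopAtLeft (approx P x n) u))
    (S := horizInt F (approx P x n)) hT (by simp [stopAtLeft_zero])
    (fun i hi u hu h1 h2 => by
      rw [stopAt_approx P x hi h1 h2]; exact hstep i hi u hu h1 h2.le)
    (fun i hi u hu h1 h2 => by
      rw [stopAtLeft_approx P x hi h1 h2]; exact hstep i hi u hu h1.le h2)).1 u hu
  have h00 : horizInt F (approx P x n) 0 = 0 := by simp [horizInt]
  rw [riemannSum_eq_stepSum F x u hk]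
  have hsplit : stepSum P (fun n i => ∑ a, val (vertGradComp F a) (P.t n i)
      (stopAtLeft (approx P x n) (P.t n i)) * jump (approx P x n) (P.t n i) a) n u =
      stepSum P (fun n' i => val F (P.t n' i) (stopAt (approx P x n) (P.t n' i)) -
        val F (P.t n' i) (stopAtLeft (approx P x n) (P.t n' i))) n u -
      stepSum P (fun n i => vertRem F (approx P x n) (P.t n i)) n u := by
    rw [stepSum, stepSum, stepSum, ← Finset.sum_sub_distrib]
    refine Finset.sum_congr rfl fun i _ => ?_
    rw [vertRem]; ring
  rw [hsplit]
  simp only [h00] at htel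
  linarith

end Horizontal

/-- A right-continuous function whose left increments are, at every point, eventually negligible
against those of another right-continuous function does not increase. -/
lemma le_of_left_increments {E w : ℝ≥0 → ℝ} (hE : ∀ t, ContinuousWithinAt E (Ici t) t)
    (hw : ∀ t, ContinuousWithinAt w (Ici t) t)
    (h : ∀ t > 0, ∀ ε > 0, ∃ l < t, E t - E l ≤ ε * (w t - w l)) (T : ℝ≥0) : E T ≤ E 0 := by
  have key : ∀ ε > 0, E T - E 0 ≤ ε * (w T - w 0) := by
    intro ε hε
    -- The times from which the bound reaches T. Right-continuity puts the infimum in the set, and a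
    -- left step from a positive infimum would contradict minimality.
    set S : Set ℝ≥0 := {s | s ≤ T ∧ E T - E s ≤ ε * (w T - w s)} with hS
    have hTS : T ∈ S := ⟨le_rfl, by simp⟩
    set s₀ := sInf S with hs₀
    have hs₀S : s₀ ∈ S := by
      refine ⟨csInf_le (OrderBot.bddBelow S) hTS, ?_⟩
      have hcl : s₀ ∈ closure S := csInf_mem_closure ⟨T, hTS⟩ (OrderBot.bddBelow S)
      have hfr : ∃ᶠ s in 𝓝[≥] s₀, s ∈ S := by
        rw [mem_closure_iff_frequently] at hcl
        rw [frequently_nhdsWithin_iff]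
        exact hcl.mono fun s hs => ⟨hs, csInf_le (OrderBot.bddBelow S) hs⟩
      have ht : Tendsto (fun s => ε * (w T - w s) - (E T - E s)) (𝓝[≥] s₀)
          (𝓝 (ε * (w T - w s₀) - (E T - E s₀))) :=
        (((hw s₀).tendsto.const_sub (w T)).const_mul ε).sub ((hE s₀).tendsto.const_sub (E T))
      have := isClosed_Ici.mem_of_frequently_of_tendsto (s := Ici (0 : ℝ))
        (hfr.mono fun s hs => sub_nonneg.2 hs.2) ht
      exact sub_nonneg.1 this
    rcases eq_zero_or_pos s₀ with h0 | h0
    · rw [← h0]; exact hs₀S.2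
    · obtain ⟨l, hl, hl2⟩ := h s₀ h0 ε hε
      have : l ∈ S := by
        refine ⟨hl.le.trans hs₀S.1, ?_⟩
        have := hs₀S.2
        linarith
      exact absurd (csInf_le (OrderBot.bddBelow S) this) hl.not_ge
  by_contra! hcon
  have hC : 0 < |w T - w 0| + 1 := by positivity
  -- This ε turns the bound into E T - E 0 ≤ (E T - E 0)/2.
  have h1 := key ((E T - E 0) / (2 * (|w T - w 0| + 1))) (div_pos (by linarith) (by positivity))
  have h2 : (E T - E 0) / (2 * (|w T - w 0| + 1)) * (w T - w 0) ≤
      (E T - E 0) / (2 * (|w T - w 0| + 1)) * (|w T - w 0| + 1) :=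
    mul_le_mul_of_nonneg_left (by linarith [le_abs_self (w T - w 0)])
      (div_pos (by linarith) (by positivity)).le
  have h3 : (E T - E 0) / (2 * (|w T - w 0| + 1)) * (|w T - w 0| + 1) = (E T - E 0) / 2 := by
    field_simp
  linarith

/-! ### Accumulated second-order remainders -/

section Remainder

variable {m : ℕ} {Ω : Set (CPath m)} {P : PartitionSeq} {F : domain Ω → ℝ} {x : CPath m}
  {q : ℝ≥0 → Matrix (Fin m) (Fin m) ℝ}

/-- The accumulated second order remainders along the `n`-th step approximation. -/
def remSum (P : PartitionSeq) (F : domain Ω → ℝ) (x : CPath m) (n : ℕ) (u : ℝ≥0) : ℝ :=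
  stepSum P (fun n i => vertRem F (approx P x n) (P.t n i)) n u

/-- The scalar discrete quadratic variation. -/
def sqSum (P : PartitionSeq) (x : CPath m) (n : ℕ) (u : ℝ≥0) : ℝ :=
  stepSum P (fun n i => ‖incr P x n i‖ ^ 2) n u

/-- The entries of the discrete quadratic variation. -/
def crossSum (P : PartitionSeq) (x : CPath m) (a b : Fin m) (n : ℕ) (u : ℝ≥0) : ℝ :=
  stepSum P (fun n i => incr P x n i a * incr P x n i b) n u

lemma sqSum_eq (n : ℕ) (u : ℝ≥0) : sqSum P x n u = ∑ a, crossSum P x a a n u := by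
  simp only [sqSum, crossSum, stepSum]
  rw [Finset.sum_comm]
  refine Finset.sum_congr rfl fun i _ => ?_
  rw [EuclideanSpace.real_norm_sq_eq]
  exact Finset.sum_congr rfl fun a _ => sq _

lemma sqSum_mono (n : ℕ) : Monotone (sqSum P x n) := stepSum_mono fun _ => by positivity

lemma IsQuadVar.tendsto_sqSum (hx : IsCadlag x) (hq : IsQuadVar P x q) (t : ℝ≥0) :
    Tendsto (fun p : ℕ × ℝ≥0 => sqSum P x p.1 p.2) (P.nearRight t) (𝓝 (∑ a, q t a a)) := by
  simp only [sqSum_eq]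
  exact tendsto_finsetSum _ fun a _ => ((hq.tendsto hx a a).2 t).1

lemma IsQuadVar.tendsto_sqSum_left (hx : IsCadlag x) (hq : IsQuadVar P x q) (t : ℝ≥0) :
    Tendsto (fun p : ℕ × ℝ≥0 => sqSum P x p.1 p.2) (P.nearLeftStrict t)
      (𝓝 (∑ a, Function.leftLim (fun s => q s a a) t)) := by
  simp only [sqSum_eq]
  exact tendsto_finsetSum _ fun a _ => ((hq.tendsto hx a a).2 t).2

lemma IsQuadVar.trace_rightCts (hx : IsCadlag x) (hq : IsQuadVar P x q) (t : ℝ≥0) :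
    ContinuousWithinAt (fun s => ∑ a, q s a a) (Ici t) t := by
  unfold ContinuousWithinAt
  exact tendsto_finsetSum _ fun a _ => ((hq.tendsto hx a a).1 t).1

/-- Transfers boundedness, right-continuity and one-sided limits from the discrete quadratic
variation to the remainders. -/
lemma remSum_sub_le (hΩ : IsGeneric P Ω) (hF : IsC12 P F) (hx : x ∈ Ω) (T : ℝ≥0) :
    ∃ K ≥ 0, ∀ᶠ n in atTop, ∀ s ≤ T, ∀ t ≤ T,
      |remSum P F x n t - remSum P F x n s| ≤ K * |sqSum P x n t - sqSum P x n s| := by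
  obtain ⟨ω, -, K, hK, h⟩ := hF.rem_bounds hΩ hx T
  refine ⟨K, hK, ?_⟩
  filter_upwards [h] with n hn s hs t ht
  exact abs_stepSum_sub_le' hK hs ht fun i hi hiT => (hn i hi hiT).2

lemma remSum_zero (n : ℕ) : remSum P F x n 0 = 0 := by
  unfold remSum stepSum
  refine Finset.sum_eq_zero fun i hi => ?_
  simp only [Finset.mem_filter] at hi
  simp [nonpos_iff_eq_zero.1 hi.2, vertRem, stopAtLeft_zero, jump_zero]

lemma eventually_exists_prev (P : PartitionSeq) {t : ℝ≥0} (ht : 0 < t) : ∀ᶠ n in atTop,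
    ∃ i < P.k n, P.t n i = P.prev n t ∧ 0 < P.t n i ∧ P.t n i < t ∧ t ≤ P.t n (i + 1) := by
  filter_upwards [P.eventually_lt_last t, P.eventually_lt_prev ht] with n h1 h2
  obtain ⟨i, hi, h3, h4, h5⟩ := P.exists_prev_index ht h1.le
  exact ⟨i, hi, h3, h3 ▸ h2, h4, h5⟩

/-- The jump of the step approximations at the last partition point before `t` converges to the
jump of the path at `t`. -/
lemma tendsto_jump_prev (hx : IsCadlag x) {t : ℝ≥0} (ht : 0 < t) :
    Tendsto (fun n => jump (approx P x n) (P.prev n t)) atTop (𝓝 (jump x t)) := by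
  have h1 : Tendsto (fun n => x (P.prev n t)) atTop (𝓝 (Function.leftLim x t)) :=
    (hx.tendsto_leftLim t).comp (tendsto_nhdsWithin_iff.2
      ⟨P.tendsto_prev t, .of_forall fun n => P.prev_lt n ht⟩)
  have h2 : Tendsto (fun n => jump (approx P x n) (P.prev n t) + x (P.prev n t)) atTop
      (𝓝 (x t)) := by
    rw [Metric.tendsto_nhds]
    intro ε hε
    filter_upwards [eventually_next (P := P) hx t hε, eventually_exists_prev P ht]
      with n hn ⟨i, hi, h3, h4, h5, h6⟩
    rcases jump_approx_cases (P := P) x hi with ⟨rfl, -⟩ | ⟨-, h7⟩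
    · simp [P.t_zero] at h4
    · rw [← h3, h7, incr, sub_add_cancel, dist_eq_norm]
      exact hn i hi h5.le h6
  simpa [jump] using h2.sub h1

/-- The jump of x^n at the last partition point before t imitates the jump of x at t: the values
after and before it, the left gradient and the jump size all converge to their counterparts at t. -/
lemma tendsto_rem_prev (hΩ : IsGeneric P Ω) (hF : IsC12 P F) (hx : x ∈ Ω) {t : ℝ≥0}
    (ht : 0 < t) :
    Tendsto (fun n => remSum P F x n (P.prev n t) - remSum P F x n (P.prev n (P.prev n t)))
      atTop (𝓝 (vertRem F x t)) := by
  have h1 := ((hF.continuous.rightCts hΩ).nearRight hx t).comp (P.nearRight_prev t)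
  have h2 := ((hF.continuous.leftCts hΩ).nearLeft hx t).comp (P.nearLeft_prev t)
  have h3 := fun a => (((hF.grad_leftCts a).minus_nearLeft hΩ hx t).comp (P.nearLeft_prev t)).mul
    (((EuclideanSpace.proj (𝕜 := ℝ) a).continuous.tendsto _).comp
      (tendsto_jump_prev (P := P) (hΩ.cadlag x hx) ht))
  have h4 := (h1.sub h2).sub (tendsto_finsetSum Finset.univ fun a _ => h3 a)
  refine Tendsto.congr' ?_ h4
  filter_upwards [eventually_exists_prev P ht] with n ⟨i, hi, h5, h6, _, _⟩
  rw [remSum, remSum, stepSum_prev_sub hi h6 h5, h5]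
  rfl

/-- Unpacks the filter into a left neighbourhood that does not depend on n. -/
lemma eventually_nearLeft {p : ℕ × ℝ≥0 → Prop} {t : ℝ≥0} (ht : 0 < t)
    (h : ∀ᶠ z in P.nearLeft t, p z) :
    ∃ l < t, ∀ᶠ n in atTop, ∀ u, l < u → u ≤ P.prev n t → p (n, u) := by
  rw [Filter.Eventually, PartitionSeq.nearLeft, alongConstraint, mem_inf_principal] at h
  obtain ⟨pa, hpa, pb, hpb, hp⟩ := eventually_prod_iff.1 h
  obtain ⟨l, hl, hl2⟩ := exists_Ioc_subset_of_mem_nhds hpb ⟨0, ht⟩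
  refine ⟨l, hl, hpa.mono fun n hn u hu1 hu2 => hp hn (hl2 ⟨hu1, hu2.trans (P.prev_le n t)⟩) hu2⟩

lemma stepSum_quadratic (h : Fin m → Fin m → ℝ) (n : ℕ) (u : ℝ≥0) :
    stepSum P (fun n i => vertRem F (approx P x n) (P.t n i) -
      1 / 2 * ∑ a, ∑ b, h a b * (incr P x n i b * incr P x n i a)) n u =
    remSum P F x n u - 1 / 2 * ∑ a, ∑ b, h a b * crossSum P x b a n u := by
  simp only [stepSum, remSum, crossSum, Finset.sum_sub_distrib, ← Finset.mul_sum]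
  congr 2
  rw [Finset.sum_comm]
  refine Finset.sum_congr rfl fun a _ => ?_
  rw [Finset.sum_comm]
  exact Finset.sum_congr rfl fun b _ => (Finset.mul_sum _ _ _).symm

/-- To the left of `t` the remainders are governed by the left limit of the second vertical
derivative. -/
lemma remSum_left_estimate (hΩ : IsGeneric P Ω) (hF : IsC12 P F) (hx : x ∈ Ω) {t : ℝ≥0}
    (ht : 0 < t) {ε : ℝ} (hε : 0 < ε) : ∃ l₀ < t, ∀ l, l₀ ≤ l → l < t → ∀ᶠ n in atTop,
      |remSum P F x n (P.prev n (P.prev n t)) - remSum P F x n l -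
        1 / 2 * ∑ a, ∑ b, val (vertHess F a b) t (stopAtLeft x t) *
          (crossSum P x b a n (P.prev n (P.prev n t)) - crossSum P x b a n l)| ≤
      ε * (sqSum P x n (P.prev n (P.prev n t)) - sqSum P x n l) := by
  obtain ⟨ω, hω, K, -, hrem⟩ := hF.rem_bounds hΩ hx t
  -- One δ for the Taylor error and at most one for each of the m² Hessian entries.
  set δ := ε / (1 + m * m) with hδ
  have hδ0 : 0 < δ := by positivity
  have hH : ∀ᶠ z in P.nearLeft t, ∀ a b,
      |val (vertHess F a b) z.2 (stopAtLeft (approx P x z.1) z.2) -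
        val (vertHess F a b) t (stopAtLeft x t)| < δ :=
    eventually_all.2 fun a => eventually_all.2 fun b =>
      (Metric.tendsto_nhds.1 ((hF.hess_leftCts a b).minus_nearLeft hΩ hx t)) δ hδ0
  obtain ⟨l₁, hl₁, hH1⟩ := eventually_nearLeft ht hH
  obtain ⟨η, hη, hωη⟩ := hω.small δ hδ0
  obtain ⟨l₂, hl₂, hsmall⟩ := (hΩ.cadlag x hx).small_left ht hη
  refine ⟨max l₁ l₂, max_lt hl₁ hl₂, fun l hl hlt => ?_⟩
  filter_upwards [hrem, hH1, P.eventually_lt_prev hlt, P.tendsto_prev_prev t |>.eventually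
    (eventually_gt_nhds hlt), eventually_exists_prev P ht] with n h1 h2 h3 h4 
    ⟨j, hj, hj1, hj0, hj2, _⟩
  have hpp : P.prev n (P.prev n t) < P.prev n t := P.prev_lt n (by rw [← hj1]; exact hj0)
  have hmain := abs_stepSum_sub_le (P := P) (d := fun n i => vertRem F (approx P x n) (P.t n i) -
      1 / 2 * ∑ a, ∑ b, val (vertHess F a b) t (stopAtLeft x t) *
        (incr P x n i b * incr P x n i a)) (e := fun n i => ‖incr P x n i‖ ^ 2) (n := n) (K := ε)
    h4.le ?_
  · rw [stepSum_quadratic, stepSum_quadratic] at hmain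
    refine le_trans (le_of_eq ?_) hmain
    congr 1
    simp only [mul_sub, Finset.sum_sub_distrib]
    ring
  · intro i hi hil hip
    have hil1 : l₁ < P.t n i := ((le_max_left _ _).trans hl).trans_lt hil
    have hil2 : l₂ < P.t n i := ((le_max_right _ _).trans hl).trans_lt hil
    have hit : P.t n i ≤ t := hip.trans (hpp.le.trans (P.prev_le n t))
    have hi0 : 0 < i := by
      rcases Nat.eq_zero_or_pos i with rfl | h
      · rw [P.t_zero] at hil
        exact absurd hil not_lt_zero
      · exact h
    -- Stopping at `prev n (prev n t)` leaves out the straddling interval, which has index j. All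
    -- intervals counted end before t, where the increments are small.
    have hij : i < j := (P.t_lt_iff hi.le hj.le).1 (hip.trans_lt (hj1 ▸ hpp))
    have hsucc : P.t n (i + 1) < t :=
      ((P.t_le_iff (by omega) hj.le).2 (by omega)).trans_lt hj2
    have hlt' := P.t_lt_succ hi
    have hinc : ‖incr P x n i‖ ≤ η :=
      (hsmall _ ⟨hil2.trans hlt', hsucc⟩ _ ⟨hil2, hlt'.trans hsucc⟩).le
    obtain ⟨h5, -⟩ := h1 i hi hit
    have hJ : jump (approx P x n) (P.t n i) = incr P x n i := by
      rcases jump_approx_cases (P := P) x hi with ⟨h, -⟩ | ⟨-, h⟩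
      · omega
      · exact h
    rw [hJ] at h5
    have h6 := h2 (P.t n i) hil1 (hip.trans hpp.le)
    have h7 : |1 / 2 * ∑ a, ∑ b,
        val (vertHess F a b) (P.t n i) (stopAtLeft (approx P x n) (P.t n i)) *
          (incr P x n i b * incr P x n i a) - 1 / 2 * ∑ a, ∑ b,
        val (vertHess F a b) t (stopAtLeft x t) * (incr P x n i b * incr P x n i a)| ≤
        (m * m) * (δ * ‖incr P x n i‖ ^ 2) := by
      rw [← mul_sub, ← Finset.sum_sub_distrib, abs_mul]
      have h8 : |∑ a, (∑ b,
          val (vertHess F a b) (P.t n i) (stopAtLeft (approx P x n) (P.t n i)) *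
          (incr P x n i b * incr P x n i a) - ∑ b,
          val (vertHess F a b) t (stopAtLeft x t) * (incr P x n i b * incr P x n i a))| ≤
          ∑ _a : Fin m, ∑ _b : Fin m, δ * ‖incr P x n i‖ ^ 2 := by
        refine (Finset.abs_sum_le_sum_abs _ _).trans (Finset.sum_le_sum fun a _ => ?_)
        rw [← Finset.sum_sub_distrib]
        refine (Finset.abs_sum_le_sum_abs _ _).trans (Finset.sum_le_sum fun b _ => ?_)
        rw [← sub_mul, abs_mul]
        exact mul_le_mul (h6 a b).le (abs_mul_coord_le _ _ _) (abs_nonneg _) hδ0.le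
      simp only [Finset.sum_const, Finset.card_univ, Fintype.card_fin, nsmul_eq_mul] at h8
      rw [← mul_assoc] at h8
      refine le_trans ?_ h8
      rw [abs_of_pos (by norm_num : (0 : ℝ) < 1 / 2)]
      linarith [abs_nonneg (∑ a, (∑ b,
          val (vertHess F a b) (P.t n i) (stopAtLeft (approx P x n) (P.t n i)) *
          (incr P x n i b * incr P x n i a) - ∑ b,
          val (vertHess F a b) t (stopAtLeft x t) * (incr P x n i b * incr P x n i a)))]
    have h9 : ω ‖incr P x n i‖ * ‖incr P x n i‖ ^ 2 ≤ δ * ‖incr P x n i‖ ^ 2 :=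
      mul_le_mul_of_nonneg_right (hωη _ hinc) (by positivity)
    have h10 : ε * ‖incr P x n i‖ ^ 2 =
        δ * ‖incr P x n i‖ ^ 2 + (m * m) * (δ * ‖incr P x n i‖ ^ 2) := by
      have : ε = δ * (1 + m * m) := by rw [hδ]; field_simp
      rw [this]; ring
    rw [h10]
    exact (abs_sub_le _ _ _).trans (add_le_add (h5.trans h9) h7)

/-! ### Limits of the remainders and their uniqueness -/

section Limits

variable {l : Filter ℕ} {A : ℝ≥0 → ℝ}

lemma limit_sub_le (hΩ : IsGeneric P Ω) (hF : IsC12 P F) (hx : x ∈ Ω) (hq : IsQuadVar P x q)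
    [l.NeBot] (hl : l ≤ atTop) (hA : ∀ t, Tendsto (fun n => remSum P F x n t) l (𝓝 (A t)))
    (T : ℝ≥0) : ∃ K, ∀ s ≤ T, ∀ t ≤ T, |A t - A s| ≤ K * |∑ a, q t a a - ∑ a, q s a a| := by
  obtain ⟨K, hK, h⟩ := remSum_sub_le hΩ hF hx T
  refine ⟨K, fun s hs t ht => ?_⟩
  have hv := fun t => (((hq.tendsto_sqSum (hΩ.cadlag x hx) t).comp (P.nearRight_const t)).mono_left hl)
  exact le_of_tendsto_of_tendsto ((hA t).sub (hA s)).abs (((hv t).sub (hv s)).abs.const_mul K)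
    ((h.filter_mono hl).mono fun n hn => hn s hs t ht)

lemma limit_rightCts (hΩ : IsGeneric P Ω) (hF : IsC12 P F) (hx : x ∈ Ω) (hq : IsQuadVar P x q)
    [l.NeBot] (hl : l ≤ atTop) (hA : ∀ t, Tendsto (fun n => remSum P F x n t) l (𝓝 (A t)))
    (t : ℝ≥0) : ContinuousWithinAt A (Ici t) t := by
  obtain ⟨K, hK⟩ := limit_sub_le hΩ hF hx hq hl hA (t + 1)
  have h1 := ((((hq.trace_rightCts (hΩ.cadlag x hx) t).tendsto).sub_const
    (∑ a, q t a a)).abs).const_mul K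
  simp only [sub_self, abs_zero, mul_zero] at h1
  refine tendsto_sub_nhds_zero_iff.1 (squeeze_zero_norm' ?_ h1)
  filter_upwards [mem_nhdsWithin_of_mem_nhds (Iic_mem_nhds (show t < t + 1 by simp))] with s hs
  exact hK t le_self_add s hs

/-- The straddling interval contributes in the limit exactly the remainder of the jump at t; the
earlier ones are governed by the Hessian frozen at (t, x_{t-}). This determines the left increments
of a limit up to a small multiple of those of the trace. -/
lemma limit_left_estimate (hΩ : IsGeneric P Ω) (hF : IsC12 P F) (hx : x ∈ Ω)
    (hq : IsQuadVar P x q) [l.NeBot] (hl : l ≤ atTop)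
    (hA : ∀ t, Tendsto (fun n => remSum P F x n t) l (𝓝 (A t))) {t : ℝ≥0} (ht : 0 < t) {ε : ℝ}
    (hε : 0 < ε) : ∃ s₀ < t, ∀ s, s₀ ≤ s → s < t → |A t - vertRem F x t - A s -
        1 / 2 * ∑ a, ∑ b, val (vertHess F a b) t (stopAtLeft x t) *
          (Function.leftLim (fun u => q u b a) t - q s b a)| ≤
      ε * (∑ a, q t a a - ∑ a, q s a a) := by
  have hc := hΩ.cadlag x hx
  obtain ⟨s₀, hs₀, h⟩ := remSum_left_estimate hΩ hF hx ht hε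
  refine ⟨s₀, hs₀, fun s hs hst => ?_⟩
  obtain ⟨K, hK, hrem⟩ := remSum_sub_le hΩ hF hx t
  have hv := fun t => ((hq.tendsto_sqSum hc t).comp (P.nearRight_const t)).mono_left hl
  have hv' := ((hq.tendsto_sqSum hc t).comp (P.nearRight_prev t)).mono_left hl
  have hQ := fun a b => (((hq.tendsto hc a b).2 s).1.comp (P.nearRight_const s)).mono_left hl
  have hQ' := fun a b =>
    (((hq.tendsto hc a b).2 t).2.comp (P.nearLeftStrict_prev_prev ht)).mono_left hl
  -- The discrete quadratic variations at t and at `prev n t` share a limit, both times being on the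
  -- right side, so passing between them costs nothing.
  have hlast : Tendsto (fun n => remSum P F x n t - remSum P F x n (P.prev n t)) l (𝓝 0) := by
    have h1 := ((hv t).sub hv').abs.const_mul K
    simp only [sub_self, abs_zero, mul_zero] at h1
    refine squeeze_zero_norm' ?_ h1
    filter_upwards [hrem.filter_mono hl] with n hn
    exact hn _ (P.prev_le n t) t le_rfl
  have hpp : Tendsto (fun n => remSum P F x n (P.prev n (P.prev n t))) l
      (𝓝 (A t - 0 - vertRem F x t)) := by
    refine (((hA t).sub hlast).sub ((tendsto_rem_prev hΩ hF hx ht).mono_left hl)).congr fun n => ?_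
    ring
  rw [sub_zero] at hpp
  have hsum := tendsto_finsetSum Finset.univ fun (a : Fin m) _ =>
    tendsto_finsetSum Finset.univ fun (b : Fin m) _ =>
      ((hQ' b a).sub (hQ b a)).const_mul (val (vertHess F a b) t (stopAtLeft x t))
  refine le_of_tendsto_of_tendsto ((hpp.sub (hA s)).sub (hsum.const_mul (1 / 2))).abs
    (((hv t).sub (hv s)).const_mul ε) ?_
  filter_upwards [(h s hs hst).filter_mono hl] with n hn
  refine hn.trans (mul_le_mul_of_nonneg_left ?_ hε.le)
  exact sub_le_sub_right (sqSum_mono n ((P.prev_le _ _).trans (P.prev_le _ _))) _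

/-- Boundedness and compactness. An ultrafilter yields limits for all t at once, so no subsequence
has to be chosen. -/
lemma exists_ultrafilter_limit (hΩ : IsGeneric P Ω) (hF : IsC12 P F) (hx : x ∈ Ω)
    (hq : IsQuadVar P x q) (U : Ultrafilter ℕ) (hU : (U : Filter ℕ) ≤ atTop) :
    ∃ A : ℝ≥0 → ℝ, ∀ t, Tendsto (fun n => remSum P F x n t) U (𝓝 (A t)) := by
  have : ∀ t, ∃ a, Tendsto (fun n => remSum P F x n t) U (𝓝 a) := by
    intro t
    obtain ⟨K, hK, h⟩ := remSum_sub_le hΩ hF hx t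
    have hv := fun t => (hq.tendsto_sqSum (hΩ.cadlag x hx) t).comp (P.nearRight_const t)
    have hlim := ((hv t).sub (hv 0)).abs.const_mul K
    set C := K * |∑ a, q t a a - ∑ a, q 0 a a| + 1 with hC
    have hev : ∀ᶠ n in atTop, remSum P F x n t ∈ Icc (-C) C := by
      filter_upwards [h, hlim.eventually (eventually_lt_nhds (lt_add_one _))] with n h1 h2
      have h3 := h1 0 zero_le t le_rfl
      rw [remSum_zero, sub_zero] at h3
      exact abs_le.1 (h3.trans h2.le)
    obtain ⟨a, -, ha⟩ := isCompact_Icc.ultrafilter_le_nhds (U.map fun n => remSum P F x n t)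
      (le_principal_iff.2 (hU hev))
    exact ⟨a, ha⟩
  choose A hA using this
  exact ⟨A, hA⟩

/-- The jump and Hessian terms in the left estimates are the same for both limits and cancel. The
left increments of the difference are therefore negligible against the trace of [x]. -/
lemma ultrafilter_limit_le (hΩ : IsGeneric P Ω) (hF : IsC12 P F) (hx : x ∈ Ω)
    (hq : IsQuadVar P x q) {l l' : Filter ℕ} [l.NeBot] [l'.NeBot] (hl : l ≤ atTop)
    (hl' : l' ≤ atTop) {A A' : ℝ≥0 → ℝ}
    (hA : ∀ t, Tendsto (fun n => remSum P F x n t) l (𝓝 (A t)))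
    (hA' : ∀ t, Tendsto (fun n => remSum P F x n t) l' (𝓝 (A' t))) (T : ℝ≥0) : A T ≤ A' T := by
  have hz : A 0 = 0 := tendsto_nhds_unique (hA 0) (by simp [remSum_zero])
  have hz' : A' 0 = 0 := tendsto_nhds_unique (hA' 0) (by simp [remSum_zero])
  have := le_of_left_increments (E := fun t => A t - A' t) (w := fun t => ∑ a, q t a a)
    (fun t => (limit_rightCts hΩ hF hx hq hl hA t).sub (limit_rightCts hΩ hF hx hq hl' hA' t))
    (hq.trace_rightCts (hΩ.cadlag x hx)) (fun t ht ε hε => ?_) T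
  · simp only [hz, hz', sub_self] at this
    linarith
  · obtain ⟨s₀, h0, h1⟩ := limit_left_estimate hΩ hF hx hq hl hA ht (half_pos hε)
    obtain ⟨s₁, h2, h3⟩ := limit_left_estimate hΩ hF hx hq hl' hA' ht (half_pos hε)
    refine ⟨max s₀ s₁, max_lt h0 h2, ?_⟩
    have h4 := abs_le.1 (h1 _ (le_max_left s₀ s₁) (max_lt h0 h2))
    have h5 := abs_le.1 (h3 _ (le_max_right s₀ s₁) (max_lt h0 h2))
    linarith [h4.2, h5.1]

/-- The accumulated remainders converge. -/
lemma exists_remSum_limit (hΩ : IsGeneric P Ω) (hF : IsC12 P F) (hx : x ∈ Ω)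
    (hq : IsQuadVar P x q) :
    ∃ A : ℝ≥0 → ℝ, ∀ t, Tendsto (fun n => remSum P F x n t) atTop (𝓝 (A t)) := by
  obtain ⟨A, hA⟩ := exists_ultrafilter_limit hΩ hF hx hq (hyperfilter ℕ)
    Nat.hyperfilter_le_atTop
  refine ⟨A, fun t => (tendsto_iff_ultrafilter _ _ _).2 fun U hU => ?_⟩
  obtain ⟨A', hA'⟩ := exists_ultrafilter_limit hΩ hF hx hq U hU
  have e : A' t = A t := le_antisymm
    (ultrafilter_limit_le hΩ hF hx hq hU Nat.hyperfilter_le_atTop hA' hA t)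
    (ultrafilter_limit_le hΩ hF hx hq Nat.hyperfilter_le_atTop hU hA hA' t)
  rw [← e]
  exact hA' t

lemma tendsto_remSum_nearRight (hΩ : IsGeneric P Ω) (hF : IsC12 P F) (hx : x ∈ Ω)
    (hq : IsQuadVar P x q) (hA : ∀ t, Tendsto (fun n => remSum P F x n t) atTop (𝓝 (A t)))
    (t : ℝ≥0) :
    Tendsto (fun p : ℕ × ℝ≥0 => remSum P F x p.1 p.2) (P.nearRight t) (𝓝 (A t)) := by
  obtain ⟨K, hK, h⟩ := remSum_sub_le hΩ hF hx (t + 1)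
  have hv := hq.tendsto_sqSum (hΩ.cadlag x hx) t
  have hdiff : Tendsto (fun p : ℕ × ℝ≥0 => remSum P F x p.1 p.2 - remSum P F x p.1 t)
      (P.nearRight t) (𝓝 0) := by
    have h1 := (hv.sub (hv.comp (P.nearRight_const' t))).abs.const_mul K
    simp only [sub_self, abs_zero, mul_zero] at h1
    refine squeeze_zero_norm' ?_ h1
    filter_upwards [P.nearRight_le t
      (h.prod_mk (eventually_le_nhds (show t < t + 1 by simp)))] with p hp
    exact hp.1 t le_self_add _ hp.2
  have h2 : Tendsto (fun p : ℕ × ℝ≥0 => remSum P F x p.1 t) (P.nearRight t) (𝓝 (A t)) :=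
    (hA t).comp (tendsto_fst.mono_left (P.nearRight_le t))
  simpa using hdiff.add h2

/-- Strictly left of the last partition point the jump remainder has not yet been collected. -/
lemma tendsto_remSum_nearLeftStrict (hΩ : IsGeneric P Ω) (hF : IsC12 P F) (hx : x ∈ Ω)
    (hq : IsQuadVar P x q) (hA : ∀ t, Tendsto (fun n => remSum P F x n t) atTop (𝓝 (A t)))
    (t : ℝ≥0) :
    Tendsto (fun p : ℕ × ℝ≥0 => remSum P F x p.1 p.2) (P.nearLeftStrict t)
      (𝓝 (A t - vertRem F x t)) := by
  rcases eq_zero_or_pos t with rfl | ht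
  · simp [P.nearLeftStrict_zero]
  obtain ⟨K, hK, h⟩ := remSum_sub_le hΩ hF hx (t + 1)
  have hv := hq.tendsto_sqSum_left (hΩ.cadlag x hx) t
  have hdiff : Tendsto (fun p : ℕ × ℝ≥0 => remSum P F x p.1 p.2 -
      remSum P F x p.1 (P.prev p.1 (P.prev p.1 t))) (P.nearLeftStrict t) (𝓝 0) := by
    have h1 := (hv.sub (hv.comp (P.nearLeftStrict_prev_prev' t))).abs.const_mul K
    simp only [sub_self, abs_zero, mul_zero] at h1
    refine squeeze_zero_norm' ?_ h1
    filter_upwards [P.nearLeftStrict_le t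
      (h.prod_mk (eventually_le_nhds (show t < t + 1 by simp)))] with p hp
    exact hp.1 _ (((P.prev_le _ _).trans (P.prev_le _ _)).trans le_self_add) _ hp.2
  have h2 : Tendsto (fun n => remSum P F x n (P.prev n (P.prev n t))) atTop
      (𝓝 (A t - vertRem F x t)) := by
    refine (((tendsto_remSum_nearRight hΩ hF hx hq hA t).comp (P.nearRight_prev t)).sub
      (tendsto_rem_prev hΩ hF hx ht)).congr fun n => ?_
    simp
  have h3 := h2.comp (tendsto_fst.mono_left (P.nearLeftStrict_le t))
  simpa using hdiff.add h3

end Limits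

end Remainder

/-! ### Existence and one-sided limits of the pathwise integral -/

section PathIntegral

variable {m : ℕ} {Ω : Set (CPath m)} {P : PartitionSeq} {F : domain Ω → ℝ} {x : CPath m}

/-- The pathwise integral of the vertical derivative. -/
def pathInt (P : PartitionSeq) (F : domain Ω → ℝ) (x : CPath m) (t : ℝ≥0) : ℝ :=
  limUnder atTop (riemannSum P (vertGrad F) x t)

lemma tendsto_riemannSum_aux (hΩ : IsGeneric P Ω) (hF : IsC12 P F) (hx : x ∈ Ω) {t : ℝ≥0}
    {l : Filter (ℕ × ℝ≥0)} (hl : l ≤ atTop ×ˢ 𝓝 t) {α β : ℝ}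
    (hα : Tendsto (fun p : ℕ × ℝ≥0 => val F p.2 (stopAt (approx P x p.1) p.2)) l (𝓝 α))
    (hβ : Tendsto (fun p : ℕ × ℝ≥0 => remSum P F x p.1 p.2) l (𝓝 β)) :
    Tendsto (fun p : ℕ × ℝ≥0 => riemannSum P (vertGrad F) x p.2 p.1) l
      (𝓝 (α - val F 0 (stopAt x 0) - horizInt F x t - β)) := by
  have hfst : Tendsto (fun p : ℕ × ℝ≥0 => p.1) l atTop := tendsto_fst.mono_left hl
  have h1 := (tendsto_initTerm hΩ hF.grad_leftCts hx).comp hfst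
  have h2 := ((hF.continuous.rightCts hΩ).c x hx 0 (fun _ => 0) tendsto_const_nhds
    (.of_forall fun n => P.prev_le n 0)).comp hfst
  have h3 := (hF.tendsto_horizInt hΩ hx t).mono_left hl
  have h4 := ((h1.add (hα.sub h2)).sub h3).sub hβ
  rw [zero_add] at h4
  refine h4.congr' ?_
  filter_upwards [hl ((hF.riemannSum_eq hΩ hx (t + 1)).prod_mk
    (eventually_le_nhds (show t < t + 1 by simp)))] with p hp
  exact (hp.1 _ hp.2).symm

/-- On the left side F tends to F(t, x_{t-}) and the remainders to A(t) - `vertRem F x t`; by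
definition of `vertRem` the combined defect is exactly the linear term ∇F(t, x_{t-})·Δx(t). -/
lemma exists_pathInt (hΩ : IsGeneric P Ω) (hF : IsC12 P F) (hx : x ∈ Ω) {A : ℝ≥0 → ℝ}
    {q : ℝ≥0 → Matrix (Fin m) (Fin m) ℝ} (hq : IsQuadVar P x q)
    (hA : ∀ t, Tendsto (fun n => remSum P F x n t) atTop (𝓝 (A t))) (t : ℝ≥0) :
    pathInt P F x t = val F t (stopAt x t) - val F 0 (stopAt x 0) - horizInt F x t - A t ∧
    Tendsto (fun p : ℕ × ℝ≥0 => riemannSum P (vertGrad F) x p.2 p.1) (P.nearRight t)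
      (𝓝 (pathInt P F x t)) ∧
    Tendsto (fun p : ℕ × ℝ≥0 => riemannSum P (vertGrad F) x p.2 p.1) (P.nearLeftStrict t)
      (𝓝 (pathInt P F x t - ∑ a, val (vertGradComp F a) t (stopAtLeft x t) * jump x t a)) := by
  have h1 := tendsto_riemannSum_aux hΩ hF hx (P.nearRight_le t)
    ((hF.continuous.rightCts hΩ).nearRight hx t) (tendsto_remSum_nearRight hΩ hF hx hq hA t)
  have h2 := tendsto_riemannSum_aux hΩ hF hx (P.nearLeftStrict_le t)
    ((hF.continuous.leftCts hΩ).nearLeftStrict hx t)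
    (tendsto_remSum_nearLeftStrict hΩ hF hx hq hA t)
  have e : pathInt P F x t =
      val F t (stopAt x t) - val F 0 (stopAt x 0) - horizInt F x t - A t :=
    (h1.comp (P.nearRight_const t)).limUnder_eq
  refine ⟨e, e ▸ h1, ?_⟩
  convert h2 using 2
  rw [e, vertRem]
  ring

lemma tendsto_pathInt (hΩ : IsGeneric P Ω) (hQ : Ω ⊆ finiteQV P m) (hF : IsC12 P F) (hx : x ∈ Ω)
    (t : ℝ≥0) :
    Tendsto (fun p : ℕ × ℝ≥0 => riemannSum P (vertGrad F) x p.2 p.1) (P.nearRight t)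
      (𝓝 (pathInt P F x t)) ∧
    Tendsto (fun p : ℕ × ℝ≥0 => riemannSum P (vertGrad F) x p.2 p.1) (P.nearLeftStrict t)
      (𝓝 (pathInt P F x t - ∑ a, val (vertGradComp F a) t (stopAtLeft x t) * jump x t a)) := by
  obtain ⟨-, q, hq⟩ := hQ hx
  obtain ⟨A, hA⟩ := exists_remSum_limit hΩ hF hx hq
  exact (exists_pathInt hΩ hF hx hq hA t).2

lemma hasPathIntegral_pathInt (hΩ : IsGeneric P Ω) (hQ : Ω ⊆ finiteQV P m) (hF : IsC12 P F)
    (hx : x ∈ Ω) (t : ℝ≥0) : HasPathIntegral P (vertGrad F) x t (pathInt P F x t) := by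
  intro s hs
  exact P.nearRight_const t ((tendsto_pathInt hΩ hQ hF hx t).1 hs)

end PathIntegral

/-! ### Harmonic functionals along paths with the prescribed quadratic variation -/

section Density

lemma intervalIntegrable_sum_sum {m : ℕ} {g : Fin m → Fin m → ℝ → ℝ} {a b : ℝ}
    (hg : ∀ i j, IntervalIntegrable (g i j) volume a b) :
    IntervalIntegrable (fun s => ∑ i, ∑ j, g i j s) volume a b := by
  have e : (fun s => ∑ i, ∑ j, g i j s) = ∑ i, ∑ j, g i j := by
    funext s
    simp [Finset.sum_apply]
  rw [e]
  exact IntervalIntegrable.sum _ fun i _ => IntervalIntegrable.sum _ fun j _ => hg i j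

lemma integral_sum_sum {m : ℕ} {g : Fin m → Fin m → ℝ → ℝ} {a b : ℝ}
    (hg : ∀ i j, IntervalIntegrable (g i j) volume a b) :
    ∫ s in a..b, ∑ i, ∑ j, g i j s = ∑ i, ∑ j, ∫ s in a..b, g i j s := by
  rw [intervalIntegral.integral_finsetSum]
  · exact Finset.sum_congr rfl fun i _ => intervalIntegral.integral_finsetSum fun j _ => hg i j
  · intro i _
    have e : (fun s => ∑ j, g i j s) = ∑ j, g i j := by
      funext s
      simp [Finset.sum_apply]
    rw [e]
    exact IntervalIntegrable.sum _ fun j _ => hg i j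

variable {m : ℕ} {Ω : Set (CPath m)} {P : PartitionSeq} {F : domain Ω → ℝ} {x : CPath m}

lemma continuous_primitive_nnreal {g : ℝ → ℝ}
    (hg : ∀ t : ℝ≥0, IntervalIntegrable g volume 0 t) :
    Continuous fun t : ℝ≥0 => ∫ s in (0 : ℝ)..t, g s := by
  refine continuous_iff_continuousAt.2 fun t => ?_
  have h1 : IntegrableOn g (uIcc (0 : ℝ) ((t + 1 : ℝ≥0) : ℝ)) := by
    rw [uIcc_of_le (NNReal.coe_nonneg _)]
    exact (intervalIntegrable_iff_integrableOn_Icc_of_le (NNReal.coe_nonneg _)).1 (hg (t + 1))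
  have h2 := intervalIntegral.continuousOn_primitive_interval h1
  have h3 : ContinuousOn (fun t : ℝ≥0 => ∫ s in (0 : ℝ)..t, g s) (Iic (t + 1)) := by
    refine h2.comp NNReal.continuous_coe.continuousOn fun s hs => ?_
    rw [uIcc_of_le (NNReal.coe_nonneg _)]
    exact ⟨NNReal.coe_nonneg _, NNReal.coe_le_coe.2 hs⟩
  exact h3.continuousAt (Iic_mem_nhds (by simp))

/-- A path with continuous quadratic variation is continuous. -/
lemma jump_eq_zero (hx : IsCadlag x) {q : ℝ≥0 → Matrix (Fin m) (Fin m) ℝ} (hq : IsQuadVar P x q)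
    (hc : ∀ a, Continuous fun t => q t a a) (t : ℝ≥0) : jump x t = 0 := by
  rcases eq_zero_or_pos t with rfl | ht
  · exact jump_zero x
  ext a
  obtain ⟨-, h⟩ := hq.tendsto hx a a
  have h1 := ((h t).1.comp (P.nearRight_prev t)).sub ((h t).2.comp (P.nearLeftStrict_prev_prev ht))
  rw [(hc a).continuousAt.continuousWithinAt.leftLim_eq, sub_self] at h1
  have h2 := ((EuclideanSpace.proj (𝕜 := ℝ) a).continuous.tendsto _).comp
      (tendsto_jump_prev (P := P) hx ht)
  have h3 := h2.mul h2
  have h4 : Tendsto (fun n => ((EuclideanSpace.proj (𝕜 := ℝ) a) ∘ fun n =>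
      jump (approx P x n) (P.prev n t)) n * ((EuclideanSpace.proj (𝕜 := ℝ) a) ∘ fun n =>
      jump (approx P x n) (P.prev n t)) n) atTop (𝓝 0) := by
    -- The jump of the discrete quadratic variation at `prev n t` is the squared straddling
    -- increment, whose limit is the squared jump of x.
    refine h1.congr' ?_
    filter_upwards [eventually_exists_prev P ht] with n ⟨i, hi, h5, h6, _, _⟩
    have h7 := stepSum_prev_sub (d := fun n i => incr P x n i a * incr P x n i a) hi h6 h5
    simp only [Function.comp]
    rw [h7]
    rcases jump_approx_cases (P := P) x hi with ⟨rfl, -⟩ | ⟨-, h8⟩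
    · simp [P.t_zero] at h6
    · rw [← h5, h8]; rfl
  have h5 := tendsto_nhds_unique h3 h4
  simpa using h5

/-- Along the paths whose quadratic variation has density `S`, a harmonic functional is the
integral of its vertical derivative. -/
lemma pathInt_eq_of_density (hΩ : IsGeneric P Ω) {S : domain Ω → Matrix (Fin m) (Fin m) ℝ}
    (hS : ∀ z, (S z).PosDef) (hF : IsHarmonic P S F) (hx : x ∈ Ω)
    (hxS : x ∈ pathsWithDensity P Ω S) (t : ℝ≥0) :
    pathInt P F x t = F (pt hx t) - F (pt hx 0) := by
  obtain ⟨hF, hharm⟩ := hF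
  have hharm := hharm x hx hxS
  obtain ⟨_, hint, hq⟩ := hxS
  set q : ℝ≥0 → Matrix (Fin m) (Fin m) ℝ :=
    fun t => Matrix.of fun i j => ∫ s in (0 : ℝ)..t, S (pt hx s.toNNReal) i j with hqdef
  have hxc := hΩ.cadlag x hx
  have hqc : ∀ a b, Continuous fun t => q t a b := fun a b =>
    continuous_primitive_nnreal fun t => hint t a b
  have hjump := jump_eq_zero hxc hq fun a => hqc a a
  have hleft : ∀ t, stopAtLeft x t = stopAt x t := fun t => by
    rw [stopAtLeft_eq, hjump]; simp [bump_zero]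
  have hrem : ∀ t, vertRem F x t = 0 := fun t => by simp [vertRem, hleft, hjump]
  obtain ⟨A, hA⟩ := exists_remSum_limit hΩ hF hx hq
  have hA0 : A 0 = 0 := tendsto_nhds_unique (hA 0) (by simp [remSum_zero])
  have hI0 : horizInt F x 0 = 0 := by simp [horizInt]
  have hDint : ∀ t : ℝ≥0, IntervalIntegrable (fun s : ℝ =>
      val (horizDeriv F) s.toNNReal (stopAt x s.toNNReal)) volume 0 t := fun t =>
    NNReal.coe_zero ▸ hF.horiz_integrable hΩ hx (zero_le (a := t))
  have hIc : Continuous (horizInt F x) := continuous_primitive_nnreal hDint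
  -- The two errors to be dominated: the remainder estimate is measured by tr[x], freezing the
  -- Hessian by the integral of the absolute entries of Σ.
  set w : ℝ≥0 → ℝ := fun t => ∑ a, q t a a +
    ∑ a, ∑ b, ∫ s in (0 : ℝ)..t, |S (pt hx s.toNNReal) a b| with hw
  have hwc : Continuous w := (continuous_finsetSum _ fun a _ => hqc a a).add
    (continuous_finsetSum _ fun a _ => continuous_finsetSum _ fun b _ =>
      continuous_primitive_nnreal fun t => (hint t a b).abs)
  have hAc := limit_rightCts hΩ hF hx hq le_rfl hA
  have key : ∀ t > 0, ∀ ε > 0, ∃ l < t,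
      |(A t + horizInt F x t) - (A l + horizInt F x l)| ≤ ε * (w t - w l) := by
    intro t ht ε hε
    obtain ⟨s₀, hs₀, h0⟩ := limit_left_estimate hΩ hF hx hq le_rfl hA ht hε
    have hH : ∀ᶠ s in 𝓝[≤] t, ∀ a b, |val (vertHess F a b) s (stopAt x s) -
        val (vertHess F a b) t (stopAt x t)| < ε := by
      refine eventually_all.2 fun a => eventually_all.2 fun b => ?_
      have := Metric.tendsto_nhds.1 ((hF.hess_leftCts a b).a x hx t) ε hε
      filter_upwards [this] with s hs
      rw [val_minus_stopAtLeft hΩ _ hx, val_minus_stopAtLeft hΩ _ hx, hleft, hleft] at hs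
      exact hs
    obtain ⟨s₁, hs₁, h1⟩ := (mem_nhdsLE_iff_exists_Ioc_subset' ht).1 hH
    obtain ⟨l, hl, hlt⟩ := exists_between (max_lt hs₀ (mem_Iio.1 hs₁))
    have hls₀ : s₀ ≤ l := (le_max_left _ _).trans hl.le
    have hls₁ : s₁ < l := (le_max_right _ _).trans_lt hl
    have hltR : (l : ℝ) ≤ t := NNReal.coe_le_coe.2 hlt.le
    refine ⟨l, hlt, ?_⟩
    have h2 := h0 l hls₀ hlt
    have hleftq : ∀ a b, Function.leftLim (fun u => q u b a) t = q t b a := fun a b =>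
      (hqc b a).continuousAt.continuousWithinAt.leftLim_eq
    simp only [hrem, hleftq, sub_zero, hleft] at h2
    have hSint : ∀ a b, IntervalIntegrable (fun s : ℝ => S (pt hx s.toNNReal) a b) volume l t :=
      fun a b => (hint l a b).symm.trans (hint t a b)
    have hq' : ∀ a b, q t b a - q l b a = ∫ s in (l : ℝ)..t, S (pt hx s.toNNReal) a b := by
      intro a b
      -- The remainder estimate pairs the Hessian entry (a, b) with [x] entry (b, a); symmetry of Σ
      -- reconciles this with the harmonic equation.
      have hsymm : ∀ z, S z b a = S z a b := fun z => by
        simpa using (hS z).isHermitian.apply a b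
      simp only [hqdef, Matrix.of_apply, hsymm]
      exact intervalIntegral.integral_interval_sub_left (hint t a b) (hint l a b)
    have hI : horizInt F x t - horizInt F x l =
        ∫ s in (l : ℝ)..t, val (horizDeriv F) s.toNNReal (stopAt x s.toNNReal) :=
      intervalIntegral.integral_interval_sub_left (hDint t) (hDint l)
    have hDl := (hDint l).symm.trans (hDint t)
    simp only [hq'] at h2
    have h3 : 1 / 2 * ∑ a, ∑ b, val (vertHess F a b) t (stopAt x t) *
          (∫ s in (l : ℝ)..t, S (pt hx s.toNNReal) a b) + (horizInt F x t - horizInt F x l) =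
        ∫ s in (l : ℝ)..t, (1 / 2 * ∑ a, ∑ b, val (vertHess F a b) t (stopAt x t) *
          S (pt hx s.toNNReal) a b + val (horizDeriv F) s.toNNReal (stopAt x s.toNNReal)) := by
      have hg : ∀ a b, IntervalIntegrable (fun s : ℝ => val (vertHess F a b) t (stopAt x t) *
          S (pt hx s.toNNReal) a b) volume l t := fun a b => (hSint a b).const_mul _
      rw [hI, intervalIntegral.integral_add ((intervalIntegrable_sum_sum hg).const_mul _) hDl,
        intervalIntegral.integral_const_mul, integral_sum_sum hg]
      simp_rw [intervalIntegral.integral_const_mul]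
    have h4 : |∫ s in (l : ℝ)..t, (1 / 2 * ∑ a, ∑ b, val (vertHess F a b) t (stopAt x t) *
          S (pt hx s.toNNReal) a b + val (horizDeriv F) s.toNNReal (stopAt x s.toNNReal))| ≤
        ∫ s in (l : ℝ)..t, ε * ∑ a, ∑ b, |S (pt hx s.toNNReal) a b| := by
      rw [← Real.norm_eq_abs]
      refine intervalIntegral.norm_integral_le_of_norm_le hltR (.of_forall fun s hs => ?_)
        ((intervalIntegrable_sum_sum fun a b => (hSint a b).abs).const_mul _)
      have hs' : s.toNNReal ∈ Ioc s₁ t := by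
        constructor
        · exact hls₁.trans_le (NNReal.le_toNNReal_of_coe_le hs.1.le)
        · exact Real.toNNReal_le_iff_le_coe.2 hs.2
      have h5 := h1 hs'
      have h6 := hharm s.toNNReal
      rw [← val_stopAt (horizDeriv F) hx] at h6
      simp only [← val_stopAt (vertHess F _ _) hx] at h6
      -- Harmonicity at time s replaces 𝒟F by minus half the pairing with the Hessian at s, leaving
      -- only the variation of the Hessian between s and t.
      have h7 : 1 / 2 * ∑ a, ∑ b, val (vertHess F a b) t (stopAt x t) *
          S (pt hx s.toNNReal) a b + val (horizDeriv F) s.toNNReal (stopAt x s.toNNReal) =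
          - (1 / 2 * ∑ a, ∑ b, (val (vertHess F a b) s.toNNReal (stopAt x s.toNNReal) -
            val (vertHess F a b) t (stopAt x t)) * S (pt hx s.toNNReal) a b) := by
        simp only [sub_mul, Finset.sum_sub_distrib]
        linarith
      rw [h7, norm_neg, Real.norm_eq_abs, abs_mul, abs_of_pos (by norm_num : (0 : ℝ) < 1 / 2)]
      have h8 : |∑ a, ∑ b, (val (vertHess F a b) s.toNNReal (stopAt x s.toNNReal) -
            val (vertHess F a b) t (stopAt x t)) * S (pt hx s.toNNReal) a b| ≤
          ε * ∑ a, ∑ b, |S (pt hx s.toNNReal) a b| := by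
        rw [Finset.mul_sum]
        refine (Finset.abs_sum_le_sum_abs _ _).trans (Finset.sum_le_sum fun a _ => ?_)
        rw [Finset.mul_sum]
        refine (Finset.abs_sum_le_sum_abs _ _).trans (Finset.sum_le_sum fun b _ => ?_)
        rw [abs_mul]
        exact mul_le_mul_of_nonneg_right (h5 a b).le (abs_nonneg _)
      linarith [abs_nonneg (∑ a, ∑ b, (val (vertHess F a b) s.toNNReal (stopAt x s.toNNReal) -
            val (vertHess F a b) t (stopAt x t)) * S (pt hx s.toNNReal) a b)]
    have h9 : ∫ s in (l : ℝ)..t, ε * ∑ a, ∑ b, |S (pt hx s.toNNReal) a b| =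
        ε * (∑ a, ∑ b, (∫ s in (0 : ℝ)..t, |S (pt hx s.toNNReal) a b|) -
          ∑ a, ∑ b, ∫ s in (0 : ℝ)..l, |S (pt hx s.toNNReal) a b|) := by
      rw [intervalIntegral.integral_const_mul, integral_sum_sum fun a b => (hSint a b).abs,
        ← Finset.sum_sub_distrib]
      congr 1
      refine Finset.sum_congr rfl fun a _ => ?_
      rw [← Finset.sum_sub_distrib]
      refine Finset.sum_congr rfl fun b _ => ?_
      exact (intervalIntegral.integral_interval_sub_left (hint t a b).abs (hint l a b).abs).symm
    rw [← h3, h9] at h4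
    have e : A t + horizInt F x t - (A l + horizInt F x l) =
      (A t - A l - 1 / 2 * ∑ a, ∑ b, val (vertHess F a b) t (stopAt x t) *
          (∫ s in (l : ℝ)..t, S (pt hx s.toNNReal) a b)) +
      (1 / 2 * ∑ a, ∑ b, val (vertHess F a b) t (stopAt x t) *
          (∫ s in (l : ℝ)..t, S (pt hx s.toNNReal) a b) + (horizInt F x t - horizInt F x l)) := by
      ring
    rw [e]
    refine (abs_add_le _ _).trans ((add_le_add h2 h4).trans (le_of_eq ?_))
    simp only [hw]
    ring
  have hup := le_of_left_increments (E := fun t => A t + horizInt F x t) (w := w)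
    (fun t => (hAc t).add hIc.continuousWithinAt) (fun t => hwc.continuousWithinAt)
    (fun t ht ε hε => by
      obtain ⟨l, hl, h⟩ := key t ht ε hε
      exact ⟨l, hl, (abs_le.1 h).2⟩) t
  have hdown := le_of_left_increments (E := fun t => -(A t + horizInt F x t)) (w := w)
    (fun t => ((hAc t).add hIc.continuousWithinAt).neg) (fun t => hwc.continuousWithinAt)
    (fun t ht ε hε => by
      obtain ⟨l, hl, h⟩ := key t ht ε hε
      exact ⟨l, hl, by linarith [(abs_le.1 h).1]⟩) t
  simp only [hA0, hI0] at hup hdown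
  rw [(exists_pathInt hΩ hF hx hq hA t).1, val_stopAt F hx, val_stopAt F hx]
  linarith

end Density

/-! ### Regularity in time of limits taken in n -/

section Iterated

/-- If g(s) is the limit of f(n, w s n) at admissible times, then for s near t it lies in every
closed neighbourhood of a that eventually contains f. -/
lemma tendsto_of_alongConstraint {C : ℕ → Set ℝ≥0} {t : ℝ≥0} {f : ℕ × ℝ≥0 → ℝ} {a : ℝ}
    (hf : Tendsto f (alongConstraint C t) (𝓝 a)) {l : Filter ℝ≥0} (hl : l ≤ 𝓝 t)
    {w : ℝ≥0 → ℕ → ℝ≥0} {g : ℝ≥0 → ℝ}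
    (hw : ∀ᶠ s in l, Tendsto (w s) atTop (𝓝 s) ∧ (∀ᶠ n in atTop, w s n ∈ C n) ∧
      Tendsto (fun n => f (n, w s n)) atTop (𝓝 (g s))) : Tendsto g l (𝓝 a) := by
  refine (closed_nhds_basis a).tendsto_right_iff.2 fun s ⟨hs, hsc⟩ => ?_
  have h1 : ∀ᶠ z in alongConstraint C t, f z ∈ s := hf hs
  rw [Filter.Eventually, alongConstraint, mem_inf_principal] at h1
  obtain ⟨pa, hpa, pb, hpb, hp⟩ := eventually_prod_iff.1 h1
  filter_upwards [hw, hl (eventually_eventually_nhds.2 hpb)] with u ⟨h2, h3, h4⟩ h5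
  refine hsc.mem_of_tendsto h4 ?_
  filter_upwards [hpa, h2.eventually h5, h3] with n h6 h7 h8
  exact hp h6 h7 h8

variable {P : PartitionSeq} {f : ℕ × ℝ≥0 → ℝ} {I J : ℝ≥0 → ℝ}

lemma regular_right (hI : ∀ t, Tendsto f (P.nearRight t) (𝓝 (I t))) (t : ℝ≥0) :
    Tendsto I (𝓝[≥] t) (𝓝 (I t)) := by
  refine tendsto_of_alongConstraint (hI t) nhdsWithin_le_nhds (w := fun s _ => s) ?_
  filter_upwards [self_mem_nhdsWithin] with s hs
  exact ⟨tendsto_const_nhds, .of_forall fun n => (P.prev_le n t).trans hs,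
    (hI s).comp (P.nearRight_const s)⟩

lemma regular_left (hI : ∀ t, Tendsto f (P.nearRight t) (𝓝 (I t)))
    (hJ : ∀ t, Tendsto f (P.nearLeftStrict t) (𝓝 (J t))) (t : ℝ≥0) :
    Tendsto I (𝓝[<] t) (𝓝 (J t)) := by
  refine tendsto_of_alongConstraint (hJ t) nhdsWithin_le_nhds (w := fun s _ => s) ?_
  filter_upwards [self_mem_nhdsWithin] with s hs
  exact ⟨tendsto_const_nhds, P.eventually_lt_prev hs, (hI s).comp (P.nearRight_const s)⟩

lemma regular_right' (hI : ∀ t, Tendsto f (P.nearRight t) (𝓝 (I t)))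
    (hJ : ∀ t, Tendsto f (P.nearLeftStrict t) (𝓝 (J t))) (t : ℝ≥0) :
    Tendsto J (𝓝[>] t) (𝓝 (I t)) := by
  refine tendsto_of_alongConstraint (hI t) nhdsWithin_le_nhds
    (w := fun s n => P.prev n (P.prev n s)) ?_
  filter_upwards [self_mem_nhdsWithin] with s hs
  refine ⟨P.tendsto_prev_prev s, ?_, (hJ s).comp (P.nearLeftStrict_prev_prev (pos_of_gt hs))⟩
  filter_upwards [(P.tendsto_prev_prev s).eventually (eventually_gt_nhds hs)] with n hn
  exact (P.prev_le n t).trans hn.le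

lemma regular_left' (hJ : ∀ t, Tendsto f (P.nearLeftStrict t) (𝓝 (J t))) (t : ℝ≥0) :
    Tendsto J (𝓝[≤] t) (𝓝 (J t)) := by
  -- The value at t itself is automatic, so only times strictly before t matter.
  refine (continuousWithinAt_Iio_iff_Iic.1 ?_ : ContinuousWithinAt J (Iic t) t)
  rcases eq_zero_or_pos t with rfl | ht
  · simp [ContinuousWithinAt]
  refine tendsto_of_alongConstraint (hJ t) nhdsWithin_le_nhds
    (w := fun s n => P.prev n (P.prev n s)) ?_
  filter_upwards [Ioo_mem_nhdsLT ht] with s hs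
  refine ⟨P.tendsto_prev_prev s, ?_, (hJ s).comp (P.nearLeftStrict_prev_prev hs.1)⟩
  filter_upwards [P.eventually_lt_prev hs.2] with n hn
  exact ((P.prev_le _ _).trans (P.prev_le _ _)).trans_lt hn

end Iterated

/-! ### The integral functional and its membership in the class ℳ -/

section Martingale

variable {m : ℕ} {Ω : Set (CPath m)} {P : PartitionSeq} {F : domain Ω → ℝ} {x y : CPath m}

/-- The step path looks ahead to the right end of each interval. Before t_i these ends are at most
t_i < t, so only values strictly before t enter. -/
lemma approx_congr {n i : ℕ} {t : ℝ≥0} (hi : i < P.k n) (hit : P.t n i < t)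
    (h : ∀ s < t, x s = y s) {s : ℝ≥0} (hs : s < P.t n i) : approx P x n s = approx P y n s := by
  obtain ⟨j, hj, h1, h2⟩ := P.exists_index (hs.trans ((P.t_lt_iff hi.le le_rfl).2 hi))
  have hji : j < i := (P.t_lt_iff hj.le hi.le).1 (h1.trans_lt hs)
  rw [approx_apply P x hj h1 h2, approx_apply P y hj h1 h2]
  exact h _ (((P.t_le_iff hj hi.le).2 hji).trans_lt hit)

lemma stopAtLeft_approx_congr {n i j : ℕ} {t : ℝ≥0} (hi : i < P.k n) (hi0 : 0 < i)
    (hit : P.t n i < t) (h : ∀ s < t, x s = y s) (hji : j ≤ i) :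
    stopAtLeft (approx P x n) (P.t n j) = stopAtLeft (approx P y n) (P.t n j) := by
  rcases j with _ | j
  · rw [P.t_zero, stopAtLeft_zero, stopAtLeft_zero]
    refine stopAt_congr fun s hs => approx_congr hi hit h (hs.trans_lt ?_)
    rw [← P.t_zero n]
    exact (P.t_lt_iff (Nat.zero_le _) hi.le).2 hi0
  · have hj : j < P.k n := by omega
    refine stopAtLeft_congr (pos_of_gt (P.t_lt_succ hj))
      ⟨_, leftLim_approx P x hj (P.t_lt_succ hj) le_rfl⟩ fun s hs => ?_
    exact approx_congr hi hit h (hs.trans_le ((P.t_le_iff hj hi.le).2 hji))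

/-- Paths that agree strictly before `t` have pathwise integrals differing by the last jump. -/
lemma pathInt_sub (hΩ : IsGeneric P Ω) (hQ : Ω ⊆ finiteQV P m) (hF : IsC12 P F) (hx : x ∈ Ω)
    (hy : y ∈ Ω) {t : ℝ≥0} (ht : 0 < t) (h : ∀ s < t, x s = y s) :
    pathInt P F x t - pathInt P F y t =
      ∑ a, val (vertGradComp F a) t (stopAtLeft x t) * (x t a - y t a) := by
  have h1 := ((tendsto_pathInt hΩ hQ hF hx t).1.comp (P.nearRight_prev t)).sub
    ((tendsto_pathInt hΩ hQ hF hy t).1.comp (P.nearRight_prev t))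
  have hxc := hΩ.cadlag x hx
  have hj := (tendsto_jump_prev (P := P) hxc ht).sub
    (tendsto_jump_prev (P := P) (hΩ.cadlag y hy) ht)
  have hlim : Function.leftLim x t = Function.leftLim y t :=
    leftLim_congr ht (by filter_upwards [self_mem_nhdsWithin] with s hs using h s hs) (hxc t).2
  have hjt : jump x t - jump y t = x t - y t := by simp [jump, hlim]
  rw [hjt] at hj
  have h2 := tendsto_finsetSum Finset.univ fun (a : Fin m) _ =>
    (((hF.grad_leftCts a).minus_nearLeft hΩ hx t).comp (P.nearLeft_prev t)).mul
    (((EuclideanSpace.proj (𝕜 := ℝ) a).continuous.tendsto _).comp hj)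
  refine tendsto_nhds_unique h1 (Tendsto.congr' ?_ h2)
  filter_upwards [eventually_exists_prev P ht] with n ⟨i, hi, h5, h6, h7, _⟩
  have hi0 : 0 < i := by
    rcases Nat.eq_zero_or_pos i with rfl | hp
    · simp [P.t_zero] at h6
    · exact hp
  have hJ : ∀ z : CPath m, jump (approx P z n) (P.t n i) = incr P z n i := fun z => by
    rcases jump_approx_cases (P := P) z hi with ⟨h8, -⟩ | ⟨-, h8⟩
    · omega
    · exact h8
  simp only [Function.comp, ← h5, hJ]
  -- Only the straddling increment, of index i, sees the difference between the two paths, and its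
  -- integrand is the same for both.
  rw [riemannSum, riemannSum, ← Finset.sum_sub_distrib, Finset.sum_eq_single i]
  · rw [← stopAtLeft_approx_congr hi hi0 h7 h le_rfl, ← inner_sub_right, inner_vertGrad]
    rfl
  · intro j hj hji
    simp only [Finset.mem_filter, Finset.mem_range] at hj
    have hji' : j < i := lt_of_le_of_ne ((P.t_le_iff hj.1.le hi.le).1 hj.2) hji
    have e1 : P.t n (j + 1) < t := ((P.t_le_iff hj.1 hi.le).2 hji').trans_lt h7
    rw [stopAtLeft_approx_congr hi hi0 h7 h hji'.le, h _ e1, h _ (hj.2.trans_lt h7), sub_self]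
  · intro hni
    exact absurd (Finset.mem_filter.2 ⟨Finset.mem_range.2 hi, le_refl (P.t n i)⟩) hni

lemma eventually_k_pos (P : PartitionSeq) : ∀ᶠ n in atTop, 0 < P.k n := by
  filter_upwards [P.eventually_lt_last 0] with n hn
  by_contra! h
  rw [Nat.le_zero.1 h, P.t_zero] at hn
  exact lt_irrefl _ hn

lemma pathInt_zero (hΩ : IsGeneric P Ω) (hF : IsC12 P F) (hx : x ∈ Ω) : pathInt P F x 0 = 0 := by
  refine Tendsto.limUnder_eq ((tendsto_initTerm hΩ hF.grad_leftCts hx).congr' ?_)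
  filter_upwards [eventually_k_pos P] with n hn
  rw [riemannSum_eq_stepSum F x 0 hn, left_eq_add]
  unfold stepSum
  refine Finset.sum_eq_zero fun i hi => ?_
  simp only [Finset.mem_filter] at hi
  simp [nonpos_iff_eq_zero.1 hi.2, jump_zero]

/-- The Riemann sums up to t look beyond t and may differ for x and x_t; the limits agree because
the paths have equal values up to and including t. -/
lemma pathInt_stopAt (hΩ : IsGeneric P Ω) (hQ : Ω ⊆ finiteQV P m) (hF : IsC12 P F) (hx : x ∈ Ω)
    (t : ℝ≥0) : pathInt P F (stopAt x t) t = pathInt P F x t := by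
  rcases eq_zero_or_pos t with rfl | ht
  · rw [pathInt_zero hΩ hF hx, pathInt_zero hΩ hF (hΩ.stopAt_mem hx 0)]
  · have := pathInt_sub hΩ hQ hF hx (hΩ.stopAt_mem hx t) ht fun s hs =>
      (stopAt_apply_of_le x hs.le).symm
    simp only [stopAt_apply_self, sub_self, mul_zero, Finset.sum_const_zero] at this
    linarith

/-- Here the sums themselves coincide: increments starting after t vanish. -/
lemma pathInt_later {s t : ℝ≥0} (hy : stopAt y t = y) (h : t ≤ s) :
    pathInt P F y s = pathInt P F y t := by
  unfold pathInt
  congr 1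
  funext n
  refine (Finset.sum_subset ?_ fun i hi hni => ?_).symm
  · intro i hi
    simp only [Finset.mem_filter] at hi ⊢
    exact ⟨hi.1, hi.2.trans h⟩
  · simp only [Finset.mem_filter, not_and, not_le] at hi hni
    have h1 := hni hi.1
    have h2 := h1.trans (P.t_lt_succ (Finset.mem_range.1 hi.1))
    have e : ∀ u, t ≤ u → y u = y t := fun u hu => by
      rw [← hy]; simp [stopAt, hu]
    rw [e _ h2.le, e _ h1.le, sub_self, inner_zero_right]

variable (P F) in
/-- The functional `F(0, x_0) + ∫ ∇ₓF dx`. -/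
def integralFunctional : domain Ω → ℝ := fun z =>
  val F 0 (stopAt z.1.2 0) + pathInt P F z.1.2 z.1.1

lemma val_integralFunctional {t : ℝ≥0} (h : (t, y) ∈ domain Ω) :
    val (integralFunctional P F) t y = val F 0 (stopAt y 0) + pathInt P F y t := by
  rw [val_of_mem _ h]; rfl

lemma val_integralFunctional_stopAt (hΩ : IsGeneric P Ω) (hQ : Ω ⊆ finiteQV P m)
    (hF : IsC12 P F) (hx : x ∈ Ω) (t : ℝ≥0) :
    val (integralFunctional P F) t (stopAt x t) = val F 0 (stopAt x 0) + pathInt P F x t := by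
  rw [val_integralFunctional (domain_stopAt hx t), stopAt_stopAt _ zero_le,
    pathInt_stopAt hΩ hQ hF hx]

lemma val_integralFunctional_later (hΩ : IsGeneric P Ω) {t s : ℝ≥0} (h : (t, y) ∈ domain Ω)
    (hts : t ≤ s) :
    val (integralFunctional P F) s y = val (integralFunctional P F) t y := by
  rw [val_integralFunctional h, val_integralFunctional (hΩ.domain_later h hts),
    pathInt_later (stopAt_of_domain h :) hts]

lemma val_integralFunctional_bump (hΩ : IsGeneric P Ω) (hQ : Ω ⊆ finiteQV P m)
    (hF : IsC12 P F) (hx : x ∈ Ω) {t : ℝ≥0} (ht : 0 < t) {e : Vec m}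
    (he : stopAt x t + bump t e ∈ Ω) :
    val (integralFunctional P F) t (stopAt x t + bump t e) =
      val (integralFunctional P F) t (stopAt x t) +
        ∑ a, val (vertGradComp F a) t (stopAtLeft x t) * e a := by
  have hdom : (t, stopAt x t + bump t e) ∈ domain Ω := ⟨_, he, (stopAt_add_bump x t e).symm⟩
  have hagree : ∀ s < t, x s = (stopAt x t + bump t e) s := fun s hs => by
    simp [stopAt, bump, hs.le, hs.not_ge]
  have h0 : stopAt (stopAt x t + bump t e) 0 = stopAt x 0 :=
    stopAt_congr fun s hs => (hagree s (hs.trans_lt ht)).symm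
  have h1 := pathInt_sub hΩ hQ hF hx he ht hagree
  have h2 : ∀ a, x t a - (stopAt x t + bump t e) t a = -e a := fun a => by
    simp [stopAt, bump]
  simp only [h2, mul_neg, Finset.sum_neg_distrib] at h1
  rw [val_integralFunctional_stopAt hΩ hQ hF hx, val_integralFunctional hdom, h0]
  linarith

lemma val_integralFunctional_stopAtLeft (hΩ : IsGeneric P Ω) (hQ : Ω ⊆ finiteQV P m)
    (hF : IsC12 P F) (hx : x ∈ Ω) (t : ℝ≥0) :
    val (integralFunctional P F) t (stopAtLeft x t) =
      val (integralFunctional P F) t (stopAt x t) -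
        ∑ a, val (vertGradComp F a) t (stopAtLeft x t) * jump x t a := by
  rcases eq_zero_or_pos t with rfl | ht
  · simp [stopAtLeft_zero, jump_zero]
  · have hmem := hΩ.stopAtLeft_mem hx t
    rw [stopAtLeft_eq] at hmem
    have := val_integralFunctional_bump hΩ hQ hF hx ht hmem
    rw [← stopAtLeft_eq] at this
    rw [this]
    simp [Finset.sum_neg_distrib, sub_eq_add_neg]

lemma horiz_integralFunctional (hΩ : IsGeneric P Ω) :
    HorizDifferentiable (integralFunctional (Ω := Ω) P F) ∧
      ∀ z, horizDeriv (integralFunctional (Ω := Ω) P F) z = 0 := by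
  have h : ∀ z : domain Ω, (fun h : ℝ≥0 => (val (integralFunctional P F) (z.1.1 + h) z.1.2 -
      integralFunctional P F z) / (h : ℝ)) = fun _ => 0 := by
    intro z
    funext h
    rw [val_integralFunctional_later hΩ z.2 le_self_add, val_coe, sub_self, zero_div]
  refine ⟨fun z => ⟨0, ?_⟩, fun z => ?_⟩
  · rw [h]; exact tendsto_const_nhds
  · rw [horizDeriv, h]
    exact tendsto_const_nhds.limUnder_eq

/-- For t > 0 the functional is affine in the perturbation with slope ∇F(t, x_{t-}). At t = 0 the
integral vanishes, so the perturbation acts through F(0, ·), and x_{0-} = x_0. -/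
lemma hasGradientAt_integralFunctional (hΩ : IsGeneric P Ω) (hQ : Ω ⊆ finiteQV P m)
    (hF : IsC12 P F) (z : domain Ω) :
    HasGradientAt (fun e : Vec m => val (integralFunctional P F) z.1.1 (z.1.2 + bump z.1.1 e))
      (minus (vertGrad F) z) 0 := by
  obtain ⟨⟨t, w⟩, hz⟩ := z
  have hw : w ∈ Ω := hΩ.mem_of_domain hz
  have stoppedEq : stopAt w t = w := stopAt_of_domain hz
  obtain ⟨U, hU⟩ := hΩ.vert w hw t
  rcases eq_zero_or_pos t with rfl | ht
  · have hm : minus (vertGrad F) ⟨(0, w), hz⟩ = vertGrad F ⟨(0, w), hz⟩ := by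
      rw [minus]
      simp only [stopAtLeft_zero, stoppedEq]
      rw [val_of_mem _ hz]
    rw [hm]
    refine (hF.vertDifferentiable ⟨(0, w), hz⟩).hasGradientAt.congr_of_eventuallyEq ?_
    filter_upwards [hU.2.1] with e he
    have hdom := hU.mem_domain he
    have hmem := hU.2.2.2 e he
    have hst := stopAt_add_bump w 0 e
    rw [stoppedEq] at hdom hmem hst
    rw [val_integralFunctional hdom, pathInt_zero hΩ hF hmem, hst, add_zero]
  · have hlin : HasGradientAt (fun e : Vec m => val (integralFunctional P F) t w +
        inner ℝ (minus (vertGrad F) ⟨(t, w), hz⟩) e) (minus (vertGrad F) ⟨(t, w), hz⟩) 0 := by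
      rw [hasGradientAt_iff_hasFDerivAt]
      exact ((InnerProductSpace.toDual ℝ (Vec m)
        (minus (vertGrad F) ⟨(t, w), hz⟩)).hasFDerivAt).const_add _
    refine hlin.congr_of_eventuallyEq ?_
    filter_upwards [hU.2.1] with e he
    have hmem := hU.2.2.2 e he
    have := val_integralFunctional_bump hΩ hQ hF hw ht hmem
    rw [stoppedEq] at this
    rw [this, minus, inner_vertGrad]

lemma vertGrad_integralFunctional (hΩ : IsGeneric P Ω) (hQ : Ω ⊆ finiteQV P m)
    (hF : IsC12 P F) : vertGrad (integralFunctional P F) = minus (vertGrad F) := by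
  funext z
  exact (hasGradientAt_integralFunctional hΩ hQ hF z).gradient

lemma vertGradComp_integralFunctional (hΩ : IsGeneric P Ω) (hQ : Ω ⊆ finiteQV P m)
    (hF : IsC12 P F) (a : Fin m) :
    vertGradComp (integralFunctional P F) a = minus (vertGradComp F a) := by
  funext z
  rw [vertGradComp, vertGrad_integralFunctional hΩ hQ hF, minus, minus, val_vertGrad]

/-- The integral functional along step approximations is a Riemann sum. -/
lemma integralFunctional_approx (hΩ : IsGeneric P Ω) (hQ : Ω ⊆ finiteQV P m)
    (hF : IsC12 P F) (hx : x ∈ Ω) (T : ℝ≥0) : ∀ᶠ n in atTop, ∀ u ≤ T,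
      val (integralFunctional P F) u (stopAt (approx P x n) u) =
        val F 0 (stopAt (approx P x n) 0) - initTerm P F x n +
          riemannSum P (vertGrad F) x u n ∧
      val (integralFunctional P F) u (stopAtLeft (approx P x n) u) =
        val F 0 (stopAt (approx P x n) 0) - initTerm P F x n +
          riemannSum P (vertGrad F) x (P.prev n u) n := by
  filter_upwards [P.eventually_lt_last T, hΩ.approx_stop hx T, eventually_k_pos P]
    with n hT ⟨y, hy, hyn⟩ hk
  have hdom : ∀ u ≤ T, (u, stopAt (approx P x n) u) ∈ domain Ω := fun u hu => by
    rw [← (hyn u hu).1]; exact domain_stopAt hy u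
  obtain ⟨h1, h2⟩ := step_telescope (P := P) (n := n)
    (α := fun u => val (integralFunctional P F) u (stopAt (approx P x n) u))
    (β := fun u => val (integralFunctional P F) u (stopAtLeft (approx P x n) u))
    -- A frozen path adds nothing to the integral, so there is no horizontal part.
    (S := fun _ => 0) hT (by simp [stopAtLeft_zero])
    (fun i hi u hu h1 h2 => by
      rw [stopAt_approx P x hi h1 h2,
        val_integralFunctional_later hΩ (hdom _ (h1.trans hu)) h1, sub_self, sub_self])
    (fun i hi u hu h1 h2 => by
      rw [stopAtLeft_approx P x hi h1 h2,
        val_integralFunctional_later hΩ (hdom _ (h1.le.trans hu)) h1.le, sub_self, sub_self])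
  have h0 : val (integralFunctional P F) 0 (stopAt (approx P x n) 0) =
      val F 0 (stopAt (approx P x n) 0) := by
    rw [← (hyn 0 zero_le).1, val_integralFunctional_stopAt hΩ hQ hF hy, pathInt_zero hΩ hF hy,
      add_zero]
  have hjump : ∀ u ≤ T, val (integralFunctional P F) u (stopAt (approx P x n) u) -
      val (integralFunctional P F) u (stopAtLeft (approx P x n) u) =
      ∑ a, val (vertGradComp F a) u (stopAtLeft (approx P x n) u) *
        jump (approx P x n) u a := by
    intro u hu
    have hj : jump y u = jump (approx P x n) u := by
      have e1 := congrFun (hyn u hu).1 u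
      have e2 := congrFun (hyn u hu).2 u
      simp only [stopAt_apply_self] at e1
      simp only [stopAtLeft, lt_irrefl, if_false] at e2
      rw [jump, jump, e1, e2]
    rw [← (hyn u hu).1, ← (hyn u hu).2, val_integralFunctional_stopAtLeft hΩ hQ hF hy, hj]
    ring
  have hsum : ∀ u ≤ T, stepSum P (fun n' i =>
      val (integralFunctional P F) (P.t n' i) (stopAt (approx P x n) (P.t n' i)) -
        val (integralFunctional P F) (P.t n' i) (stopAtLeft (approx P x n) (P.t n' i))) n u =
      riemannSum P (vertGrad F) x u n - initTerm P F x n := by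
    intro u hu
    rw [riemannSum_eq_stepSum F x u hk, add_sub_cancel_left]
    refine Finset.sum_congr rfl fun i hi => ?_
    simp only [Finset.mem_filter] at hi
    exact hjump _ (hi.2.trans hu)
  have hright : ∀ u ≤ T, val (integralFunctional P F) u (stopAt (approx P x n) u) =
        val F 0 (stopAt (approx P x n) 0) - initTerm P F x n +
          riemannSum P (vertGrad F) x u n := by
    intro u hu
    have := h1 u hu
    rw [hsum u hu] at this
    simp only [h0] at this
    linarith
  refine fun u hu => ⟨hright u hu, ?_⟩
  rcases eq_zero_or_pos u with rfl | hu0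
  · rw [stopAtLeft_zero, P.prev_zero]
    exact hright 0 hu
  · have := h2 u hu hu0
    rw [hsum _ ((P.prev_le n u).trans hu)] at this
    simp only [h0] at this
    linarith

lemma tendsto_initial (hΩ : IsGeneric P Ω) (hF : IsC12 P F) (hx : x ∈ Ω) :
    Tendsto (fun n => val F 0 (stopAt (approx P x n) 0) - initTerm P F x n) atTop
      (𝓝 (val F 0 (stopAt x 0))) := by
  have h1 := (hF.continuous.rightCts hΩ).c x hx 0 (fun _ => 0) tendsto_const_nhds
    (.of_forall fun n => P.prev_le n 0)
  simpa using h1.sub (tendsto_initTerm hΩ hF.grad_leftCts hx)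

lemma tendsto_integralFunctional_approx (hΩ : IsGeneric P Ω) (hQ : Ω ⊆ finiteQV P m)
    (hF : IsC12 P F) (hx : x ∈ Ω) {t : ℝ≥0} {u : ℕ → ℝ≥0} (hu : Tendsto u atTop (𝓝 t)) {c : ℝ}
    (hc : Tendsto (fun n => riemannSum P (vertGrad F) x (u n) n) atTop (𝓝 c)) :
    Tendsto (fun n => val (integralFunctional P F) (u n) (stopAt (approx P x n) (u n))) atTop
      (𝓝 (val F 0 (stopAt x 0) + c)) := by
  refine ((tendsto_initial hΩ hF hx).add hc).congr' ?_
  filter_upwards [integralFunctional_approx hΩ hQ hF hx (t + 1),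
    hu.eventually (eventually_le_nhds (show t < t + 1 by simp))] with n h1 h2
  exact (h1 _ h2).1.symm

lemma tendsto_integralFunctional_approx_left (hΩ : IsGeneric P Ω) (hQ : Ω ⊆ finiteQV P m)
    (hF : IsC12 P F) (hx : x ∈ Ω) {t : ℝ≥0} {u : ℕ → ℝ≥0} (hu : Tendsto u atTop (𝓝 t)) {c : ℝ}
    (hc : Tendsto (fun n => riemannSum P (vertGrad F) x (P.prev n (u n)) n) atTop (𝓝 c)) :
    Tendsto (fun n => val (integralFunctional P F) (u n) (stopAtLeft (approx P x n) (u n))) atTop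
      (𝓝 (val F 0 (stopAt x 0) + c)) := by
  refine ((tendsto_initial hΩ hF hx).add hc).congr' ?_
  filter_upwards [integralFunctional_approx hΩ hQ hF hx (t + 1),
    hu.eventually (eventually_le_nhds (show t < t + 1 by simp))] with n h1 h2
  exact (h1 _ h2).2.symm

variable (P F) in
/-- The left limits of the pathwise integral. -/
def pathIntLeft (x : CPath m) (t : ℝ≥0) : ℝ :=
  pathInt P F x t - ∑ a, val (vertGradComp F a) t (stopAtLeft x t) * jump x t a

lemma val_integralFunctional_stopAtLeft' (hΩ : IsGeneric P Ω) (hQ : Ω ⊆ finiteQV P m)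
    (hF : IsC12 P F) (hx : x ∈ Ω) (t : ℝ≥0) :
    val (integralFunctional P F) t (stopAtLeft x t) =
      val F 0 (stopAt x 0) + pathIntLeft P F x t := by
  rw [val_integralFunctional_stopAtLeft hΩ hQ hF hx, val_integralFunctional_stopAt hΩ hQ hF hx,
    pathIntLeft]
  ring

lemma tendsto_riemannSum_right (hΩ : IsGeneric P Ω) (hQ : Ω ⊆ finiteQV P m)
    (hF : IsC12 P F) (hx : x ∈ Ω) {t : ℝ≥0} {u : ℕ → ℝ≥0} (hu : Tendsto u atTop (𝓝 t))
    (hC : ∀ᶠ n in atTop, P.prev n t ≤ u n) :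
    Tendsto (fun n => riemannSum P (vertGrad F) x (u n) n) atTop (𝓝 (pathInt P F x t)) := by
  have h := P.tendsto_nearRight (f := fun n => n) tendsto_id hu hC
  intro s hs
  exact h ((tendsto_pathInt hΩ hQ hF hx t).1 hs)

lemma tendsto_riemannSum_left (hΩ : IsGeneric P Ω) (hQ : Ω ⊆ finiteQV P m)
    (hF : IsC12 P F) (hx : x ∈ Ω) {t : ℝ≥0} {u : ℕ → ℝ≥0} (hu : Tendsto u atTop (𝓝 t))
    (hC : ∀ᶠ n in atTop, u n < P.prev n t) :
    Tendsto (fun n => riemannSum P (vertGrad F) x (u n) n) atTop (𝓝 (pathIntLeft P F x t)) := by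
  have h := P.tendsto_nearLeftStrict (f := fun n => n) tendsto_id hu hC
  intro s hs
  exact h ((tendsto_pathInt hΩ hQ hF hx t).2 hs)

lemma rightCts_integralFunctional (hΩ : IsGeneric P Ω) (hQ : Ω ⊆ finiteQV P m)
    (hF : IsC12 P F) : RightCts P (integralFunctional (Ω := Ω) P F) where
  a x hx t := by
    simp only [val_integralFunctional_stopAt hΩ hQ hF hx]
    exact (regular_right (fun t => (tendsto_pathInt hΩ hQ hF hx t).1) t).const_add _
  b x hx t := by
    simp only [val_integralFunctional_stopAt hΩ hQ hF hx,
      val_integralFunctional_stopAtLeft' hΩ hQ hF hx]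
    exact (regular_right' (fun t => (tendsto_pathInt hΩ hQ hF hx t).1)
      (fun t => (tendsto_pathInt hΩ hQ hF hx t).2) t).const_add _
  c x hx t u hu hC := by
    rw [val_integralFunctional_stopAt hΩ hQ hF hx]
    exact tendsto_integralFunctional_approx hΩ hQ hF hx hu
      (tendsto_riemannSum_right hΩ hQ hF hx hu hC)
  d x hx t u hu hC := by
    rw [val_integralFunctional_stopAt hΩ hQ hF hx]
    refine tendsto_integralFunctional_approx_left hΩ hQ hF hx hu ?_
    -- The left value at u is a Riemann sum up to `prev n (u n)`. This time is still on the right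
    -- side, since `prev n t` is a partition point before u n.
    have hC' : ∀ᶠ n in atTop, P.prev n t ≤ P.prev n (u n) := by
      filter_upwards [hC] with n hn
      rcases eq_zero_or_pos t with rfl | ht
      · rw [P.prev_zero]; exact zero_le
      · obtain ⟨i, hi, h1, -⟩ := P.exists_eq_prev n ht
        rw [← h1] at hn ⊢
        exact P.le_prev hi hn
    exact tendsto_riemannSum_right hΩ hQ hF hx (P.tendsto_prev_comp hu) hC'

lemma leftCts_integralFunctional (hΩ : IsGeneric P Ω) (hQ : Ω ⊆ finiteQV P m)
    (hF : IsC12 P F) : LeftCts P (integralFunctional (Ω := Ω) P F) where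
  a x hx t := by
    simp only [val_integralFunctional_stopAtLeft' hΩ hQ hF hx]
    exact (regular_left' (fun t => (tendsto_pathInt hΩ hQ hF hx t).2) t).const_add _
  b x hx t := by
    simp only [val_integralFunctional_stopAt hΩ hQ hF hx,
      val_integralFunctional_stopAtLeft' hΩ hQ hF hx]
    exact (regular_left (fun t => (tendsto_pathInt hΩ hQ hF hx t).1)
      (fun t => (tendsto_pathInt hΩ hQ hF hx t).2) t).const_add _
  c x hx t u hu hC := by
    rw [val_integralFunctional_stopAtLeft' hΩ hQ hF hx]
    refine tendsto_integralFunctional_approx_left hΩ hQ hF hx hu ?_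
    rcases eq_zero_or_pos t with rfl | ht
    -- At t = 0 no time lies strictly to the left, but the jump is zero and the right limit serves.
    · have h0 : pathIntLeft P F x 0 = pathInt P F x 0 := by simp [pathIntLeft, jump_zero]
      rw [h0]
      refine tendsto_riemannSum_right hΩ hQ hF hx (P.tendsto_prev_comp hu) (.of_forall fun n => ?_)
      rw [P.prev_zero]; exact zero_le
    · refine tendsto_riemannSum_left hΩ hQ hF hx (P.tendsto_prev_comp hu) ?_
      filter_upwards [hC, hu.eventually (eventually_gt_nhds ht)] with n h1 h2
      exact (P.prev_lt n h2).trans_le h1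
  d x hx t u hu hC := by
    rw [val_integralFunctional_stopAtLeft' hΩ hQ hF hx]
    exact tendsto_integralFunctional_approx hΩ hQ hF hx hu
      (tendsto_riemannSum_left hΩ hQ hF hx hu hC)

/-- The integral functional is of class `ℳ`. -/
lemma isClassM_integralFunctional (hΩ : IsGeneric P Ω) (hQ : Ω ⊆ finiteQV P m)
    (hF : IsC12 P F) : IsClassM P (integralFunctional (Ω := Ω) P F) := by
  obtain ⟨hd, h0⟩ := horiz_integralFunctional (P := P) (F := F) hΩ
  have hval : ∀ t (y : CPath m), val (horizDeriv (integralFunctional (Ω := Ω) P F)) t y = 0 := by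
    intro t y
    unfold val
    split_ifs
    · exact h0 _
    · rfl
  refine ⟨⟨piContinuous_of_leftCts_rightCts (leftCts_integralFunctional hΩ hQ hF)
    (rightCts_integralFunctional hΩ hQ hF), hd,
    fun z => (hasGradientAt_integralFunctional hΩ hQ hF z).differentiableAt, ?_, ?_, ?_, ?_⟩, h0⟩
  · constructor <;> intros <;> simp only [hval] <;> exact tendsto_const_nhds
  · exact fun x hx T => ⟨0, 0, fun n _ t _ => by rw [hval, abs_zero]⟩
  · intro a
    rw [vertGradComp_integralFunctional hΩ hQ hF]
    exact hF.grad_leftCts a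
  · rw [StrictlyCausal, vertGrad_integralFunctional hΩ hQ hF]
    funext z
    obtain ⟨⟨t, w⟩, hz⟩ := z
    exact (val_minus_stopAtLeft hΩ (vertGrad F) (hΩ.mem_of_domain hz) t).symm

end Martingale

end CausalCalculus

end

/-! ### The representation theorem -/

theorem mainTheorem9 {m : ℕ} (P : PartitionSeq) (Ω : Set (CPath m))
    (hΩ : IsGeneric P Ω) (hQ : Ω ⊆ finiteQV P m)
    (S : domain Ω → Matrix (Fin m) (Fin m) ℝ) (hSpos : ∀ z, (S z).PosDef)
    (hScts : ∀ i j, RightCts P (fun z => S z i j))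
    (F : domain Ω → ℝ) (hF : IsHarmonic P S F) :
    ∃ M : domain Ω → ℝ, IsClassM P M ∧
      (∀ x (hx : x ∈ Ω) (t : ℝ≥0),
        HasPathIntegral P (vertGrad F) x t (M (pt hx t) - F (pt hx 0))) ∧
      (∀ x (hx : x ∈ Ω), x ∈ pathsWithDensity P Ω S → ∀ t : ℝ≥0, M (pt hx t) = F (pt hx t)) ∧
      (∀ M' : domain Ω → ℝ,
        (∀ x (hx : x ∈ Ω), x ∈ pathsWithDensity P Ω S → ∀ t : ℝ≥0,
          M' (pt hx t) = F (pt hx t)) →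
        ∀ x (hx : x ∈ Ω), x ∈ pathsWithDensity P Ω S → ∀ t : ℝ≥0,
          M' (pt hx t) = M (pt hx t)) ∧
      (∀ M' : domain Ω → ℝ,
        (∀ x (hx : x ∈ Ω), x ∈ pathsWithDensity P Ω S → ∀ t : ℝ≥0,
          HasPathIntegral P (vertGrad F) x t (M' (pt hx t) - F (pt hx 0))) →
        ∀ x (hx : x ∈ Ω), x ∈ pathsWithDensity P Ω S → ∀ t : ℝ≥0,
          M' (pt hx t) = M (pt hx t)) := by
  have hval0 : ∀ x (hx : x ∈ Ω), val F 0 (stopAt x 0) = F (pt hx 0) := fun x hx => val_stopAt F hx 0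
  have hM : ∀ x (hx : x ∈ Ω) (t : ℝ≥0), integralFunctional P F (pt hx t) - F (pt hx 0) =
      pathInt P F x t := fun x hx t => by
    rw [← val_stopAt (integralFunctional P F) hx,
      val_integralFunctional_stopAt hΩ hQ hF.1 hx, hval0 x hx, add_sub_cancel_left]
  have hMF : ∀ x (hx : x ∈ Ω), x ∈ pathsWithDensity P Ω S → ∀ t : ℝ≥0,
      integralFunctional P F (pt hx t) = F (pt hx t) := fun x hx hxS t => by
    have h1 := hM x hx t
    rw [pathInt_eq_of_density hΩ hSpos hF hx hxS] at h1
    exact sub_left_inj.1 h1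
  refine ⟨integralFunctional P F, isClassM_integralFunctional hΩ hQ hF.1, fun x hx t => ?_, hMF,
    fun M' hM' x hx hxS t => (hM' x hx hxS t).trans (hMF x hx hxS t).symm,
    fun M' hM' x hx hxS t => ?_⟩
  · rw [hM]
    exact hasPathIntegral_pathInt hΩ hQ hF.1 hx t
  · have h1 := tendsto_nhds_unique (hM' x hx hxS t) (hasPathIntegral_pathInt hΩ hQ hF.1 hx t)
    rw [← hM x hx t] at h1
    exact sub_left_inj.1 h1
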